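/- Work over $\mathbb{C}$. Let $G,H$ be algebraic groups and let $V$, $W$ be finite-dimensional (algebraic) linear representations of $G$, $H$ respectively. Let $\mathbb{P}V$ denote the projective space of lines in $V$, and put $a=\dim\mathbb{P}V\ge 0$, $b=\dim\mathbb{P}W$; assume $a<b$. Let $\mathbb{G}(a,\mathbb{P}W)$ be the Grassmannian of $a$-planes in $\mathbb{P}W$, i.e. of $(a+1)$-dimensional linear subspaces of $W$, and let $\mathcal{E}$ be its universal subbundle of rank $a+1$. Let $H_0\subset H$ be the subgroup of elements acting trivially on $\mathbb{P}W$ and $\overline{H}=H/H_0$. For a linear representation $U$ of an algebraic group $K$, $\mathbb{P}U/K$ denotes the rational quotient, i.e. the birational class of varieties with function field $\mathbb{C}(\mathbb{P}U)^K$; and $\sim$ denotes birational equivalence over $\mathbb{C}$. An action is called almost free if a general point has trivial stabilizer. Assume that (1) there is an $H$-linearized line bundle $\mathcal{L}$ on $\mathbb{G}(a,\mathbb{P}W)$ such that $H_0$ acts trivially on $\mathcal{E}\otimes\mathcal{L}$; (2) $\mathbb{P}(V^{\oplus a+1})/G$ is rational of dimension $d\geq a$; (3) $\overline{H}$ acts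 almost freely on $\mathbb{P}W$ and on $\mathbb{G}(a,\mathbb{P}W)$. Then, setting $M=d-a+a(b-a)$, $$\mathbb{P}(V\otimes W)/(G\times H)\;\sim\;\mathbb{C}^M\times(\mathbb{P}W/H).$$ -/

import Mathlib

open scoped TensorProduct
open Module

noncomputable section

namespace RatQuot

/-! ### Spaces with regular functions

A (quasi-affine) variety is handled through its set of points `X` and a `ℂ`-algebra
`A ⊆ (X → ℂ)` of globally defined functions, which determines its Zariski topology and the regular
functions on its open subsets. -/

section Spaces

variable {X Y : Type*}

/-- The algebra of the functions `p ∘ φ`, `p ∈ A`. -/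
def pullbackFun (φ : Y → X) (A : Subalgebra ℂ (X → ℂ)) : Subalgebra ℂ (Y → ℂ) :=
  A.map (AlgHom.pi fun y => Pi.evalAlgHom ℂ (fun _ : X => ℂ) (φ y))

/-- The algebra on a product `X × Y`: sums of products `f x * g y` with `f ∈ A`, `g ∈ B`. -/
def prodFun (A : Subalgebra ℂ (X → ℂ)) (B : Subalgebra ℂ (Y → ℂ)) : Subalgebra ℂ (X × Y → ℂ) :=
  pullbackFun Prod.fst A ⊔ pullbackFun Prod.snd B

/-- Zariski open subsets: unions of principal open sets `{p ≠ 0}`, `p ∈ A`. -/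
def IsZariskiOpen (A : Subalgebra ℂ (X → ℂ)) (U : Set X) : Prop :=
  ∀ x ∈ U, ∃ p ∈ A, p x ≠ 0 ∧ ∀ y, p y ≠ 0 → y ∈ U

/-- `f` is a regular function on (the Zariski open set) `U`: locally a quotient of elements
of `A`. The values of `f` outside `U` are irrelevant. -/
def IsRegularOn (A : Subalgebra ℂ (X → ℂ)) (U : Set X) (f : X → ℂ) : Prop :=
  ∀ x ∈ U, ∃ p ∈ A, ∃ q ∈ A, q x ≠ 0 ∧ ∀ y ∈ U, q y ≠ 0 → f y = p y / q y

end Spaces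

/-! ### Algebraic groups and their representations -/

/-- The structure of an algebraic group over `ℂ` on a group `G` (the group of `ℂ`-points), given by
its finitely generated algebra `O(G)` of regular functions, which is stable under
comultiplication and antipode, and all of whose characters are evaluations at points of `G`.
For an affine algebraic group, the point in `exists_eval` is unique. As only `O(G)` matters
for linear representations, uniqueness is not required: then `G(ℂ)` with `O(G)` is an example
for every algebraic group `G`, affine or not. -/
class AlgGroup (G : Type*) [Group G] where
  /-- the algebra of regular functions -/
  regular : Subalgebra ℂ (G → ℂ)
  fg : regular.FG
  exists_eval : ∀ φ : regular →ₐ[ℂ] ℂ, ∃ g : G, ∀ f : regular, φ f = f.1 g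
  mul_regular : ∀ f ∈ regular, (fun x : G × G => f (x.1 * x.2)) ∈ prodFun regular regular
  inv_regular : ∀ f ∈ regular, (fun g : G => f g⁻¹) ∈ regular

section Rep

variable {G H V W : Type*} [Group G] [Group H] [AddCommGroup V] [Module ℂ V]
  [AddCommGroup W] [Module ℂ W]

/-- `ρ` is a representation of the algebraic group `G`: its matrix coefficients are regular. -/
def IsAlgebraicRep [AlgGroup G] (ρ : Representation ℂ G V) : Prop :=
  ∀ (v : V) (l : Dual ℂ V), (fun g => l (ρ g v)) ∈ AlgGroup.regular (G := G)

/-- The linear automorphism `ρ g`. -/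
def repEquiv (ρ : Representation ℂ G V) (g : G) : V ≃ₗ[ℂ] V :=
  LinearEquiv.ofLinearMap (ρ g) (ρ g⁻¹)
    (by rw [← Module.End.mul_eq_comp, ← map_mul]; simp; rfl)
    (by rw [← Module.End.mul_eq_comp, ← map_mul]; simp; rfl)

/-- The direct sum `V^{⊕n}`. -/
def powRep (ρ : Representation ℂ G V) (n : ℕ) : Representation ℂ G (Fin n → V) where
  toFun g := (ρ g).compLeft (Fin n)
  map_one' := by ext; simp
  map_mul' g h := by ext; simp

/-- The external tensor product `V ⊗ W`, a representation of `G × H`. -/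
def extTensor (ρ : Representation ℂ G V) (σ : Representation ℂ H W) :
    Representation ℂ (G × H) (V ⊗[ℂ] W) :=
  Representation.tprod (ρ.comp (MonoidHom.fst G H)) (σ.comp (MonoidHom.snd G H))

end Rep

/-! ### Rational functions on `V` and on `ℙV`, and the field of invariants -/

section Fields

variable {V : Type*} [AddCommGroup V] [Module ℂ V]

/-- Polynomial functions on `V`: the algebra generated by the linear forms. -/
def polyFun (V : Type*) [AddCommGroup V] [Module ℂ V] : Subalgebra ℂ (V → ℂ) :=
  Algebra.adjoin ℂ (Set.range fun (l : Dual ℂ V) (v : V) => l v)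

theorem polyFun_line {p : V → ℂ} (hp : p ∈ polyFun V) (u w : V) :
    ∃ r : Polynomial ℂ, ∀ t : ℂ, p (u + t • w) = r.eval t := by
  induction hp using Algebra.adjoin_induction with
  | mem x hx =>
    obtain ⟨l, rfl⟩ := hx
    exact ⟨.C (l u) + .X * .C (l w), fun t => by simp; ring⟩
  | algebraMap c => exact ⟨.C c, fun t => by simp⟩
  | add x y _ _ hx hy =>
    obtain ⟨r, hr⟩ := hx
    obtain ⟨s, hs⟩ := hy
    exact ⟨r + s, fun t => by simp [hr, hs]⟩
  | mul x y _ _ hx hy =>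
    obtain ⟨r, hr⟩ := hx
    obtain ⟨s, hs⟩ := hy
    exact ⟨r * s, fun t => by simp [hr, hs]⟩

/-- The ring of polynomial functions on `V`. -/
def PolyRing (V : Type*) [AddCommGroup V] [Module ℂ V] : Type _ := polyFun V

instance : CommRing (PolyRing V) := inferInstanceAs (CommRing (polyFun V))

instance : Algebra ℂ (PolyRing V) := inferInstanceAs (Algebra ℂ (polyFun V))

instance : IsDomain (PolyRing V) := by
  have : Nontrivial (PolyRing V) := inferInstanceAs (Nontrivial (polyFun V))
  have : NoZeroDivisors (PolyRing V) := by
    refine ⟨fun {p q} h => ?_⟩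
    by_contra! hne
    obtain ⟨u, hu⟩ : ∃ u, p.1 u ≠ 0 := by
      by_contra! h0
      exact hne.1 (Subtype.ext (funext h0))
    obtain ⟨v, hv⟩ : ∃ v, q.1 v ≠ 0 := by
      by_contra! h0
      exact hne.2 (Subtype.ext (funext h0))
    obtain ⟨r, hr⟩ := polyFun_line p.2 u (v - u)
    obtain ⟨s, hs⟩ := polyFun_line q.2 u (v - u)
    have hrs : r * s = 0 := by
      refine Polynomial.funext fun t => ?_
      rw [Polynomial.eval_mul, ← hr, ← hs, Polynomial.eval_zero]
      exact congrFun (congrArg Subtype.val h) _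
    rcases mul_eq_zero.1 hrs with h0 | h0
    · exact hu (by simpa [h0] using hr 0)
    · exact hv (by simpa [h0] using hs 1)
  exact NoZeroDivisors.to_isDomain _

/-- The field `ℂ(V)` of rational functions on `V`. -/
abbrev RatFun (V : Type*) [AddCommGroup V] [Module ℂ V] : Type _ := FractionRing (PolyRing V)

theorem comp_mem_polyFun (L : V →ₗ[ℂ] V) {p : V → ℂ} (hp : p ∈ polyFun V) :
    (fun v => p (L v)) ∈ polyFun V := by
  induction hp using Algebra.adjoin_induction with
  | mem x hx =>
    obtain ⟨l, rfl⟩ := hx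
    exact Algebra.subset_adjoin ⟨l ∘ₗ L, rfl⟩
  | algebraMap c => exact (polyFun V).algebraMap_mem c
  | add x y _ _ hx hy => exact (polyFun V).add_mem hx hy
  | mul x y _ _ hx hy => exact (polyFun V).mul_mem hx hy

/-- The automorphism `p ↦ p ∘ L` of the algebra of polynomial functions. -/
def polySubst (L : V ≃ₗ[ℂ] V) : PolyRing V ≃ₐ[ℂ] PolyRing V where
  toFun p := ⟨fun v => p.1 (L v), comp_mem_polyFun L.toLinearMap p.2⟩
  invFun p := ⟨fun v => p.1 (L.symm v), comp_mem_polyFun L.symm.toLinearMap p.2⟩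
  left_inv p := by refine Subtype.ext (funext fun v => ?_); simp
  right_inv p := by refine Subtype.ext (funext fun v => ?_); simp
  map_mul' _ _ := rfl
  map_add' _ _ := rfl
  commutes' _ := rfl

/-- The automorphism `f ↦ f ∘ L` of the field of rational functions. -/
def ratSubst (L : V ≃ₗ[ℂ] V) : RatFun V ≃ₐ[ℂ] RatFun V :=
  IsFractionRing.algEquivOfAlgEquiv (polySubst L)

/-- Homogeneous polynomial functions of degree `n`. -/
def IsHomog (n : ℕ) (p : PolyRing V) : Prop :=
  ∀ (t : ℂ) (v : V), p.1 (t • v) = t ^ n * p.1 v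

theorem IsHomog.mul {n m : ℕ} {p q : PolyRing V} (hp : IsHomog n p) (hq : IsHomog m q) :
    IsHomog (n + m) (p * q) := fun t v => by
  change p.1 (t • v) * q.1 (t • v) = t ^ (n + m) * (p.1 v * q.1 v)
  rw [hp, hq]
  ring

theorem IsHomog.add {n : ℕ} {p q : PolyRing V} (hp : IsHomog n p) (hq : IsHomog n q) :
    IsHomog n (p + q) := fun t v => by
  change p.1 (t • v) + q.1 (t • v) = t ^ n * (p.1 v + q.1 v)
  rw [hp, hq]
  ring

/-- The function field `ℂ(ℙV)`: the quotients `p / q` of homogeneous polynomial functions of the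
same degree. -/
def projField (V : Type*) [AddCommGroup V] [Module ℂ V] : IntermediateField ℂ (RatFun V) where
  carrier := {f | ∃ (n : ℕ) (p q : PolyRing V), IsHomog n p ∧ IsHomog n q ∧ q ≠ 0 ∧
    f = algebraMap (PolyRing V) (RatFun V) p / algebraMap (PolyRing V) (RatFun V) q}
  mul_mem' := by
    rintro _ _ ⟨n, p, q, hp, hq, h0, rfl⟩ ⟨m, r, s, hr, hs, h1, rfl⟩
    exact ⟨n + m, p * r, q * s, hp.mul hr, hq.mul hs, mul_ne_zero h0 h1, by
      rw [map_mul, map_mul, div_mul_div_comm]⟩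
  add_mem' := by
    rintro _ _ ⟨n, p, q, hp, hq, h0, rfl⟩ ⟨m, r, s, hr, hs, h1, rfl⟩
    refine ⟨n + m, p * s + q * r, q * s, (hp.mul hs).add (hq.mul hr), hq.mul hs,
      mul_ne_zero h0 h1, ?_⟩
    rw [map_mul, map_add, map_mul, map_mul, div_add_div]
    · simpa using h0
    · simpa using h1
  algebraMap_mem' c := by
    refine ⟨0, algebraMap ℂ _ c, 1, fun t v => ?_, fun t v => ?_, one_ne_zero, ?_⟩
    · rw [pow_zero, one_mul]; rfl
    · rw [pow_zero, one_mul]; rfl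
    · rw [map_one, div_one]; exact IsScalarTower.algebraMap_apply ℂ (PolyRing V) (RatFun V) c
  inv_mem' := by
    rintro _ ⟨n, p, q, hp, hq, h0, rfl⟩
    by_cases h : p = 0
    · refine ⟨0, 0, 1, fun t v => ?_, fun t v => ?_, one_ne_zero, by simp [h]⟩
      · rw [pow_zero, one_mul]; rfl
      · rw [pow_zero, one_mul]; rfl
    · exact ⟨n, q, p, hq, hp, h, by rw [inv_div]⟩

/-- The field of invariants `ℂ(ℙV)^G`. This is the function field of the quotient `ℙV/G`, which
as a birational equivalence class of varieties is defined by it. -/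
def projQuotField {G : Type*} [Group G] (ρ : Representation ℂ G V) :
    IntermediateField ℂ (RatFun V) where
  carrier := {f | f ∈ projField V ∧ ∀ g : G, ratSubst (repEquiv ρ g) f = f}
  mul_mem' hx hy := ⟨mul_mem hx.1 hy.1, fun g => by rw [map_mul, hx.2 g, hy.2 g]⟩
  add_mem' hx hy := ⟨add_mem hx.1 hy.1, fun g => by rw [map_add, hx.2 g, hy.2 g]⟩
  algebraMap_mem' c := ⟨(projField V).algebraMap_mem c, fun g => AlgEquiv.commutes _ c⟩
  inv_mem' x hx := ⟨inv_mem hx.1, fun g => by rw [map_inv₀, hx.2 g]⟩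

end Fields

/-! ### Birational equivalence -/

/-- Two varieties with function fields `K`, `L` are birational iff `K` and `L` are isomorphic
over `ℂ`. -/
def AreBirational (K L : Type*) [Field K] [Field L] [Algebra ℂ K] [Algebra ℂ L] : Prop :=
  Nonempty (K ≃ₐ[ℂ] L)

/-- The function field of `ℂ^n × Y`, where `K` is the function field of `Y`: the rational
functions in `n` variables over `K`. -/
abbrev affineTimes (n : ℕ) (K : Type*) [Field K] : Type _ := FractionRing (MvPolynomial (Fin n) K)

/-- A variety with function field `K` is rational of dimension `n`: it is birational to `ℂ^n`. -/
def IsRationalOfDim (K : Type*) [Field K] [Algebra ℂ K] (n : ℕ) : Prop :=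
  AreBirational K (affineTimes n ℂ)

/-! ### Grassmannians -/

section Grassmannian

variable {H W : Type*} [Group H] [AddCommGroup W] [Module ℂ W]

/-- The Grassmannian of `k`-dimensional linear subspaces of `W`. Thus `Grass W 1` is `ℙW`, and
`Grass W (a + 1)` is the Grassmannian `𝔾(a, ℙW)` of `a`-planes in `ℙW`. -/
def Grass (W : Type*) [AddCommGroup W] [Module ℂ W] (k : ℕ) : Type _ :=
  {P : Submodule ℂ W // finrank ℂ P = k}

/-- Linearly independent `k`-tuples, an open subvariety of the affine space `W^k`. -/
def Frame (W : Type*) [AddCommGroup W] [Module ℂ W] (k : ℕ) : Type _ :=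
  {f : Fin k → W // LinearIndependent ℂ f}

/-- The restrictions of polynomial functions from `W^k` to `Frame W k`. -/
def frameFun (W : Type*) [AddCommGroup W] [Module ℂ W] (k : ℕ) : Subalgebra ℂ (Frame W k → ℂ) :=
  pullbackFun Subtype.val (polyFun (Fin k → W))

/-- The quotient map from frames to the Grassmannian. It presents the Grassmannian as the quotient
of `Frame W k` by `GL_k` (a locally trivial principal bundle), so that the open sets and the
regular functions of the Grassmannian are those which are so after pullback to `Frame W k`. -/
def Frame.span {k : ℕ} (f : Frame W k) : Grass W k :=
  ⟨Submodule.span ℂ (Set.range f.1), by simpa using finrank_span_eq_card f.2⟩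

/-- Zariski open subsets of the Grassmannian. -/
def Grass.IsOpen {k : ℕ} (U : Set (Grass W k)) : Prop :=
  IsZariskiOpen (frameFun W k) (Frame.span ⁻¹' U)

/-- Regular functions on an open subset of the Grassmannian. -/
def Grass.IsRegularOn {k : ℕ} (U : Set (Grass W k)) (f : Grass W k → ℂ) : Prop :=
  RatQuot.IsRegularOn (frameFun W k) (Frame.span ⁻¹' U) fun x => f x.span

/-- Regular functions on an open subset of `H × Grass W k`. -/
def Grass.IsRegularOnProd [AlgGroup H] {k : ℕ} (U : Set (H × Grass W k))
    (f : H × Grass W k → ℂ) : Prop :=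
  RatQuot.IsRegularOn (prodFun (AlgGroup.regular (G := H)) (frameFun W k))
    ((fun x : H × Frame W k => (x.1, x.2.span)) ⁻¹' U) fun x => f (x.1, x.2.span)

/-- The action of `H` on the Grassmannian. -/
def Grass.act (σ : Representation ℂ H W) {k : ℕ} (h : H) (P : Grass W k) : Grass W k :=
  ⟨P.1.map (repEquiv σ h).toLinearMap, by rw [LinearEquiv.finrank_map_eq, P.2]⟩

/-- The subgroup `H₀` of the elements which act trivially on `ℙW`. -/
def projKernel (σ : Representation ℂ H W) : Subgroup H where
  carrier := {h | ∀ P : Grass W 1, P.act σ h = P}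
  one_mem' P := by
    apply Subtype.ext
    ext x
    simp [Grass.act, repEquiv]
  mul_mem' {g h} hg hh P := by
    have h1 := congrArg Subtype.val (hg P)
    have h2 := congrArg Subtype.val (hh P)
    apply Subtype.ext
    have : (repEquiv σ (g * h)).toLinearMap
        = (repEquiv σ g).toLinearMap ∘ₗ (repEquiv σ h).toLinearMap := by
      ext x; simp [repEquiv]
    simp only [Grass.act] at h1 h2 ⊢
    rw [this, Submodule.map_comp, h2, h1]
  inv_mem' {g} hg P := by
    have h1 := congrArg Subtype.val (hg P)
    apply Subtype.ext
    have : (repEquiv σ g⁻¹).toLinearMap ∘ₗ (repEquiv σ g).toLinearMap = LinearMap.id := by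
      ext x; simp [repEquiv]
    simp only [Grass.act] at h1 ⊢
    conv_lhs => rw [← h1]
    rw [← Submodule.map_comp, this, Submodule.map_id]

/-- `H/H₀` acts almost freely on the Grassmannian: the stabilizer in `H/H₀` of a general point is
trivial. (For `k = 1` the Grassmannian is `ℙW`.) -/
def ActsAlmostFreely (σ : Representation ℂ H W) (k : ℕ) : Prop :=
  ∃ U : Set (Grass W k), Grass.IsOpen U ∧ U.Nonempty ∧
    ∀ P ∈ U, ∀ h : H, P.act σ h = P → h ∈ projKernel σ

/-- The action of `H` on the universal subbundle `ℰ`, whose fibre over `P` is `P` itself: the map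
`ℰ_P → ℰ_Q` given by `h` when `hP = Q`. -/
def tautAct (σ : Representation ℂ H W) {k : ℕ} (h : H) {P Q : Grass W k} (e : P.act σ h = Q) :
    P.1 →ₗ[ℂ] Q.1 :=
  (repEquiv σ h).toLinearMap.restrict fun x hx => by
    rw [← e]; exact Submodule.mem_map_of_mem hx

/-- An `H`-linearized (algebraic) line bundle on the Grassmannian of `k`-dimensional subspaces. -/
structure LinearizedLineBundle [AlgGroup H] (σ : Representation ℂ H W) (k : ℕ) where
  /-- the fibres -/
  fiber : Grass W k → Type
  [addCommGroup : ∀ P, AddCommGroup (fiber P)]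
  [module : ∀ P, Module ℂ (fiber P)]
  finrank_fiber : ∀ P, finrank ℂ (fiber P) = 1
  /-- the index set of a trivializing open cover -/
  ι : Type
  /-- the open sets of the cover -/
  chart : ι → Set (Grass W k)
  chart_open : ∀ i, Grass.IsOpen (chart i)
  chart_cover : ∀ P, ∃ i, P ∈ chart i
  /-- a section without zeros on each of them (the values outside are irrelevant) -/
  gen : ι → ∀ P, fiber P
  gen_ne_zero : ∀ i, ∀ P ∈ chart i, gen i P ≠ 0
  /-- the transition functions are regular -/
  transition_regular : ∀ i j, ∃ u : Grass W k → ℂ, Grass.IsRegularOn (chart i ∩ chart j) u ∧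
    ∀ P ∈ chart i ∩ chart j, gen i P = u P • gen j P
  /-- the linearization: `h` maps the fibre over `P` to the fibre over `Q = hP` -/
  act : ∀ (h : H) {P Q : Grass W k}, P.act σ h = Q → (fiber P ≃ₗ[ℂ] fiber Q)
  act_one : ∀ {P : Grass W k} (e : P.act σ 1 = P) (x : fiber P), act 1 e x = x
  act_mul : ∀ (g h : H) {P Q R : Grass W k} (e : P.act σ h = Q) (e' : Q.act σ g = R)
    (e'' : P.act σ (g * h) = R) (x : fiber P), act (g * h) e'' x = act g e' (act h e x)
  /-- the linearization is algebraic on `H × Grass W k` -/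
  act_regular : ∀ i j, ∃ c : H × Grass W k → ℂ,
    Grass.IsRegularOnProd {x | x.2 ∈ chart i ∧ x.2.act σ x.1 ∈ chart j} c ∧
    ∀ (h : H) {P Q : Grass W k} (e : P.act σ h = Q), P ∈ chart i → Q ∈ chart j →
      act h e (gen i P) = c (h, P) • gen j Q

attribute [instance] LinearizedLineBundle.addCommGroup LinearizedLineBundle.module

/-- `H₀` acts trivially on `ℰ ⊗ ℒ`, where `ℰ` is the universal subbundle. -/
def LinearizedLineBundle.TwistTrivial [AlgGroup H] {σ : Representation ℂ H W} {k : ℕ}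
    (L : LinearizedLineBundle σ k) : Prop :=
  ∀ h ∈ projKernel σ, ∀ (P : Grass W k) (e : P.act σ h = P),
    TensorProduct.map (tautAct σ h e) (L.act h e).toLinearMap =
      (LinearMap.id : P.1 ⊗[ℂ] L.fiber P →ₗ[ℂ] P.1 ⊗[ℂ] L.fiber P)

end Grassmannian

end RatQuot

end

/-!
A general tensor in `V ⊗ W` is an injective map `V^* → W`, and its image `P` is a point of the
Grassmannian `𝔾 = 𝔾(a, ℙW)`. Thus `ℙ(V ⊗ W)` is birational to the projective bundle `ℙ(V ⊗ ℰ)` over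
`𝔾`, which is unchanged if `ℰ` is twisted by the line bundle `ℒ`. As `H₀` acts trivially on `ℰ ⊗ ℒ`
and `H/H₀` acts almost freely on `𝔾`, the bundle `ℰ ⊗ ℒ` descends generically to `𝔾/H`, where it is
generically trivial. Hence

* `ℙ(V ⊗ W)/(G × H) ∼ ℙ(V^{⊕(a+1)})/G × 𝔾/H ∼ ℂ^d × 𝔾/H`, and
* the projective bundle `ℙ(ℰ)` satisfies `ℙ(ℰ)/H ∼ ℂ^a × 𝔾/H`.

On the other hand, `ℙ(ℰ)` is the variety of the pairs of a point of `ℙW` and an `a`-plane containing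
it. Its fibres over `ℙW` are Grassmannians of dimension `a(b - a)`, and as `H/H₀` acts almost freely
on `ℙW`, a descent argument for the bundle `Hom(𝒪(-1), W)` on `ℙW` gives
`ℙ(ℰ)/H ∼ ℂ^{a(b-a)} × ℙW/H`. As `d ≥ a`, the comparison yields
`ℂ^d × 𝔾/H ∼ ℂ^{d-a} × ℙ(ℰ)/H ∼ ℂ^{d-a+a(b-a)} × ℙW/H`.

All of this is carried out in the field `F` of rational functions on `V ⊗ W`, whose coordinates are
the entries of a generic matrix `x = X [1 | A]` with an invertible block `X`. The group `G` acts on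
`x` from the left and `H` from the right. The entries of `A` (`chartCoord x`) are the coordinates
of the point `P` in a chart of `𝔾`; they generate the function field `K` of `𝔾` and are
fixed by `G`.

*Descent.* The bundle `ℰ ⊗ ℒ` is given by a cocycle of `H` with values in `GL(K)`, and an invariant
frame is found by Hilbert 90. For an abstract group of automorphisms of a field this holds for those
cocycles whose entries, up to a common denominator, lie in the `K`-span of the functions
`h ↦ τ h u`, `u ∈ K` (`span_invariants_eq_top`). This span consists of rational functions on the
graph of the action, the set of the pairs `(x, hx)`. By almost freeness and the
triviality of the action of `H₀`, the value of the cocycle at `(h, x)` only depends on the pair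
`(x, hx)`. In characteristic zero, such a regular function on `H × 𝔾` is a rational function on
the graph, by the Nullstellensatz (`exists_prime_forall_mul_mem`,
`span_invariants_eq_top_of_separated`). The results are the matrices `S` of
`ChartAction.exists_invariant_frame` and `ChartAction.exists_invariant_rows`.

*Invariants.* The entries of `X S` are multiplied by a common factor under `H` and transformed like
those of `X` under `G`, so the `G`-invariant ratios of them are fixed by `H` and form a field
`ℂ(t₁, …, t_d)`, independent over `K`. Invariants of a compositum of linearly disjoint fields, one
of which is fixed, are computed by `fixedIn_sup`. The comparison of the two projections of `ℙ(ℰ)` is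
`sup_ratioField_firstRow` with `fixedIn_sup_firstRow_areBirational`, where the first row of `x`
represents the point in `P`. Everything is combined in `fixedIn_fixedIn_areBirational`.
-/

/-! ### Functions constant on the fibres of a morphism -/

universe u

namespace RatQuot

/-- Nullstellensatz for finitely generated `ℂ`-algebras. -/
theorem mem_radical_of_forall_algHom {A : Type*} [CommRing A] [Algebra ℂ A]
    [Algebra.FiniteType ℂ A] (I : Ideal A) (D : A)
    (h : ∀ φ : A →ₐ[ℂ] ℂ, (∀ a ∈ I, φ a = 0) → φ D = 0) : D ∈ I.radical := by
  have : IsJacobsonRing A := isJacobsonRing_of_finiteType (A := ℂ)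
  rw [Ideal.radical_eq_jacobson, Ideal.jacobson, Ideal.mem_sInf]
  rintro m ⟨hIm, hm⟩
  let := Ideal.Quotient.field m
  have hfin : Module.Finite ℂ (A ⧸ m) := finite_of_finite_type_of_isJacobsonRing ℂ (A ⧸ m)
  have hbij := IsAlgClosed.algebraMap_bijective_of_isIntegral (k := ℂ) (K := A ⧸ m)
  let e : ℂ ≃ₐ[ℂ] (A ⧸ m) := AlgEquiv.ofBijective (Algebra.ofId ℂ (A ⧸ m)) hbij
  have := h (e.symm.toAlgHom.comp (Ideal.Quotient.mkₐ ℂ m)) (fun a ha => by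
    have : Ideal.Quotient.mk m a = 0 := Ideal.Quotient.eq_zero_iff_mem.2 (hIm ha)
    simp [this])
  rw [← Ideal.Quotient.eq_zero_iff_mem]
  simpa using this

/-- In a reduced algebra `A` over a field `k` of characteristic zero, an element `c` for which
`c ⊗ 1 - 1 ⊗ c` is nilpotent in `A ⊗ A` lies in `k`: otherwise `k[c]` would have two different
homomorphisms to a field over `k`. -/
theorem mem_range_of_isNilpotent_tmul_sub {k A : Type u} [Field k] [CharZero k] [CommRing A]
    [Algebra k A] [IsReduced A] [Nontrivial A] (c : A)
    (h : IsNilpotent (c ⊗ₜ[k] (1 : A) - (1 : A) ⊗ₜ[k] c)) : c ∈ (algebraMap k A).range := by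
  -- the same holds in every subalgebra containing `c`
  have key : ∀ {R : Type u} [CommRing R] [Algebra k R] (f : R →ₐ[k] A),
      Function.Injective f → ∀ r : R, f r = c →
      IsNilpotent (r ⊗ₜ[k] (1 : R) - (1 : R) ⊗ₜ[k] r) := by
    intro R _ _ f hf r hr
    have hinj : Function.Injective (Algebra.TensorProduct.map f f) :=
      TensorProduct.map_injective_of_flat_flat f.toLinearMap f.toLinearMap hf hf
    rw [← IsNilpotent.map_iff hinj]
    simpa [hr] using h
  have hom : ∀ {R : Type u} {Ω : Type u} [CommRing R] [Algebra k R] [Field Ω] [Algebra k Ω] (r : R),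
      IsNilpotent (r ⊗ₜ[k] (1 : R) - (1 : R) ⊗ₜ[k] r) → ∀ α β : R →ₐ[k] Ω, α r = β r := by
    intro R Ω _ _ _ _ r hr α β
    have := hr.map (Algebra.TensorProduct.productMap α β)
    simpa [sub_eq_zero] using this.eq_zero
  by_cases hc : IsIntegral k c
  · have hsf : Squarefree (minpoly k c) :=
      (minpoly.isRadical k c).squarefree (minpoly.ne_zero hc)
    have hsep := PerfectField.separable_iff_squarefree.2 hsf
    by_contra hcr
    have hdeg : 2 ≤ (minpoly k c).natDegree := by
      exact minpoly.two_le_natDegree_iff hc |>.2 hcr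
    have hcard : Fintype.card ((minpoly k c).rootSet (AlgebraicClosure k))
        = (minpoly k c).natDegree :=
      Polynomial.card_rootSet_eq_natDegree hsep (IsAlgClosed.splits _)
    obtain ⟨⟨α, hα⟩, ⟨β, hβ⟩, hne⟩ := Fintype.one_lt_card_iff.1 (by omega :
      1 < Fintype.card ((minpoly k c).rootSet (AlgebraicClosure k)))
    rw [Polynomial.mem_rootSet] at hα hβ
    have hn := key (Algebra.adjoin k {c}).val Subtype.val_injective
      ⟨c, Algebra.self_mem_adjoin_singleton k c⟩ rfl
    let e := AlgEquiv.adjoinSingletonEquivAdjoinRootMinpoly k c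
    let fα : AdjoinRoot (minpoly k c) →ₐ[k] AlgebraicClosure k :=
      AdjoinRoot.liftAlgHom _ (Algebra.ofId _ _) α hα.2
    let fβ : AdjoinRoot (minpoly k c) →ₐ[k] AlgebraicClosure k :=
      AdjoinRoot.liftAlgHom _ (Algebra.ofId _ _) β hβ.2
    have hec : e.symm (AdjoinRoot.root _) = ⟨c, Algebra.self_mem_adjoin_singleton k c⟩ := by
      apply Subtype.ext
      simp [e]
    have := hom _ hn (fα.comp e.toAlgHom) (fβ.comp e.toAlgHom)
    rw [← hec] at this
    rw [AlgHom.comp_apply, AlgHom.comp_apply] at this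
    erw [AlgEquiv.apply_symm_apply] at this
    have hfα : fα (AdjoinRoot.root _) = α := AdjoinRoot.liftAlgHom_root ..
    have hfβ : fβ (AdjoinRoot.root _) = β := AdjoinRoot.liftAlgHom_root ..
    exact hne (Subtype.ext (hfα.symm.trans (this.trans hfβ)))
  · exfalso
    have ht : Transcendental k c := fun hal => hc hal.isIntegral
    have hn := key (Polynomial.aeval c) (transcendental_iff_injective.1 ht) Polynomial.X (by simp)
    have := hom _ hn (Polynomial.aeval (0 : k)) (Polynomial.aeval (1 : k))
    simp at this

/-- If `c ⊗ 1 - 1 ⊗ c` is nilpotent in `C ⊗[B] C`, and the localization of `B` at `p` is a field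
over which `C` becomes a reduced algebra `A`, then `c` is a quotient of elements of `B` locally
at `p`. -/
theorem exists_mul_eq_of_isNilpotent {B C k A : Type u} [CommRing B] [CommRing C] [Algebra B C]
    (p : Ideal B) [p.IsPrime] [Field k] [CharZero k] [Algebra B k] [IsLocalization.AtPrime k p]
    [CommRing A] [Nontrivial A] [IsReduced A] [Algebra C A] [Algebra B A] [Algebra k A]
    [IsScalarTower B C A] [IsScalarTower B k A]
    [IsLocalization (Algebra.algebraMapSubmonoid C p.primeCompl) A] (c : C)
    (h : IsNilpotent (c ⊗ₜ[B] (1 : C) - (1 : C) ⊗ₜ[B] c)) :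
    ∃ s : B, s ∉ p ∧ ∃ b : B, algebraMap B C s * c = algebraMap B C b := by
  let l : C →ₐ[B] A ⊗[k] A :=
    ((Algebra.TensorProduct.includeLeft : A →ₐ[k] A ⊗[k] A).restrictScalars B).comp
      (IsScalarTower.toAlgHom B C A)
  let r : C →ₐ[B] A ⊗[k] A :=
    ((Algebra.TensorProduct.includeRight : A →ₐ[k] A ⊗[k] A).restrictScalars B).comp
      (IsScalarTower.toAlgHom B C A)
  have hnil' := h.map (Algebra.TensorProduct.productMap l r)
  obtain ⟨x, hx⟩ := mem_range_of_isNilpotent_tmul_sub (k := k) (algebraMap C A c) (by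
    simpa [l, r] using hnil')
  obtain ⟨b, s, rfl⟩ := IsLocalization.exists_mk'_eq p.primeCompl x
  have h1 : algebraMap C A (algebraMap B C s * c) = algebraMap C A (algebraMap B C b) := by
    rw [map_mul, ← hx, ← IsScalarTower.algebraMap_apply, ← IsScalarTower.algebraMap_apply,
      IsScalarTower.algebraMap_apply B k A, ← map_mul, IsLocalization.mk'_spec'_mk,
      ← IsScalarTower.algebraMap_apply]
  obtain ⟨⟨_, t, ht, rfl⟩, h2⟩ := (IsLocalization.eq_iff_exists
    (Algebra.algebraMapSubmonoid C p.primeCompl) A).1 h1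
  exact ⟨t * s, p.primeCompl.mul_mem ht s.2, t * b, by
    simpa [mul_assoc] using h2⟩

/-- Let `C` be a reduced finitely generated algebra and `B` a subalgebra. An element of
`C` which is constant on the fibres of `Spec C → Spec B` is a quotient of elements of
`B`, locally at some prime of `B` (a generic point), as `C` has characteristic zero. -/
theorem exists_prime_forall_mul_mem {C : Type*} [CommRing C] [Algebra ℂ C]
    [Algebra.FiniteType ℂ C] [IsReduced C] [Nontrivial C] (B : Subalgebra ℂ C) :
    ∃ p : Ideal B, p.IsPrime ∧ ∀ c : C,
      (∀ φ ψ : C →ₐ[ℂ] ℂ, (∀ b ∈ B, φ b = ψ b) → φ c = ψ c) →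
      ∃ s : B, s ∉ p ∧ (s : C) * c ∈ B := by
  obtain ⟨m, hm⟩ := Ideal.exists_maximal B
  have hmp : m.IsPrime := hm.isPrime
  obtain ⟨p, hp, -⟩ := Ideal.exists_minimalPrimes_le (bot_le : (⊥ : Ideal B) ≤ m)
  have hpp : p.IsPrime := hp.1.1
  refine ⟨p, hpp, fun c hc => ?_⟩
  have hred : IsReduced B := isReduced_of_injective B.val Subtype.val_injective
  let k := Localization.AtPrime p
  have hredk : IsReduced k := inferInstance
  have hsub : Subsingleton (PrimeSpectrum k) :=
    IsLocalization.subsingleton_primeSpectrum_of_mem_minimalPrimes p hp k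
  -- the localization of a reduced ring at a minimal prime is a field
  have hfield : IsField k := by
    rw [IsLocalRing.isField_iff_maximalIdeal_eq, eq_bot_iff]
    intro x hx
    refine (nilpotent_iff_mem_prime.2 fun q hq => ?_ : IsNilpotent x).eq_zero
    have : (⟨q, hq⟩ : PrimeSpectrum k) = ⟨IsLocalRing.maximalIdeal k, inferInstance⟩ :=
      Subsingleton.elim _ _
    have hq' : q = IsLocalRing.maximalIdeal k := congrArg PrimeSpectrum.asIdeal this
    exact hq' ▸ hx
  let A := Localization (Algebra.algebraMapSubmonoid C p.primeCompl)
  let : Algebra k A := localizationAlgebra p.primeCompl C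
  have htower : IsScalarTower B k A := isScalarTower_localizationAlgebra p.primeCompl C
  let : Field k := hfield.toField
  have : CharZero k := charZero_of_injective_algebraMap (algebraMap ℂ k).injective
  -- a `ℂ`-point of `Spec (C ⊗[B] C)` is a pair of points in the same fibre of `Spec C → Spec B`
  have hnil : IsNilpotent (c ⊗ₜ[B] (1 : C) - (1 : C) ⊗ₜ[B] c) := by
    have : Algebra.FiniteType B C := Algebra.FiniteType.of_restrictScalars_finiteType ℂ B C
    have : Algebra.FiniteType ℂ (C ⊗[B] C) := Algebra.FiniteType.trans (S := C) ‹_› inferInstance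
    have := mem_radical_of_forall_algHom (⊥ : Ideal (C ⊗[B] C))
      (c ⊗ₜ[B] (1 : C) - (1 : C) ⊗ₜ[B] c) fun φ _ => by
        have h1 := hc
          (φ.comp ((Algebra.TensorProduct.includeLeft : C →ₐ[B] C ⊗[B] C).restrictScalars ℂ))
          (φ.comp ((Algebra.TensorProduct.includeRight : C →ₐ[B] C ⊗[B] C).restrictScalars ℂ))
          fun b hb => by
            have : (b ⊗ₜ[B] (1 : C)) = (1 : C) ⊗ₜ[B] b := by
              have := TensorProduct.smul_tmul (R := B) (⟨b, hb⟩ : B) (1 : C) (1 : C)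
              simpa [Subalgebra.smul_def] using this
            simp [this]
        simpa [sub_eq_zero] using h1
    exact this
  have : Nontrivial A := by
    rw [← not_subsingleton_iff_nontrivial,
      IsLocalization.subsingleton_iff (M := Algebra.algebraMapSubmonoid C p.primeCompl) (S := A)]
    rintro ⟨b, hb, hb0⟩
    have : b = 0 := Subtype.ext hb0
    exact hb (this ▸ p.zero_mem)
  obtain ⟨s, hs, b, hb⟩ := exists_mul_eq_of_isNilpotent p (k := k) (A := A) c hnil
  exact ⟨s, hs, by
    have : (s : C) * c = b := hb
    exact this ▸ b.2⟩

end RatQuot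

/-! ### Semilinear invariants -/

namespace RatQuot

/-- A nonzero subspace of `K^(κ)` which is stable under a family of (coordinatewise acting) field
endomorphisms contains a nonzero vector with fixed coordinates: take a vector of minimal support and
make one of its coordinates equal to `1`. -/
theorem exists_mem_forall_fixed {K κ Γ : Type*} [Field K] (τ : Γ → K →+* K)
    (I : Submodule K (κ →₀ K)) (hI : ∀ γ, ∀ f ∈ I, f.mapRange (τ γ) (map_zero _) ∈ I)
    (hne : I ≠ ⊥) : ∃ f ∈ I, f ≠ 0 ∧ ∀ k γ, τ γ (f k) = f k := by
  classical
  obtain ⟨f₀, hf₀, h0⟩ := Submodule.exists_mem_ne_zero_of_ne_bot hne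
  have hex : ∃ n, ∃ f ∈ I, f ≠ 0 ∧ f.support.card = n := ⟨_, f₀, hf₀, h0, rfl⟩
  obtain ⟨f, hf, hf0, hcard⟩ := Nat.find_spec hex
  obtain ⟨k, hk⟩ := Finsupp.support_nonempty_iff.2 hf0
  rw [Finsupp.mem_support_iff] at hk
  refine ⟨(f k)⁻¹ • f, I.smul_mem _ hf, smul_ne_zero (inv_ne_zero hk) hf0, fun j γ => ?_⟩
  set e := (f k)⁻¹ • f with he
  have hek : e k = 1 := by simp [he, hk]
  have hsub : e.mapRange (τ γ) (map_zero _) - e ∈ I :=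
    I.sub_mem (hI γ _ (I.smul_mem _ hf)) (I.smul_mem _ hf)
  by_contra hj
  have hne' : e.mapRange (τ γ) (map_zero _) - e ≠ 0 := fun h => hj (by
    simpa [sub_eq_zero] using DFunLike.congr_fun h j)
  refine Nat.find_min hex ?_ ⟨_, hsub, hne', rfl⟩
  rw [← hcard]
  refine Finset.card_lt_card ((Finset.ssubset_iff_of_subset fun i hi => ?_).2 ⟨k, by simpa, ?_⟩)
  · rw [Finsupp.mem_support_iff] at hi ⊢
    intro hi0
    simp [he, hi0] at hi
  · simp [hek]

section Cocycle

variable {H K : Type*} [Field K] (τ : H → K →+* K)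

/-- The subfield fixed by a family of endomorphisms. -/
def fixedSubfield : Subfield K where
  carrier := {x | ∀ h, τ h x = x}
  mul_mem' hx hy h := by rw [map_mul, hx h, hy h]
  one_mem' h := map_one _
  add_mem' hx hy h := by rw [map_add, hx h, hy h]
  zero_mem' h := map_zero _
  neg_mem' hx h := by rw [map_neg, hx h]
  inv_mem' x hx h := by rw [map_inv₀, hx h]

/-- The function `h ↦ τ h g` on the group, for `g` in the field. -/
def orbitFun (g : K) : H → K := fun h => τ h g

/-- The `K`-span of the functions `h ↦ τ h g`. When `K` is the function field of a variety with an
action of `H`, these are functions on the graph `{(x, hx)}` of the action. -/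
def orbitSpan : Submodule K (H → K) := Submodule.span K (Set.range (orbitFun τ))

variable {τ}

theorem mul_orbitFun_mem {F : H → K} (hF : F ∈ orbitSpan τ) (g : K) :
    F * orbitFun τ g ∈ orbitSpan τ := by
  induction hF using Submodule.span_induction with
  | mem x hx =>
    obtain ⟨g', rfl⟩ := hx
    refine Submodule.subset_span ⟨g' * g, ?_⟩
    ext h
    simp [orbitFun]
  | zero => simp
  | add x y _ _ hx hy => rw [add_mul]; exact Submodule.add_mem _ hx hy
  | smul a x _ hx => rw [smul_mul_assoc]; exact Submodule.smul_mem _ _ hx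

/-- The functions `h ↦ τ h g` span a subring. -/
theorem mul_mem_orbitSpan {F G : H → K} (hF : F ∈ orbitSpan τ) (hG : G ∈ orbitSpan τ) :
    F * G ∈ orbitSpan τ := by
  induction hG using Submodule.span_induction with
  | mem x hx =>
    obtain ⟨g', rfl⟩ := hx
    exact mul_orbitFun_mem hF g'
  | zero => simp
  | add x y _ _ hx hy => rw [mul_add]; exact Submodule.add_mem _ hx hy
  | smul a x _ hx => rw [mul_smul_comm]; exact Submodule.smul_mem _ _ hx

theorem linearCombination_fixed {κ : Type*} (g : κ → K) (f : κ →₀ K)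
    (hf : ∀ k h, τ h (f k) = f k) :
    Finsupp.linearCombination K (fun k => orbitFun τ (g k)) f
      = orbitFun τ (Finsupp.linearCombination K g f) := by
  ext h
  simp only [Finsupp.linearCombination_apply, Finsupp.sum, Finset.sum_apply, Pi.smul_apply,
    smul_eq_mul, orbitFun, map_sum, map_mul, hf]

variable [Group H] (hτ1 : ∀ x, τ 1 x = x) (hτ : ∀ g h x, τ (g * h) x = τ h (τ g x))

include hτ in
theorem linearCombination_mapRange {κ : Type*} (g : κ → K) (f : κ →₀ K) (h' h : H) :
    Finsupp.linearCombination K (fun k => orbitFun τ (g k)) (f.mapRange (τ h') (map_zero _)) h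
      = τ h' (Finsupp.linearCombination K (fun k => orbitFun τ (g k)) f (h * h'⁻¹)) := by
  have : ∀ k, τ h (g k) = τ h' (τ (h * h'⁻¹) (g k)) := fun k => by rw [← hτ]; simp
  simp only [Finsupp.linearCombination_apply]
  rw [Finsupp.sum_mapRange_index (by simp)]
  simp only [Finsupp.sum, Finset.sum_apply, Pi.smul_apply, smul_eq_mul, map_sum, map_mul, orbitFun,
    this]

include hτ1 hτ in
/-- Artin's independence: elements independent over the fixed field have orbit
functions which are independent over `K`. -/
theorem linearIndependent_orbitFun {κ : Type*} {g : κ → K}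
    (hg : LinearIndependent (fixedSubfield τ) g) :
    LinearIndependent K fun k => orbitFun τ (g k) := by
  rw [linearIndependent_iff_ker]
  by_contra hne
  obtain ⟨f, hf, hf0, hfix⟩ := exists_mem_forall_fixed τ _ (fun h' f hf => by
    rw [LinearMap.mem_ker] at hf ⊢
    ext h
    rw [linearCombination_mapRange hτ, hf]
    simp) hne
  rw [LinearMap.mem_ker, linearCombination_fixed g f hfix] at hf
  have h1 := congrFun hf 1
  rw [orbitFun, hτ1, Pi.zero_apply] at h1
  let f' : κ →₀ fixedSubfield τ :=
    Finsupp.onFinset f.support (fun k => ⟨f k, hfix k⟩) (fun k hk => by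
      rw [Finsupp.mem_support_iff]
      exact fun h => hk (Subtype.ext h))
  have h2 := linearIndependent_iff.1 hg f' (by
    rw [← h1, Finsupp.linearCombination_apply, Finsupp.linearCombination_apply,
      Finsupp.sum_of_support_subset (s := f.support) _ Finsupp.support_onFinset_subset _ (by simp)]
    rfl)
  exact hf0 (Finsupp.ext fun k => congrArg Subtype.val (DFunLike.congr_fun h2 k))

include hτ1 hτ in
/-- Hilbert 90: let `c` be a cocycle with values in `GL_r(K)`. If its entries become elements of
`orbitSpan τ` after multiplication by some nonzero element of `orbitSpan τ`, then
the space `K^r`, with the twisted action of the group given by `c`, is spanned by its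
invariants. -/
theorem span_invariants_eq_top {r : Type*} [Fintype r] [DecidableEq r] (c : H → Matrix r r K)
    (hc1 : c 1 = 1) (hc : ∀ g h, c (g * h) = c h * (c g).map (τ h))
    (F : H → K) (hF : F ∈ orbitSpan τ) (hF0 : F ≠ 0)
    (hFc : ∀ i j, F * (fun h => c h i j) ∈ orbitSpan τ) :
    Submodule.span K {v : r → K | ∀ h, (c h).mulVec (fun i => τ h (v i)) = v} = ⊤ := by
  classical
  let b := Basis.ofVectorSpace (fixedSubfield τ) K
  let Φ := Finsupp.linearCombination K (fun k => orbitFun τ (b k))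
  have hΦ : Function.Injective Φ := linearIndependent_orbitFun hτ1 hτ b.linearIndependent
  have hrange : LinearMap.range Φ = orbitSpan τ := by
    rw [Finsupp.range_linearCombination]
    refine le_antisymm (Submodule.span_mono ?_) (Submodule.span_le.2 ?_)
    · rintro _ ⟨k, rfl⟩
      exact ⟨b k, rfl⟩
    · rintro _ ⟨g, rfl⟩
      rw [← b.linearCombination_repr g, Finsupp.linearCombination_apply]
      have : orbitFun τ ((b.repr g).sum fun i a => a • b i)
          = (b.repr g).sum fun i a => (a : K) • orbitFun τ (b i) := by
        ext h
        simp only [orbitFun, Finsupp.sum, map_sum, Finset.sum_apply, Pi.smul_apply, smul_eq_mul]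
        refine Finset.sum_congr rfl fun i _ => ?_
        change τ h ((b.repr g i : K) * b i) = _
        rw [map_mul, (b.repr g i).2 h]
      rw [this]
      exact Submodule.sum_mem _ fun i _ => Submodule.smul_mem _ _ (Submodule.subset_span ⟨i, rfl⟩)
  have hshift : ∀ (h' : H) (G : H → K), G ∈ orbitSpan τ →
      (fun h => τ h' (G (h * h'⁻¹))) ∈ orbitSpan τ := by
    intro h' G hG
    rw [← hrange] at hG ⊢
    obtain ⟨f, rfl⟩ := hG
    exact ⟨f.mapRange (τ h') (map_zero _), funext fun h => linearCombination_mapRange hτ b f h' h⟩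
  have hcs : ∀ h h' i j, c h i j = ∑ l, c h' i l * τ h' (c (h * h'⁻¹) l j) := by
    intro h h' i j
    conv_lhs => rw [← inv_mul_cancel_right h h', hc]
    simp [Matrix.mul_apply]
  -- the entries of `c` lie in `orbitSpan τ`
  have hcB : ∀ i j, (fun h => c h i j) ∈ orbitSpan τ := by
    let I : Submodule K (_ →₀ K) := ⨅ i, ⨅ j, (orbitSpan τ).comap
      ((LinearMap.mulRight K (fun h => c h i j)).comp Φ)
    have hmemI : ∀ f, f ∈ I ↔ ∀ i j, Φ f * (fun h => c h i j) ∈ orbitSpan τ := by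
      intro f
      simp [I, Submodule.mem_iInf]
    have hIne : I ≠ ⊥ := by
      rw [← hrange] at hF
      obtain ⟨f, rfl⟩ := hF
      refine Submodule.ne_bot_iff _ |>.2 ⟨f, (hmemI f).2 hFc, ?_⟩
      rintro rfl
      simp at hF0
    obtain ⟨f, hf, hf0, hfix⟩ := exists_mem_forall_fixed τ I (fun h' f hf => by
      rw [hmemI] at hf ⊢
      intro i j
      have : Φ (f.mapRange (τ h') (map_zero _)) * (fun h => c h i j)
          = ∑ l, c h' i l • fun h => τ h' ((Φ f * fun h => c h l j) (h * h'⁻¹)) := by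
        ext h
        rw [Pi.mul_apply, linearCombination_mapRange hτ, hcs h h', Finset.mul_sum,
          Finset.sum_apply]
        refine Finset.sum_congr rfl fun l _ => ?_
        simp only [Pi.smul_apply, Pi.mul_apply, map_mul, smul_eq_mul, Φ]
        ring
      rw [this]
      exact Submodule.sum_mem _ fun l _ => Submodule.smul_mem _ _ (hshift h' _ (hf l j))) hIne
    rw [hmemI] at hf
    have hΦf : Φ f = orbitFun τ (Finsupp.linearCombination K b f) :=
      linearCombination_fixed b f hfix
    have hg0 : Finsupp.linearCombination K b f ≠ 0 := by
      intro h0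
      refine hf0 (hΦ ?_)
      rw [hΦf, h0, map_zero]
      ext h
      simp [orbitFun]
    intro i j
    have := mul_orbitFun_mem (hf i j) (Finsupp.linearCombination K b f)⁻¹
    convert this using 1
    ext h
    have h0 : τ h (Finsupp.linearCombination K b f) ≠ 0 := by simpa using hg0
    rw [hΦf]
    simp only [Pi.mul_apply, orbitFun, map_inv₀]
    field_simp
  rw [← hrange] at hcB
  choose f hf using hcB
  have hinv : ∀ j k h, (c h).mulVec (fun i => τ h (f i j k)) = fun i => f i j k := by
    intro j k h'
    ext i
    have : f i j = ∑ l, c h' i l • (f l j).mapRange (τ h') (map_zero _) := by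
      apply hΦ
      ext h
      rw [map_sum, Finset.sum_apply, hf]
      refine (hcs h h' i j).trans ?_
      refine Finset.sum_congr rfl fun l _ => ?_
      rw [map_smul, Pi.smul_apply, linearCombination_mapRange hτ]
      change _ = c h' i l * τ h' (Φ (f l j) (h * h'⁻¹))
      rw [hf]
    conv_rhs => rw [this]
    simp [Matrix.mulVec, dotProduct]
  rw [eq_top_iff, ← (Pi.basisFun K r).span_eq, Submodule.span_le]
  rintro _ ⟨j, rfl⟩
  let s : Finset _ := Finset.univ.biUnion fun i => (f i j).support
  have hs : ∀ i, (1 : Matrix r r K) i j = ∑ k ∈ s, f i j k * b k := by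
    intro i
    have := congrFun (hf i j) 1
    rw [hc1, Finsupp.linearCombination_apply, Finsupp.sum_of_support_subset (s := s)] at this
    · rw [← this]
      simp [orbitFun, hτ1]
    · exact Finset.subset_biUnion_of_mem (fun i => (f i j).support) (Finset.mem_univ i)
    · simp
  have : Pi.basisFun K r j = ∑ k ∈ s, b k • fun i => f i j k := by
    ext i
    rw [Finset.sum_apply]
    simp only [Pi.smul_apply, smul_eq_mul]
    rw [Finset.sum_congr rfl fun k _ => mul_comm (b k) (f i j k), ← hs i, Pi.basisFun_apply,
      Matrix.one_apply, Pi.single_apply]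
  rw [SetLike.mem_coe, this]
  exact Submodule.sum_mem _ fun k _ => Submodule.smul_mem _ _ (Submodule.subset_span (hinv j k))

end Cocycle

end RatQuot

/-! ### Purely transcendental extensions and their invariants -/

namespace RatQuot

open IntermediateField IntermediateField.algebraAdjoinAdjoin

theorem isAlgebraic_adjoin_of_adjoin_eq_top {k M κ : Type*} [Field k] [Field M] [Algebra k M]
    {y : κ → M} (hy : adjoin k (Set.range y) = ⊤) :
    Algebra.IsAlgebraic (Algebra.adjoin k (Set.range y)) M := by
  refine ⟨fun z => ?_⟩
  have hz : z ∈ adjoin k (Set.range y) := hy ▸ mem_top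
  obtain ⟨r, hr, s, hs, rfl⟩ := mem_adjoin_iff_div.1 hz
  rw [div_eq_mul_inv]
  exact (isAlgebraic_algebraMap (⟨r, hr⟩ : Algebra.adjoin k (Set.range y))).mul
    (isAlgebraic_algebraMap (⟨s, hs⟩ : Algebra.adjoin k (Set.range y))).inv

theorem algebraicIndependent_of_adjoin_eq_top {k M ι κ : Type*} [Field k] [Field M] [Algebra k M]
    [Fintype ι] [Fintype κ] {x : ι → M} {y : κ → M} (hx : AlgebraicIndependent k x)
    (hcard : Fintype.card κ = Fintype.card ι) (hy : adjoin k (Set.range y) = ⊤) :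
    AlgebraicIndependent k y := by
  have := isAlgebraic_adjoin_of_adjoin_eq_top hy
  have hle := hx.lift_cardinalMk_le_trdeg
  refine (Algebra.IsAlgebraic.isTranscendenceBasis_of_lift_le_trdeg_of_finite k y ?_).1
  rw [Cardinal.mk_fintype, Cardinal.lift_natCast] at hle ⊢
  rw [hcard]
  simpa using hle

/-- If the members of an algebraically independent finite family `x` are rational functions of
a family `y` of the same length, then `y` is algebraically independent. -/
theorem algebraicIndependent_of_mem_adjoin {k F ι κ : Type*} [Field k] [Field F] [Algebra k F]
    [Fintype ι] [Fintype κ] {x : ι → F} {y : κ → F} (hx : AlgebraicIndependent k x)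
    (hcard : Fintype.card κ = Fintype.card ι) (h : ∀ i, x i ∈ adjoin k (Set.range y)) :
    AlgebraicIndependent k y := by
  let x' : ι → adjoin k (Set.range y) := fun i => ⟨x i, h i⟩
  let y' : κ → adjoin k (Set.range y) := fun i => ⟨y i, subset_adjoin k _ ⟨i, rfl⟩⟩
  have hxx : (adjoin k (Set.range y)).val ∘ x' = x := rfl
  have hyy : (adjoin k (Set.range y)).val ∘ y' = y := rfl
  have hinj : Function.Injective (adjoin k (Set.range y)).val := Subtype.val_injective
  have hx' : AlgebraicIndependent k x' := by
    rw [← hxx] at hx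
    exact (AlgHom.algebraicIndependent_iff _ hinj).1 hx
  have hy' : adjoin k (Set.range y') = ⊤ := by
    refine map_injective (adjoin k (Set.range y)).val ?_
    rw [adjoin_map, ← Set.range_comp, hyy, ← AlgHom.fieldRange_eq_map, fieldRange_val]
  have := (AlgHom.algebraicIndependent_iff _ hinj).2
    (algebraicIndependent_of_adjoin_eq_top hx' hcard hy')
  rwa [hyy] at this

variable {F : Type*} [Field F] [Algebra ℂ F]

/-- A purely transcendental extension `E(s)` is the compositum of the linearly disjoint fields
`E` and `ℂ(s)`. -/
theorem linearDisjoint_adjoin {κ : Type*} {E : IntermediateField ℂ F} {s : κ → F}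
    (hs : AlgebraicIndependent E s) : E.LinearDisjoint (adjoin ℂ (Set.range s)) := by
  let b := Basis.ofVectorSpace ℂ E
  refine LinearDisjoint.of_basis_left b ?_
  rw [← LinearIndependent.iff_fractionRing (Algebra.adjoin ℂ (Set.range s))]
  rw [linearIndependent_iff']
  intro t g hg i hi
  have hp : ∀ j, ∃ p : MvPolynomial κ ℂ, MvPolynomial.aeval s p = (g j : F) := fun j => by
    exact (Algebra.adjoin_range_eq_range_aeval ℂ s).le (g j).2
  choose p hp using hp
  have hsum : ∑ j ∈ t, MvPolynomial.C (b j) * MvPolynomial.map (algebraMap ℂ E) (p j) = 0 := by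
    apply hs
    rw [map_zero, map_sum, ← hg]
    refine Finset.sum_congr rfl fun j _ => ?_
    rw [map_mul, MvPolynomial.aeval_C, MvPolynomial.aeval_map_algebraMap, hp, Subalgebra.smul_def,
      smul_eq_mul, mul_comm]
    rfl
  have hpi : p i = 0 := by
    ext m
    have := congrArg (MvPolynomial.coeff m) hsum
    simp only [MvPolynomial.coeff_sum, MvPolynomial.coeff_C_mul, MvPolynomial.coeff_map,
      MvPolynomial.coeff_zero] at this ⊢
    exact linearIndependent_iff'.1 b.linearIndependent t (fun j => MvPolynomial.coeff m (p j))
      (by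
        rw [← this]
        exact Finset.sum_congr rfl fun j _ => by rw [Algebra.smul_def, mul_comm]) i hi
  apply Subtype.ext
  rw [← hp, hpi, map_zero]
  rfl

/-- Elements which are algebraically independent over `ℂ` remain so over a linearly disjoint
field. -/
theorem algebraicIndependent_of_linearDisjoint {κ : Type*} {E L : IntermediateField ℂ F}
    (h : E.LinearDisjoint L) {s : κ → F} (hs : AlgebraicIndependent ℂ s) (hsL : ∀ i, s i ∈ L) :
    AlgebraicIndependent E s := by
  let s' : κ → L := fun i => ⟨s i, hsL i⟩
  have hs' : AlgebraicIndependent ℂ s' :=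
    (AlgHom.algebraicIndependent_iff L.val Subtype.val_injective).1 hs
  have h1 : LinearIndependent ℂ fun m : κ →₀ ℕ =>
      MvPolynomial.aeval s' (MvPolynomial.monomial m (1 : ℂ)) := by
    have := (MvPolynomial.basisMonomials κ ℂ).linearIndependent.map'
      (MvPolynomial.aeval s').toLinearMap (LinearMap.ker_eq_bot.2 hs')
    simpa [Function.comp_def] using this
  have h2 := h.linearIndependent_right h1
  rw [AlgebraicIndependent, injective_iff_map_eq_zero]
  intro p hp
  rw [linearIndependent_iff'] at h2
  ext m
  by_cases hm : m ∈ p.support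
  · refine congrArg Subtype.val (h2 p.support (fun m => p.coeff m) ?_ m hm)
    rw [← hp]
    conv_rhs => rw [p.as_sum, map_sum]
    refine Finset.sum_congr rfl fun m _ => ?_
    have : L.val (MvPolynomial.aeval s' (MvPolynomial.monomial m (1 : ℂ)))
        = m.prod fun i k => s i ^ k := by
      simp [MvPolynomial.aeval_monomial, Finsupp.prod, s']
    refine (congrArg (MvPolynomial.coeff m p • ·) this).trans ?_
    rw [MvPolynomial.aeval_monomial, Algebra.smul_def]
  · simpa using hm

theorem algebraicIndependent_mono {κ : Type*} {E E' : IntermediateField ℂ F} (h : E' ≤ E)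
    {s : κ → F} (hs : AlgebraicIndependent E s) : AlgebraicIndependent E' s :=
  algebraicIndependent_of_linearDisjoint ((linearDisjoint_adjoin hs).of_le_left h)
    (hs.restrictScalars (algebraMap ℂ E).injective) fun i => subset_adjoin _ _ ⟨i, rfl⟩

/-- The elements of `E` which are fixed by a family of automorphisms. -/
def fixedIn {Γ : Type*} (τ : Γ → F ≃ₐ[ℂ] F) (E : IntermediateField ℂ F) :
    IntermediateField ℂ F where
  carrier := {u | u ∈ E ∧ ∀ γ, τ γ u = u}
  mul_mem' hx hy := ⟨mul_mem hx.1 hy.1, fun g => by rw [map_mul, hx.2 g, hy.2 g]⟩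
  add_mem' hx hy := ⟨add_mem hx.1 hy.1, fun g => by rw [map_add, hx.2 g, hy.2 g]⟩
  algebraMap_mem' c := ⟨E.algebraMap_mem c, fun g => AlgEquiv.commutes _ c⟩
  inv_mem' x hx := ⟨inv_mem hx.1, fun g => by rw [map_inv₀, hx.2 g]⟩

theorem mem_fixedIn {Γ : Type*} {τ : Γ → F ≃ₐ[ℂ] F} {E : IntermediateField ℂ F} {u : F} :
    u ∈ fixedIn τ E ↔ u ∈ E ∧ ∀ γ, τ γ u = u := Iff.rfl

theorem fixedIn_le {Γ : Type*} (τ : Γ → F ≃ₐ[ℂ] F) (E : IntermediateField ℂ F) :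
    fixedIn τ E ≤ E := fun _ h => h.1

/-- Invariants of a compositum `E L` of linearly disjoint fields, where the automorphisms
preserve `E` and fix `L`: the possible denominators of an invariant form a stable
`E`-subspace of `E ⊗ L`, hence one of them is invariant. -/
theorem fixedIn_sup {Γ : Type*} (τ : Γ → F ≃ₐ[ℂ] F) {E L : IntermediateField ℂ F}
    (h : E.LinearDisjoint L) (hE : ∀ γ, ∀ u ∈ E, τ γ u ∈ E) (hL : ∀ γ, ∀ u ∈ L, τ γ u = u) :
    fixedIn τ (E ⊔ L) = fixedIn τ E ⊔ L := by
  refine le_antisymm ?_ (sup_le (fun u hu => ⟨le_sup_left (a := E) hu.1, hu.2⟩)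
    fun u hu => ⟨le_sup_right (a := E) hu, fun γ => hL γ u hu⟩)
  rintro u ⟨hu, hfix⟩
  let b := Basis.ofVectorSpace ℂ L
  let Φ := Finsupp.linearCombination E (fun k => (b k : F))
  have hΦ : Function.Injective Φ := h.linearIndependent_right b.linearIndependent
  -- the ring `E[L]` is the `E`-span of a basis of `L`
  have hspan : ∀ x ∈ Algebra.adjoin E (L : Set F), x ∈ LinearMap.range Φ := by
    intro x hx
    rw [← Subalgebra.mem_toSubmodule, Algebra.adjoin_eq_span] at hx
    have hcl : (Submonoid.closure (L : Set F) : Set F) ⊆ L := by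
      intro y hy
      exact (Submonoid.closure_le (S := L.toSubalgebra.toSubmonoid)).2 (le_refl _) hy
    refine (Submodule.span_le.2 fun y hy => ?_) hx
    rw [Finsupp.range_linearCombination]
    have hy' : y = L.val (⟨y, hcl hy⟩ : L) := rfl
    rw [hy', ← b.linearCombination_repr ⟨y, hcl hy⟩, Finsupp.linearCombination_apply, Finsupp.sum,
      map_sum]
    refine Submodule.sum_mem _ fun i _ => ?_
    rw [map_smul, ← algebraMap_smul E (b.repr _ i) (L.val (b i))]
    exact Submodule.smul_mem _ _ (Submodule.subset_span ⟨i, rfl⟩)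
  let τE : Γ → E →+* E := fun γ =>
    { toFun := fun x => ⟨τ γ (x : F), hE γ x x.2⟩
      map_one' := Subtype.ext (map_one (τ γ))
      map_mul' := fun x y => Subtype.ext (map_mul (τ γ) (x : F) y)
      map_zero' := Subtype.ext (map_zero (τ γ))
      map_add' := fun x y => Subtype.ext (map_add (τ γ) (x : F) y) }
  have hΦτ : ∀ γ f, Φ (f.mapRange (τE γ) (map_zero _)) = τ γ (Φ f) := by
    intro γ f
    simp only [Φ, Finsupp.linearCombination_apply]
    rw [Finsupp.sum_mapRange_index (by simp), Finsupp.sum, Finsupp.sum, map_sum]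
    refine Finset.sum_congr rfl fun i _ => ?_
    rw [Algebra.smul_def, Algebra.smul_def, map_mul, hL γ (b i) (b i).2]
    rfl
  have hfixΦ : ∀ f, (∀ k γ, τE γ (f k) = f k) → Φ f ∈ fixedIn τ E ⊔ L := by
    intro f hf
    simp only [Φ, Finsupp.linearCombination_apply]
    refine sum_mem fun k _ => ?_
    simp only [Algebra.smul_def]
    refine mul_mem (le_sup_left (b := L) ?_) (le_sup_right (b := L) (b k).2)
    exact ⟨(f k).2, fun γ => congrArg Subtype.val (hf k γ)⟩
  -- the denominators of `u` in `E[L]`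
  let I : Submodule E (_ →₀ E) := (LinearMap.range Φ).comap ((LinearMap.mulRight E u).comp Φ)
  have hmemI : ∀ f, f ∈ I ↔ Φ f * u ∈ LinearMap.range Φ := fun f => Iff.rfl
  have hIne : I ≠ ⊥ := by
    have hu' : u ∈ adjoin E (L : Set F) := by
      have : E ⊔ L ≤ (adjoin E (L : Set F)).restrictScalars ℂ :=
        sup_le (fun x hx => (adjoin E (L : Set F)).algebraMap_mem ⟨x, hx⟩)
          fun x hx => subset_adjoin E _ hx
      exact this hu
    obtain ⟨r, hr, s, hs, rfl⟩ := mem_adjoin_iff_div.1 hu'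
    obtain ⟨f, hf⟩ := hspan s hs
    obtain ⟨g, hg⟩ := hspan r hr
    by_cases hs0 : s = 0
    · obtain ⟨f1, hf1⟩ := hspan 1 (one_mem _)
      refine Submodule.ne_bot_iff _ |>.2 ⟨f1, ?_, ?_⟩
      · rw [hmemI, hs0, div_zero, mul_zero]
        exact zero_mem _
      · rintro rfl
        simp at hf1
    · refine Submodule.ne_bot_iff _ |>.2 ⟨f, ?_, ?_⟩
      · rw [hmemI, hf, mul_div_cancel₀ _ hs0]
        exact ⟨g, hg⟩
      · rintro rfl
        exact hs0 (by rw [← hf, map_zero])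
  obtain ⟨f, hf, hf0, hffix⟩ := exists_mem_forall_fixed τE I (fun γ f hf => by
    rw [hmemI] at hf ⊢
    obtain ⟨g, hg⟩ := hf
    exact ⟨g.mapRange (τE γ) (map_zero _), by rw [hΦτ, hΦτ, hg, map_mul, hfix]⟩) hIne
  obtain ⟨g, hg⟩ := (hmemI f).1 hf
  have hgfix : ∀ k γ, τE γ (g k) = g k := by
    intro k γ
    have : g.mapRange (τE γ) (map_zero _) = g := by
      apply hΦ
      rw [hΦτ, hg, map_mul, hfix, ← hΦτ]
      congr 2
      exact Finsupp.ext fun k => hffix k γ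
    exact DFunLike.congr_fun this k
  have hΦf0 : Φ f ≠ 0 := fun h0 => hf0 (hΦ (by rw [h0, map_zero]))
  have : u = Φ g / Φ f := by rw [hg]; field_simp
  rw [this]
  exact div_mem (hfixΦ g hgfix) (hfixΦ f hffix)

/-- A purely transcendental extension `k(s)` inside a field is the function field of `ℂ^n × Y`,
where `k` is the function field of `Y`. -/
theorem areBirational_affineTimes_of_eq {κ : Type*} [Fintype κ] {n : ℕ}
    (hn : Fintype.card κ = n) {k L : IntermediateField ℂ F} {s : κ → F}
    (hs : AlgebraicIndependent k s) (hL : L = k ⊔ adjoin ℂ (Set.range s)) :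
    AreBirational L (affineTimes n k) := by
  let e : κ ≃ Fin n := Fintype.equivFinOfCardEq hn
  have hs' : AlgebraicIndependent k (s ∘ e.symm) := hs.comp _ e.symm.injective
  have hr : Set.range (s ∘ e.symm) = Set.range s := e.symm.surjective.range_comp s
  have hL' : L = (adjoin k (Set.range (s ∘ e.symm))).restrictScalars ℂ := by
    rw [hr, hL]
    exact (restrictScalars_adjoin_eq_sup ℂ k (Set.range s)).symm
  subst hL'
  exact ⟨(hs'.aevalEquivField.restrictScalars ℂ).symm⟩

theorem AreBirational.symm {K L : Type*} [Field K] [Field L] [Algebra ℂ K] [Algebra ℂ L]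
    (h : AreBirational K L) : AreBirational L K := h.map AlgEquiv.symm

theorem AreBirational.trans {K L M : Type*} [Field K] [Field L] [Field M] [Algebra ℂ K]
    [Algebra ℂ L] [Algebra ℂ M] (h : AreBirational K L) (h' : AreBirational L M) :
    AreBirational K M := ⟨h.some.trans h'.some⟩

theorem AreBirational.affineTimes {K L : Type*} [Field K] [Field L] [Algebra ℂ K] [Algebra ℂ L]
    (h : AreBirational K L) (n : ℕ) : AreBirational (affineTimes n K) (affineTimes n L) :=
  ⟨IsFractionRing.algEquivOfAlgEquiv (MvPolynomial.mapAlgEquiv (Fin n) h.some)⟩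

theorem adjoin_range_X_eq_top (K : Type*) [Field K] (κ : Type*) :
    adjoin K (Set.range fun i : κ =>
      algebraMap (MvPolynomial κ K) (FractionRing (MvPolynomial κ K)) (MvPolynomial.X i)) = ⊤ := by
  rw [eq_top_iff]
  rintro u -
  obtain ⟨a, b, hb, rfl⟩ := IsFractionRing.div_surjective (A := MvPolynomial κ K) u
  have key : ∀ p : MvPolynomial κ K, algebraMap (MvPolynomial κ K)
      (FractionRing (MvPolynomial κ K)) p ∈ adjoin K (Set.range fun i : κ =>
      algebraMap (MvPolynomial κ K) (FractionRing (MvPolynomial κ K)) (MvPolynomial.X i)) := by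
    intro p
    induction p using MvPolynomial.induction_on with
    | C c => exact (adjoin K _).algebraMap_mem c
    | add p q hp hq => rw [map_add]; exact add_mem hp hq
    | mul_X p i hp => rw [map_mul]; exact mul_mem hp (subset_adjoin _ _ ⟨i, rfl⟩)
  exact div_mem (key a) (key b)

theorem areBirational_affineTimes_affineTimes (K : Type*) [Field K] [Algebra ℂ K] (p q : ℕ) :
    AreBirational (affineTimes p (affineTimes q K)) (affineTimes (p + q) K) := by
  let K₁ := affineTimes q K
  let Ω := affineTimes p K₁
  let x : Fin q → K₁ := fun i => algebraMap (MvPolynomial (Fin q) K) K₁ (MvPolynomial.X i)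
  let y : Fin p → Ω := fun i => algebraMap (MvPolynomial (Fin p) K₁) Ω (MvPolynomial.X i)
  have hx : AlgebraicIndependent K x := (MvPolynomial.algebraicIndependent_X (Fin q) K).map'
    (f := IsScalarTower.toAlgHom K (MvPolynomial (Fin q) K) K₁)
    (IsFractionRing.injective (MvPolynomial (Fin q) K) K₁)
  have hy : AlgebraicIndependent K₁ y := (MvPolynomial.algebraicIndependent_X (Fin p) K₁).map'
    (f := IsScalarTower.toAlgHom K₁ (MvPolynomial (Fin p) K₁) Ω)
    (IsFractionRing.injective (MvPolynomial (Fin p) K₁) Ω)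
  have hz := hx.sumElim_comp hy
  have htop : adjoin K (Set.range (Sum.elim y (algebraMap K₁ Ω ∘ x))) = ⊤ := by
    rw [eq_top_iff]
    have h1 : ∀ u : K₁, algebraMap K₁ Ω u
        ∈ adjoin K (Set.range (Sum.elim y (algebraMap K₁ Ω ∘ x))) := by
      have : (⊤ : IntermediateField K K₁) ≤ (adjoin K (Set.range
          (Sum.elim y (algebraMap K₁ Ω ∘ x)))).comap (IsScalarTower.toAlgHom K K₁ Ω) := by
        rw [← adjoin_range_X_eq_top K (Fin q), adjoin_le_iff]
        rintro _ ⟨i, rfl⟩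
        exact subset_adjoin _ _ ⟨Sum.inr i, rfl⟩
      exact fun u => this (mem_top (x := u))
    rintro u -
    have hu : u ∈ (⊤ : IntermediateField K₁ Ω) := mem_top
    rw [← adjoin_range_X_eq_top K₁ (Fin p)] at hu
    induction hu using adjoin_induction with
    | mem x hx =>
      obtain ⟨i, rfl⟩ := hx
      exact subset_adjoin _ _ ⟨Sum.inl i, rfl⟩
    | algebraMap u => exact h1 u
    | add x y _ _ hx hy => exact add_mem hx hy
    | mul x y _ _ hx hy => exact mul_mem hx hy
    | inv x _ hx => exact inv_mem hx
  let e : Ω ≃ₐ[K] FractionRing (MvPolynomial (Fin (p + q)) K) :=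
    (topEquiv.symm.trans (equivOfEq htop.symm)).trans
      (hz.aevalEquivField.symm.trans
        (IsFractionRing.algEquivOfAlgEquiv (R := K)
          (A := MvPolynomial (Fin p ⊕ Fin q) K) (B := MvPolynomial (Fin (p + q)) K)
          (MvPolynomial.renameEquiv K finSumFinEquiv)))
  exact ⟨e.restrictScalars ℂ⟩

end RatQuot

/-! ### Coordinates on projective spaces -/

namespace RatQuot

open IntermediateField

section Coordinates

variable {V ι : Type*} [AddCommGroup V] [Module ℂ V] (b : Basis ι ℂ V)

/-- The coordinates of a basis, as polynomial functions. -/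
noncomputable def polyCoord (i : ι) : PolyRing V :=
  ⟨fun v => b.coord i v, Algebra.subset_adjoin ⟨b.coord i, rfl⟩⟩

/-- The coordinates of a basis, as rational functions. -/
noncomputable def ratCoord (i : ι) : RatFun V := algebraMap (PolyRing V) (RatFun V) (polyCoord b i)

theorem aeval_polyCoord_apply (p : MvPolynomial ι ℂ) (v : V) :
    (MvPolynomial.aeval (polyCoord b) p).1 v = MvPolynomial.eval (b.repr v) p := by
  induction p using MvPolynomial.induction_on with
  | C c =>
    rw [MvPolynomial.aeval_C, MvPolynomial.eval_C]
    rfl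
  | add p q hp hq =>
    rw [map_add, map_add, ← hp, ← hq]
    rfl
  | mul_X p i hp =>
    rw [map_mul, map_mul, ← hp, MvPolynomial.aeval_X, MvPolynomial.eval_X]
    rfl

variable [Fintype ι]

theorem aeval_polyCoord_bijective :
    Function.Bijective (MvPolynomial.aeval (polyCoord b) : MvPolynomial ι ℂ →ₐ[ℂ] PolyRing V) := by
  constructor
  · intro p q h
    refine MvPolynomial.funext fun x => ?_
    have := congrFun (congrArg Subtype.val h) (b.equivFun.symm x)
    rw [aeval_polyCoord_apply, aeval_polyCoord_apply] at this
    have hx : (b.repr (b.equivFun.symm x) : ι → ℂ) = x := b.equivFun.apply_symm_apply x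
    rwa [hx] at this
  · rintro ⟨p, hp⟩
    have : ∃ P : MvPolynomial ι ℂ, ∀ v, p v = MvPolynomial.eval (b.repr v) P := by
      induction hp using Algebra.adjoin_induction with
      | mem x hx =>
        obtain ⟨l, rfl⟩ := hx
        refine ⟨∑ i, MvPolynomial.C (l (b i)) * MvPolynomial.X i, fun v => ?_⟩
        conv_lhs => rw [← b.sum_repr v]
        simp only [map_sum, map_smul, smul_eq_mul, map_mul, MvPolynomial.eval_C,
          MvPolynomial.eval_X, mul_comm]
      | algebraMap c => exact ⟨MvPolynomial.C c, fun v => by simp⟩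
      | add x y _ _ hx hy =>
        obtain ⟨r, hr⟩ := hx
        obtain ⟨s, hs⟩ := hy
        exact ⟨r + s, fun t => by simp [hr, hs]⟩
      | mul x y _ _ hx hy =>
        obtain ⟨r, hr⟩ := hx
        obtain ⟨s, hs⟩ := hy
        exact ⟨r * s, fun t => by simp [hr, hs]⟩
    obtain ⟨P, hP⟩ := this
    exact ⟨P, Subtype.ext (funext fun v => by rw [aeval_polyCoord_apply]; exact (hP v).symm)⟩

/-- Polynomial functions are polynomials in the coordinates. -/
noncomputable def polyRingEquiv : MvPolynomial ι ℂ ≃ₐ[ℂ] PolyRing V :=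
  AlgEquiv.ofBijective _ (aeval_polyCoord_bijective b)

theorem polyRingEquiv_X (i : ι) : polyRingEquiv b (MvPolynomial.X i) = polyCoord b i :=
  MvPolynomial.aeval_X _ i

theorem algebraMap_polyRingEquiv (p : MvPolynomial ι ℂ) :
    algebraMap (PolyRing V) (RatFun V) (polyRingEquiv b p) = MvPolynomial.aeval (ratCoord b) p := by
  have : (IsScalarTower.toAlgHom ℂ (PolyRing V) (RatFun V)).comp (polyRingEquiv b).toAlgHom
      = MvPolynomial.aeval (ratCoord b) := by
    refine MvPolynomial.algHom_ext fun i => ?_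
    rw [MvPolynomial.aeval_X, ratCoord, ← polyRingEquiv_X]
    rfl
  exact DFunLike.congr_fun this p

theorem algebraicIndependent_ratCoord : AlgebraicIndependent ℂ (ratCoord b) := by
  intro p q h
  rw [← algebraMap_polyRingEquiv, ← algebraMap_polyRingEquiv] at h
  exact (polyRingEquiv b).injective (IsFractionRing.injective (PolyRing V) (RatFun V) h)

theorem ratSubst_ratCoord (L : V ≃ₗ[ℂ] V) (i : ι) :
    ratSubst L (ratCoord b i) = ∑ j, b.repr (L (b j)) i • ratCoord b j := by
  have h1 : ratSubst L (ratCoord b i)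
      = algebraMap (PolyRing V) (RatFun V) (polySubst L (polyCoord b i)) := by
    simp [ratSubst, ratCoord]
  have h2 : polySubst L (polyCoord b i) = ∑ j, b.repr (L (b j)) i • polyCoord b j := by
    refine (aeval_polyCoord_bijective b).2 (polySubst L (polyCoord b i)) |>.elim fun _ _ => ?_
    apply Subtype.ext
    funext v
    have : ∀ s : Finset ι, (∑ j ∈ s, b.repr (L (b j)) i • polyCoord b j).1 v
        = ∑ j ∈ s, b.repr (L (b j)) i * b.repr v j := by
      classical
      intro s
      induction s using Finset.induction_on with
      | empty => rfl
      | insert j s hj ih =>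
        rw [Finset.sum_insert hj, Finset.sum_insert hj, ← ih]
        rfl
    rw [this]
    change b.repr (L v) i = _
    conv_lhs => rw [← b.sum_repr v]
    simp only [map_sum, map_smul, Finsupp.coe_finsetSum, Finset.sum_apply, Finsupp.coe_smul,
      Pi.smul_apply, smul_eq_mul, mul_comm]
  rw [h1, h2, map_sum]
  refine Finset.sum_congr rfl fun j _ => ?_
  exact map_smul (IsScalarTower.toAlgHom ℂ (PolyRing V) (RatFun V)) _ _

/-- The field generated by the quotients of the members of a family. -/
noncomputable def ratioField {F : Type*} [Field F] [Algebra ℂ F] {ι : Type*} (y : ι → F) :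
    IntermediateField ℂ F :=
  adjoin ℂ (Set.range fun p : ι × ι => y p.1 / y p.2)

theorem div_mem_ratioField {F : Type*} [Field F] [Algebra ℂ F] {ι : Type*} (y : ι → F) (i j : ι) :
    y i / y j ∈ ratioField y := subset_adjoin _ _ ⟨(i, j), rfl⟩

/-- A quotient of forms of degree `n` is a quotient of polynomials in the ratios `xᵢ / x₀`, after
division of both forms by `x₀ⁿ`. -/
theorem projField_eq_ratioField [Nonempty ι] : projField V = ratioField (ratCoord b) := by
  refine le_antisymm ?_ (adjoin_le_iff.2 ?_)
  · rintro _ ⟨n, p, q, hp, hq, hq0, rfl⟩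
    obtain ⟨i₀⟩ := ‹Nonempty ι›
    have h0 : ratCoord b i₀ ≠ 0 := (algebraicIndependent_ratCoord b).ne_zero i₀
    have key : ∀ p : PolyRing V, IsHomog n p →
        algebraMap (PolyRing V) (RatFun V) p / ratCoord b i₀ ^ n ∈ ratioField (ratCoord b) := by
      intro p hp
      obtain ⟨P, rfl⟩ := (polyRingEquiv b).surjective p
      -- homogeneity as an identity of polynomials with a further variable
      have hP : MvPolynomial.aeval (fun i => MvPolynomial.X none * MvPolynomial.X (some i)) P
          = MvPolynomial.X none ^ n * MvPolynomial.rename some P := by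
        refine MvPolynomial.funext fun (x : Option ι → ℂ) => ?_
        have := hp (x none) (b.equivFun.symm fun i => x (some i))
        have e1 : ∀ v, (polyRingEquiv b P).1 v = MvPolynomial.eval (b.repr v) P :=
          aeval_polyCoord_apply b P
        have e2 : (b.repr (b.equivFun.symm fun i => x (some i)) : ι → ℂ) = fun i => x (some i) :=
          b.equivFun.apply_symm_apply _
        rw [e1, e1, map_smul, Finsupp.coe_smul, e2] at this
        rw [map_mul, map_pow, MvPolynomial.eval_X, MvPolynomial.eval_rename]
        refine Eq.trans ?_ this
        rw [← MvPolynomial.coe_aeval_eq_eval, ← MvPolynomial.coe_aeval_eq_eval]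
        change MvPolynomial.aeval x (MvPolynomial.aeval _ P) = _
        rw [← AlgHom.comp_apply, MvPolynomial.comp_aeval]
        have e3 : (fun i => MvPolynomial.aeval x
            (MvPolynomial.X none * MvPolynomial.X (some i) : MvPolynomial (Option ι) ℂ))
            = x none • fun i => x (some i) := by
          ext i
          simp
        rw [e3]
        rfl
      have h1 := congrArg (MvPolynomial.aeval
        (fun o : Option ι => o.elim (ratCoord b i₀)⁻¹ (ratCoord b))) hP
      rw [← AlgHom.comp_apply, MvPolynomial.comp_aeval, map_mul, map_pow, MvPolynomial.aeval_X,
        MvPolynomial.aeval_rename] at h1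
      have h2 : algebraMap (PolyRing V) (RatFun V) (polyRingEquiv b P) / ratCoord b i₀ ^ n
          = MvPolynomial.aeval (fun i => ratCoord b i / ratCoord b i₀) P := by
        rw [algebraMap_polyRingEquiv, div_eq_mul_inv, mul_comm, ← inv_pow]
        refine (Eq.trans ?_ h1.symm).trans ?_
        · rfl
        · congr 2
          ext i
          simp [div_eq_mul_inv, mul_comm]
      rw [h2]
      have hsub : Set.range (fun i => ratCoord b i / ratCoord b i₀)
          ⊆ Set.range fun p : ι × ι => ratCoord b p.1 / ratCoord b p.2 := by
        rintro _ ⟨i, rfl⟩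
        exact ⟨(i, i₀), rfl⟩
      refine algebra_adjoin_le_adjoin _ _ (Algebra.adjoin_mono hsub ?_)
      rw [Algebra.adjoin_range_eq_range_aeval]
      exact ⟨P, rfl⟩
    have := div_mem (key p hp) (key q hq)
    rwa [div_div_div_cancel_right₀ (pow_ne_zero n h0)] at this
  · rintro _ ⟨⟨i, j⟩, rfl⟩
    have h1 : ∀ i, IsHomog 1 (polyCoord b i) := fun i t v => by
      change b.coord i (t • v) = t ^ 1 * b.coord i v
      simp
    refine ⟨1, polyCoord b i, polyCoord b j, h1 i, h1 j, fun h => ?_, rfl⟩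
    exact (algebraicIndependent_ratCoord b).ne_zero j (by rw [ratCoord, h, map_zero])

/-- A copy of the field of invariants of `ℙV`: the invariants in the field of the quotients of
algebraically independent elements which are transformed like the coordinates of `V`, up
to a common factor. -/
theorem projQuotField_areBirational_fixedIn [Nonempty ι] {Γ : Type*} [Group Γ]
    (ρ : Representation ℂ Γ V) {F : Type*} [Field F] [Algebra ℂ F] {y : ι → F}
    (hy : AlgebraicIndependent ℂ y) (τ : Γ → F ≃ₐ[ℂ] F) (μ : Γ → F)
    (hτ : ∀ g i, τ g (y i) = μ g * ∑ j, b.repr (ρ g (b j)) i • y j) :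
    AreBirational (projQuotField ρ) (fixedIn τ (ratioField y)) := by
  let f : PolyRing V →ₐ[ℂ] F := (MvPolynomial.aeval y).comp (polyRingEquiv b).symm.toAlgHom
  have hf : Function.Injective f := Function.Injective.comp (g := MvPolynomial.aeval y) hy
    (polyRingEquiv b).symm.injective
  let φ : RatFun V →ₐ[ℂ] F := IsFractionRing.liftAlgHom hf
  have hφ : ∀ i, φ (ratCoord b i) = y i := by
    intro i
    have : φ (ratCoord b i) = f (polyCoord b i) := IsFractionRing.lift_algebraMap hf _
    rw [this, ← polyRingEquiv_X]
    change MvPolynomial.aeval y ((polyRingEquiv b).symm (polyRingEquiv b (MvPolynomial.X i))) = _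
    rw [AlgEquiv.symm_apply_apply, MvPolynomial.aeval_X]
  have hmap : (projField V).map φ = ratioField y := by
    rw [projField_eq_ratioField b, ratioField, adjoin_map, ← Set.range_comp, ratioField]
    congr 2
    ext p
    simp [hφ]
  have hμ : ∀ g, μ g ≠ 0 := by
    intro g h0
    obtain ⟨i₀⟩ := ‹Nonempty ι›
    have := hτ g i₀
    rw [h0, zero_mul] at this
    exact hy.ne_zero i₀ (by simpa using this)
  have hint : ∀ g, ∀ u ∈ projField V, φ (ratSubst (repEquiv ρ g) u) = τ g (φ u) := by
    intro g u hu
    rw [projField_eq_ratioField b] at hu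
    induction hu using adjoin_induction with
    | mem x hx =>
      obtain ⟨⟨i, j⟩, rfl⟩ := hx
      have h1 : ∀ i, φ (ratSubst (repEquiv ρ g) (ratCoord b i)) = (μ g)⁻¹ * τ g (y i) := by
        intro i
        rw [ratSubst_ratCoord, hτ, inv_mul_cancel_left₀ (hμ g), map_sum]
        refine Finset.sum_congr rfl fun j _ => ?_
        rw [map_smul, hφ]
        rfl
      simp only [map_div₀, h1, hφ]
      rw [mul_div_mul_left _ _ (inv_ne_zero (hμ g))]
    | algebraMap c => simp
    | add x y _ _ hx hy => simp [hx, hy]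
    | mul x y _ _ hx hy => simp [hx, hy]
    | inv x _ hx => simp [hx]
  have : fixedIn τ (ratioField y) = (projQuotField ρ).map φ := by
    ext u
    rw [mem_fixedIn, ← hmap]
    constructor
    · rintro ⟨⟨v, hv, rfl⟩, hu⟩
      refine ⟨v, ⟨hv, fun g => φ.injective ?_⟩, rfl⟩
      exact (hint g v hv).trans (hu g)
    · rintro ⟨v, ⟨hv, hvg⟩, rfl⟩
      refine ⟨⟨v, hv, rfl⟩, fun g => ?_⟩
      change τ g (φ v) = φ v
      rw [← hint g v hv, hvg]
  rw [this]
  exact ⟨(projQuotField ρ).equivMap φ⟩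

end Coordinates

end RatQuot

/-! ### Families of rational functions parametrized by an algebraic group -/

namespace RatQuot

/-- Polynomials in `ι` variables whose coefficients are regular functions on `H`: regular functions
on `H × ℂ^ι`, considered as families of polynomials. -/
noncomputable def familyRing (H ι : Type*) [Group H] [AlgGroup H] :
    Subalgebra ℂ (H → MvPolynomial ι ℂ) :=
  (AlgGroup.regular (G := H)).map
    (AlgHom.pi fun h => (Algebra.ofId ℂ (MvPolynomial ι ℂ)).comp
      (Pi.evalAlgHom ℂ (fun _ : H => ℂ) h)) ⊔
  (AlgHom.pi fun _ : H => AlgHom.id ℂ (MvPolynomial ι ℂ)).range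

section FamilyRing

variable {H ι : Type*} [Group H] [AlgGroup H]

theorem C_mem_familyRing {f : H → ℂ} (hf : f ∈ AlgGroup.regular (G := H)) :
    (fun h => MvPolynomial.C (f h)) ∈ familyRing H ι :=
  le_sup_left (b := (AlgHom.pi fun _ : H => AlgHom.id ℂ (MvPolynomial ι ℂ)).range) ⟨f, hf, rfl⟩

theorem const_mem_familyRing (p : MvPolynomial ι ℂ) : (fun _ : H => p) ∈ familyRing H ι :=
  SetLike.le_def.1 le_sup_right ⟨p, rfl⟩

theorem familyRing_fg [Finite ι] : (familyRing H ι).FG := by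
  refine Subalgebra.FG.sup (AlgGroup.fg.map _) ?_
  rw [← Algebra.map_top]
  exact Subalgebra.FG.map _ Algebra.FiniteType.out

/-- The characters of `O(H)[ι]` are the points of `H × ℂ^ι`. -/
theorem exists_eval_familyRing (φ : familyRing H ι →ₐ[ℂ] ℂ) :
    ∃ (h : H) (x : ι → ℂ), ∀ Q : familyRing H ι, φ Q = MvPolynomial.eval x (Q.1 h) := by
  let φ₁ : AlgGroup.regular (G := H) →ₐ[ℂ] ℂ := φ.comp
    { toFun := fun f => ⟨fun h => MvPolynomial.C (f.1 h), C_mem_familyRing f.2⟩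
      map_one' := Subtype.ext (funext fun _ => map_one MvPolynomial.C)
      map_mul' := fun _ _ => Subtype.ext (funext fun _ => map_mul MvPolynomial.C _ _)
      map_zero' := Subtype.ext (funext fun _ => map_zero MvPolynomial.C)
      map_add' := fun _ _ => Subtype.ext (funext fun _ => map_add MvPolynomial.C _ _)
      commutes' := fun _ => rfl }
  obtain ⟨h, hh⟩ := AlgGroup.exists_eval φ₁
  let φ₂ : MvPolynomial ι ℂ →ₐ[ℂ] ℂ := φ.comp
    { toFun := fun p => ⟨fun _ => p, const_mem_familyRing p⟩
      map_one' := rfl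
      map_mul' := fun _ _ => rfl
      map_zero' := rfl
      map_add' := fun _ _ => rfl
      commutes' := fun _ => rfl }
  let x : ι → ℂ := fun i => φ₂ (MvPolynomial.X i)
  have h2 : ∀ p, φ₂ p = MvPolynomial.eval x p := by
    intro p
    have : φ₂ = MvPolynomial.aeval x := MvPolynomial.algHom_ext fun i => by
      rw [MvPolynomial.aeval_X]
    rw [this]
    rfl
  refine ⟨h, x, fun Q => ?_⟩
  obtain ⟨Q, hQ⟩ := Q
  have hQ' := hQ
  rw [familyRing, Algebra.sup_def] at hQ'
  induction hQ' using Algebra.adjoin_induction with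
  | mem Q hQ' =>
    rcases hQ' with ⟨f, hf, rfl⟩ | ⟨p, rfl⟩
    · refine (hh ⟨f, hf⟩).trans ?_
      exact (MvPolynomial.eval_C _).symm
    · exact h2 p
  | algebraMap c =>
    refine (φ.commutes c).trans ?_
    exact (MvPolynomial.eval_C _).symm
  | add P Q hP' hQ' ihP ihQ =>
    have hP : P ∈ familyRing H ι := by rwa [familyRing, Algebra.sup_def]
    have hQ : Q ∈ familyRing H ι := by rwa [familyRing, Algebra.sup_def]
    have := (map_add φ ⟨P, hP⟩ ⟨Q, hQ⟩).trans (congrArg₂ (· + ·) (ihP hP) (ihQ hQ))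
    exact this.trans (map_add (MvPolynomial.eval x) _ _).symm
  | mul P Q hP' hQ' ihP ihQ =>
    have hP : P ∈ familyRing H ι := by rwa [familyRing, Algebra.sup_def]
    have hQ : Q ∈ familyRing H ι := by rwa [familyRing, Algebra.sup_def]
    have := (map_mul φ ⟨P, hP⟩ ⟨Q, hQ⟩).trans (congrArg₂ (· * ·) (ihP hP) (ihQ hQ))
    exact this.trans (map_mul (MvPolynomial.eval x) _ _).symm

/-- A function on the principal open subset `{D ≠ 0}` of `H × ℂ^ι` which is locally a quotient
of elements of `O(H)[ι]` is globally of the form `P / D ^ k`. -/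
theorem exists_mul_pow_eq_of_locally [Finite ι] {D : H → MvPolynomial ι ℂ}
    (hD : D ∈ familyRing H ι) (v : H → (ι → ℂ) → ℂ)
    (hv : ∀ h x, MvPolynomial.eval x (D h) ≠ 0 → ∃ p ∈ familyRing H ι, ∃ q ∈ familyRing H ι,
      MvPolynomial.eval x (q h) ≠ 0 ∧ ∀ g y, MvPolynomial.eval y (D g) ≠ 0 →
        MvPolynomial.eval y (q g) ≠ 0 →
        v g y = MvPolynomial.eval y (p g) / MvPolynomial.eval y (q g)) :
    ∃ k : ℕ, ∃ P ∈ familyRing H ι, ∀ h x, MvPolynomial.eval x (D h) ≠ 0 →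
      v h x * MvPolynomial.eval x (D h) ^ k = MvPolynomial.eval x (P h) := by
  -- the ideal of the denominators of `v`
  let I : Ideal (familyRing H ι) :=
    { carrier := {s | ∃ P ∈ familyRing H ι, ∀ h x, MvPolynomial.eval x (D h) ≠ 0 →
        v h x * MvPolynomial.eval x (s.1 h) = MvPolynomial.eval x (P h)}
      zero_mem' := ⟨0, zero_mem _, fun h x _ => by simp⟩
      add_mem' := by
        rintro s t ⟨P, hP, h1⟩ ⟨Q, hQ, h2⟩
        refine ⟨P + Q, add_mem hP hQ, fun h x hx => ?_⟩
        have e1 : (s + t).1 h = s.1 h + t.1 h := rfl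
        rw [e1, map_add, mul_add, h1 h x hx, h2 h x hx, Pi.add_apply, map_add]
      smul_mem' := by
        rintro s t ⟨P, hP, h1⟩
        refine ⟨s.1 * P, mul_mem s.2 hP, fun h x hx => ?_⟩
        have e1 : (s • t).1 h = s.1 h * t.1 h := rfl
        rw [e1, map_mul, mul_left_comm, h1 h x hx, Pi.mul_apply, map_mul] }
  have : Algebra.FiniteType ℂ (familyRing H ι) :=
    (Subalgebra.fg_iff_finiteType _).1 familyRing_fg
  have hrad := mem_radical_of_forall_algHom I ⟨D, hD⟩ fun φ hφ => by
    obtain ⟨h, x, hx⟩ := exists_eval_familyRing φ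
    rw [hx]
    by_contra hne
    obtain ⟨p, hp, q, hq, hq0, hpq⟩ := hv h x hne
    have hmem : (⟨q * q, mul_mem hq hq⟩ : familyRing H ι) ∈ I := by
      refine ⟨p * q, mul_mem hp hq, fun g y hy => ?_⟩
      change v g y * MvPolynomial.eval y (q g * q g) = MvPolynomial.eval y (p g * q g)
      rw [map_mul, map_mul]
      by_cases h0 : MvPolynomial.eval y (q g) = 0
      · simp [h0]
      · rw [hpq g y hy h0]
        field_simp
    have := hφ _ hmem
    rw [hx] at this
    change MvPolynomial.eval x (q h * q h) = 0 at this
    rw [map_mul, mul_self_eq_zero] at this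
    exact hq0 this
  obtain ⟨k, P, hP, hk⟩ := hrad
  refine ⟨k, P, hP, fun h x hx => ?_⟩
  rw [← hk h x hx]
  congr 1
  exact (map_pow (MvPolynomial.eval x) (D h) k).symm

end FamilyRing

section Values

variable {ι K : Type*} [Field K] [Algebra ℂ K] (A : ι → K)

/-- The rational function `k` of the algebraically independent elements `A` is defined at the point
`x`, with value `v`. -/
def HasValue (x : ι → ℂ) (k : K) (v : ℂ) : Prop :=
  ∃ p q : MvPolynomial ι ℂ, MvPolynomial.eval x q ≠ 0 ∧
    k * MvPolynomial.aeval A q = MvPolynomial.aeval A p ∧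
    v * MvPolynomial.eval x q = MvPolynomial.eval x p

variable {A}

theorem hasValue_aeval (x : ι → ℂ) (p : MvPolynomial ι ℂ) :
    HasValue A x (MvPolynomial.aeval A p) (MvPolynomial.eval x p) := ⟨p, 1, by simp⟩

theorem HasValue.add {x : ι → ℂ} {k l : K} {v w : ℂ} (hk : HasValue A x k v)
    (hl : HasValue A x l w) : HasValue A x (k + l) (v + w) := by
  obtain ⟨p, q, hq, h1, h2⟩ := hk
  obtain ⟨p', q', hq', h1', h2'⟩ := hl
  refine ⟨p * q' + p' * q, q * q', by simp [hq, hq'], ?_, ?_⟩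
  · simp only [map_mul, map_add, ← h1, ← h1']
    ring
  · simp only [map_mul, map_add, ← h2, ← h2']
    ring

theorem HasValue.mul {x : ι → ℂ} {k l : K} {v w : ℂ} (hk : HasValue A x k v)
    (hl : HasValue A x l w) : HasValue A x (k * l) (v * w) := by
  obtain ⟨p, q, hq, h1, h2⟩ := hk
  obtain ⟨p', q', hq', h1', h2'⟩ := hl
  refine ⟨p * p', q * q', by simp [hq, hq'], ?_, ?_⟩
  · simp only [map_mul, ← h1, ← h1']
    ring
  · simp only [map_mul, ← h2, ← h2']
    ring

theorem HasValue.sub {x : ι → ℂ} {k l : K} {v w : ℂ} (hk : HasValue A x k v)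
    (hl : HasValue A x l w) : HasValue A x (k - l) (v - w) := by
  have := hk.add ((hasValue_aeval (A := A) x (MvPolynomial.C (-1))).mul hl)
  simpa [sub_eq_add_neg] using this

variable (hA : AlgebraicIndependent ℂ A)

include hA

theorem aeval_ne_zero {q : MvPolynomial ι ℂ} (hq : q ≠ 0) : MvPolynomial.aeval A q ≠ 0 :=
  fun h => hq (hA (h.trans (map_zero _).symm))

theorem HasValue.inv {x : ι → ℂ} {k : K} {v : ℂ} (hk : HasValue A x k v) (hv : v ≠ 0) :
    HasValue A x k⁻¹ v⁻¹ := by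
  obtain ⟨p, q, hq, h1, h2⟩ := hk
  have hp : MvPolynomial.eval x p ≠ 0 := by
    rw [← h2]
    exact mul_ne_zero hv hq
  have hp0 : MvPolynomial.aeval A p ≠ 0 := aeval_ne_zero hA fun h => hp (by rw [h, map_zero])
  have hk0 : k ≠ 0 := by
    rintro rfl
    rw [zero_mul] at h1
    exact hp0 h1.symm
  refine ⟨q, p, hp, ?_, ?_⟩
  · rw [← h1, inv_mul_cancel_left₀ hk0]
  · rw [← h2, inv_mul_cancel_left₀ hv]

/-- The principle of identity: rational functions with the same values on a nonempty open
set are equal. -/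
theorem eq_of_hasValue {k l : K} {s : MvPolynomial ι ℂ} (hs : s ≠ 0)
    (h : ∀ x, MvPolynomial.eval x s ≠ 0 → ∃ v, HasValue A x k v ∧ HasValue A x l v) : k = l := by
  have hsub : ∀ x, MvPolynomial.eval x s ≠ 0 → HasValue A x (k - l) 0 := fun x hx => by
    obtain ⟨v, h1, h2⟩ := h x hx
    simpa using h1.sub h2
  rw [← sub_eq_zero]
  obtain ⟨x₀, hx₀⟩ : ∃ x, MvPolynomial.eval x s ≠ 0 := by
    by_contra! h0
    exact hs (MvPolynomial.funext fun x => by rw [h0, map_zero])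
  obtain ⟨p, q, hq, h1, -⟩ := hsub x₀ hx₀
  have hq0 : q ≠ 0 := fun h => hq (by rw [h, map_zero])
  have hp0 : p * s = 0 := by
    refine MvPolynomial.funext fun x => ?_
    rw [map_mul, map_zero]
    by_contra hne
    obtain ⟨hpx, hsx⟩ := mul_ne_zero_iff.1 hne
    obtain ⟨p', q', hq', h1', h2'⟩ := hsub x hsx
    rw [zero_mul] at h2'
    have : p * q' = p' * q := by
      apply hA
      rw [map_mul, map_mul, ← h1, ← h1']
      ring
    have := congrArg (MvPolynomial.eval x) this
    rw [map_mul, map_mul, ← h2', zero_mul] at this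
    exact mul_ne_zero hpx hq' this
  rcases mul_eq_zero.1 hp0 with h0 | h0
  · rw [h0, map_zero] at h1
    exact (mul_eq_zero.1 h1).resolve_right (aeval_ne_zero hA hq0)
  · exact absurd h0 hs

end Values

section Families

variable {H ι K : Type*} [Group H] [AlgGroup H] [Field K] [Algebra ℂ K] (A : ι → K)

/-- `F` is a family of rational functions of the algebraically independent elements `A`, of the
form `P / D ^ k` with `P ∈ O(H)[ι]`, and `v` is the corresponding function on the set of the
points of `H × ℂ^ι` where `D` does not vanish. -/
def IsFamily (D : H → MvPolynomial ι ℂ) (F : H → K) (v : H → (ι → ℂ) → ℂ) : Prop :=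
  ∃ k : ℕ, ∃ P ∈ familyRing H ι,
    (∀ h, F h * MvPolynomial.aeval A (D h) ^ k = MvPolynomial.aeval A (P h)) ∧
    ∀ h x, MvPolynomial.eval x (D h) ≠ 0 →
      v h x * MvPolynomial.eval x (D h) ^ k = MvPolynomial.eval x (P h)

variable {A} {D : H → MvPolynomial ι ℂ}

theorem isFamily_aeval {P : H → MvPolynomial ι ℂ} (hP : P ∈ familyRing H ι) :
    IsFamily A D (fun h => MvPolynomial.aeval A (P h)) fun h x => MvPolynomial.eval x (P h) :=
  ⟨0, P, hP, by simp⟩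

theorem IsFamily.mul {F G : H → K} {v w : H → (ι → ℂ) → ℂ} (hF : IsFamily A D F v)
    (hG : IsFamily A D G w) : IsFamily A D (fun h => F h * G h) fun h x => v h x * w h x := by
  obtain ⟨k, P, hP, h1, h2⟩ := hF
  obtain ⟨l, Q, hQ, h1', h2'⟩ := hG
  refine ⟨k + l, P * Q, mul_mem hP hQ, fun h => ?_, fun h x hx => ?_⟩
  · rw [Pi.mul_apply, map_mul, ← h1, ← h1']
    ring
  · rw [Pi.mul_apply, map_mul, ← h2 h x hx, ← h2' h x hx]
    ring

theorem IsFamily.add (hD : D ∈ familyRing H ι) {F G : H → K} {v w : H → (ι → ℂ) → ℂ}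
    (hF : IsFamily A D F v) (hG : IsFamily A D G w) :
    IsFamily A D (fun h => F h + G h) fun h x => v h x + w h x := by
  obtain ⟨k, P, hP, h1, h2⟩ := hF
  obtain ⟨l, Q, hQ, h1', h2'⟩ := hG
  refine ⟨k + l, P * D ^ l + Q * D ^ k,
    add_mem (mul_mem hP (pow_mem hD l)) (mul_mem hQ (pow_mem hD k)), fun h => ?_, fun h x hx => ?_⟩
  · simp only [Pi.mul_apply, Pi.add_apply, Pi.pow_apply, map_mul, map_add, map_pow, ← h1, ← h1']
    ring
  · simp only [Pi.mul_apply, Pi.add_apply, Pi.pow_apply, map_mul, map_add, map_pow,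
      ← h2 h x hx, ← h2' h x hx]
    ring

/-- Shrinking the set where a family is considered. -/
theorem IsFamily.mono {E G : H → MvPolynomial ι ℂ} (hG : G ∈ familyRing H ι)
    (hE : ∀ h, E h = D h * G h) {F : H → K} {v : H → (ι → ℂ) → ℂ} (hF : IsFamily A D F v) :
    IsFamily A E F v := by
  obtain ⟨k, P, hP, h1, h2⟩ := hF
  refine ⟨k, P * G ^ k, mul_mem hP (pow_mem hG k), fun h => ?_, fun h x hx => ?_⟩
  · simp only [hE, Pi.mul_apply, Pi.pow_apply, map_mul, map_pow, ← h1]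
    ring
  · rw [hE, map_mul] at hx
    simp only [hE, Pi.mul_apply, Pi.pow_apply, map_mul, map_pow, ← h2 h x (left_ne_zero_of_mul hx)]
    ring

theorem IsFamily.hasValue {F : H → K} {v : H → (ι → ℂ) → ℂ} (hF : IsFamily A D F v) {h : H}
    {x : ι → ℂ} (hx : MvPolynomial.eval x (D h) ≠ 0) : HasValue A x (F h) (v h x) := by
  obtain ⟨k, P, hP, h1, h2⟩ := hF
  refine ⟨P h, D h ^ k, ?_, ?_, ?_⟩
  · rw [map_pow]
    exact pow_ne_zero k hx
  · rw [map_pow, h1]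
  · rw [map_pow, h2 h x hx]

end Families

end RatQuot

/-! ### Hilbert 90 for almost free actions -/

namespace RatQuot

/-- Hilbert 90 in geometric form. The rational functions of `A` are the function field of `ℂ^ι`, on
which `H` acts rationally, with `(h, x) ↦ y h x` on the points of the open set where `D h`
does not vanish. If the value at `(h, x)` of a regular cocycle `c` only depends on
`x` and `y h x`, then there are enough invariants for the action twisted by `c`. -/
theorem span_invariants_eq_top_of_separated {H ι K r : Type*} [Group H] [AlgGroup H] [Finite ι]
    [Field K] [Algebra ℂ K] [Fintype r] [DecidableEq r] {A : ι → K}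
    (hA : AlgebraicIndependent ℂ A) {D : H → MvPolynomial ι ℂ} (hD : D ∈ familyRing H ι)
    (hD0 : ∀ h, D h ≠ 0) (τ : H → K →ₐ[ℂ] K) (hτ1 : ∀ x, τ 1 x = x)
    (hτ : ∀ g h x, τ (g * h) x = τ h (τ g x)) (y : H → (ι → ℂ) → ι → ℂ)
    (hy : ∀ i, IsFamily A D (fun h => τ h (A i)) fun h x => y h x i)
    (c : H → Matrix r r K) (v : H → (ι → ℂ) → Matrix r r ℂ)
    (hv : ∀ i j, IsFamily A D (fun h => c h i j) fun h x => v h x i j)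
    (hsep : ∀ h h' x, MvPolynomial.eval x (D h) ≠ 0 → MvPolynomial.eval x (D h') ≠ 0 →
      y h x = y h' x → v h x = v h' x)
    (hc1 : c 1 = 1) (hc : ∀ g h, c (g * h) = c h * (c g).map (τ h)) :
    Submodule.span K {w : r → K | ∀ h, (c h).mulVec (fun i => τ h (w i)) = w} = ⊤ := by
  classical
  let jT : (H → MvPolynomial ι ℂ) →ₐ[ℂ] (H → K) :=
    AlgHom.pi fun h => (MvPolynomial.aeval A).comp (Pi.evalAlgHom ℂ _ h)
  let Dinv : H → K := fun h => (MvPolynomial.aeval A (D h))⁻¹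
  -- the regular functions on the set of the points where `D` does not vanish
  let C : Subalgebra ℂ (H → K) := (familyRing H ι).map jT ⊔ Algebra.adjoin ℂ {Dinv}
  have hjC : ∀ Q ∈ familyRing H ι, jT Q ∈ C := fun Q hQ =>
    le_sup_left (b := Algebra.adjoin ℂ {Dinv}) (Subalgebra.mem_map.2 ⟨Q, hQ, rfl⟩)
  have hDinv : Dinv ∈ C :=
    le_sup_right (a := (familyRing H ι).map jT) (Algebra.self_mem_adjoin_singleton ℂ Dinv)
  have hfg : C.FG := (familyRing_fg.map jT).sup ⟨{Dinv}, by simp⟩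
  have hft : Algebra.FiniteType ℂ C := (Subalgebra.fg_iff_finiteType _).1 hfg
  have hred : IsReduced C := isReduced_of_injective C.val Subtype.val_injective
  have hDne : ∀ h, MvPolynomial.aeval A (D h) ≠ 0 := fun h => aeval_ne_zero hA (hD0 h)
  have hmemC : ∀ {F w}, IsFamily A D F w → F ∈ C := by
    rintro F w ⟨k, P, hP, h1, -⟩
    have : F = jT P * Dinv ^ k := by
      ext h
      have e1 : jT P h = MvPolynomial.aeval A (P h) := rfl
      rw [Pi.mul_apply, Pi.pow_apply, e1, ← h1, mul_assoc, ← mul_pow,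
        mul_inv_cancel₀ (hDne h), one_pow, mul_one]
    rw [this]
    exact mul_mem (hjC P hP) (pow_mem hDinv k)
  have hpt : ∀ φ : C →ₐ[ℂ] ℂ, ∃ h x, MvPolynomial.eval x (D h) ≠ 0 ∧
      ∀ F w, IsFamily A D F w → ∀ hF : F ∈ C, φ ⟨F, hF⟩ = w h x := by
    intro φ
    obtain ⟨h, x, hx⟩ := exists_eval_familyRing (φ.comp
      ((jT.comp (familyRing H ι).val).codRestrict C fun Q => hjC Q.1 Q.2))
    have hx' : ∀ Q (hQ : Q ∈ familyRing H ι), φ ⟨jT Q, hjC Q hQ⟩ = MvPolynomial.eval x (Q h) :=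
      fun Q hQ => hx ⟨Q, hQ⟩
    have hDx : MvPolynomial.eval x (D h) ≠ 0 := by
      have h1 : (⟨jT D, hjC D hD⟩ : C) * ⟨Dinv, hDinv⟩ = 1 :=
        Subtype.ext (funext fun h => mul_inv_cancel₀ (hDne h))
      have h2 := congrArg φ h1
      rw [map_mul, hx' D hD, map_one] at h2
      exact left_ne_zero_of_mul (h2.trans_ne one_ne_zero)
    refine ⟨h, x, hDx, ?_⟩
    rintro F w ⟨k, P, hP, h1, h2⟩ hF
    have h3 : (⟨F, hF⟩ : C) * ⟨jT D, hjC D hD⟩ ^ k = ⟨jT P, hjC P hP⟩ :=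
      Subtype.ext (funext h1)
    have h4 := congrArg φ h3
    rw [map_mul, map_pow, hx' D hD, hx' P hP, ← h2 h x hDx] at h4
    exact mul_right_cancel₀ (pow_ne_zero k hDx) h4
  have hconst : ∀ i, IsFamily A D (fun _ : H => A i) fun _ x => x i := by
    intro i
    have := isFamily_aeval (A := A) (D := D) (const_mem_familyRing (H := H) (MvPolynomial.X i))
    simpa using this
  -- the graph of the action: the image of `(h, x) ↦ (x, h x)`
  let S : Set C := (Set.range fun i => ⟨_, hmemC (hconst i)⟩) ∪ Set.range fun i => ⟨_, hmemC (hy i)⟩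
  let B := Algebra.adjoin ℂ S
  obtain ⟨p, hp, hpc⟩ := exists_prime_forall_mul_mem B
  have hcij : ∀ i j, ∃ s : B, s ∉ p ∧ (s : C) * ⟨_, hmemC (hv i j)⟩ ∈ B := by
    intro i j
    refine hpc _ fun φ ψ hφψ => ?_
    obtain ⟨h, x, hx, hφ⟩ := hpt φ
    obtain ⟨h', x', hx', hψ⟩ := hpt ψ
    have e1 : x = x' := by
      ext i
      have := hφψ _ (Algebra.subset_adjoin (Or.inl ⟨i, rfl⟩))
      rwa [hφ _ _ (hconst i), hψ _ _ (hconst i)] at this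
    subst e1
    have e2 : y h x = y h' x := by
      ext i
      have := hφψ _ (Algebra.subset_adjoin (Or.inr ⟨i, rfl⟩))
      rwa [hφ _ _ (hy i), hψ _ _ (hy i)] at this
    rw [hφ _ _ (hv i j), hψ _ _ (hv i j), hsep h h' x hx hx' e2]
  choose s hsp hs using hcij
  have hB : ∀ F ∈ B, (F : H → K) ∈ orbitSpan fun h => (τ h : K →+* K) := by
    have hone : ∀ k : K, (fun _ : H => k) ∈ orbitSpan fun h => (τ h : K →+* K) := by
      intro k
      have : (fun _ : H => k) = k • orbitFun (fun h => (τ h : K →+* K)) 1 := by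
        ext h
        simp [orbitFun]
      rw [this]
      exact Submodule.smul_mem _ _ (Submodule.subset_span ⟨1, rfl⟩)
    intro F hF
    induction hF using Algebra.adjoin_induction with
    | mem F hF =>
      rcases hF with ⟨i, rfl⟩ | ⟨i, rfl⟩
      · exact hone (A i)
      · exact Submodule.subset_span ⟨A i, rfl⟩
    | algebraMap c => exact hone (algebraMap ℂ K c)
    | add F G _ _ hF hG => exact Submodule.add_mem _ hF hG
    | mul F G _ _ hF hG => exact mul_mem_orbitSpan hF hG
  let t : B := ∏ i, ∏ j, s i j
  have ht : t ∉ p := by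
    simp only [t, Ideal.IsPrime.prod_mem_iff, not_exists, not_and]
    exact fun i _ j _ => hsp i j
  have htc : ∀ i j, (t : C) * ⟨_, hmemC (hv i j)⟩ ∈ B := by
    intro i j
    have : t = (∏ i' ∈ Finset.univ.erase i, ∏ j, s i' j) *
        (∏ j' ∈ Finset.univ.erase j, s i j') * s i j := by
      rw [mul_assoc, Finset.prod_erase_mul _ _ (Finset.mem_univ j),
        Finset.prod_erase_mul _ _ (Finset.mem_univ i)]
    rw [this, MulMemClass.coe_mul, mul_assoc]
    exact mul_mem (SetLike.coe_mem _) (hs i j)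
  refine span_invariants_eq_top (τ := fun h => (τ h : K →+* K)) hτ1 hτ c hc1 hc
    ((t : C) : H → K) (hB _ t.2) (fun h0 => ht ?_) fun i j => hB _ (htc i j)
  have : t = 0 := Subtype.ext (Subtype.ext h0)
  rw [this]
  exact p.zero_mem

/-- A spanning set of `K^r` contains the columns of an invertible matrix, one of which may
be prescribed. -/
theorem exists_isUnit_det_of_span_eq_top {K r : Type*} [Field K] [Fintype r] [DecidableEq r]
    {s : Set (r → K)} (hs : Submodule.span K s = ⊤) (i₀ : r) {w : r → K} (hw : w ∈ s)
    (hw0 : w ≠ 0) : ∃ S : Matrix r r K, IsUnit S.det ∧ (∀ j, S.col j ∈ s) ∧ S.col i₀ = w := by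
  classical
  obtain ⟨b, hbs, hwb, hsb, hb⟩ := exists_linearIndepOn_id_extension (K := K)
    (s := {w}) (t := s) (LinearIndepOn.singleton hw0) (Set.singleton_subset_iff.2 hw)
  have hspan : ⊤ ≤ Submodule.span K (Set.range (Subtype.val : b → r → K)) := by
    rw [Subtype.range_coe, ← hs, Submodule.span_le]
    exact hsb
  let B := Basis.mk hb hspan
  have : Finite b := Module.Finite.finite_basis B
  have : Fintype b := Fintype.ofFinite b
  have hcard : Fintype.card r = Fintype.card b := by
    rw [← Module.finrank_eq_card_basis B, Module.finrank_fintype_fun_eq_card]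
  let e₀ : r ≃ b := Fintype.equivOfCardEq hcard
  let e : r ≃ b := e₀.trans (Equiv.swap (e₀ i₀) ⟨w, hwb rfl⟩)
  have he : e i₀ = ⟨w, hwb rfl⟩ := by simp [e]
  refine ⟨Matrix.of fun i j => (e j : r → K) i, ?_, fun j => hbs (e j).2, ?_⟩
  · rw [← Matrix.isUnit_iff_isUnit_det, ← Matrix.linearIndependent_cols_iff_isUnit]
    exact hb.linearIndependent.comp e e.injective
  · change (e i₀ : r → K) = w
    rw [he]

end RatQuot

/-! ### An affine chart of the Grassmannian -/

namespace RatQuot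

/-- The matrix of `σ h` with respect to a basis, acting on row vectors from the right. -/
noncomputable def repMatrix {H W κ : Type*} [Group H] [AddCommGroup W] [Module ℂ W]
    (b : Basis κ ℂ W) (σ : Representation ℂ H W) (h : H) : Matrix κ κ ℂ :=
  Matrix.of fun k l => b.repr (σ h (b k)) l

section RepMatrix

variable {H W κ : Type*} [Group H] [AddCommGroup W] [Module ℂ W] [Fintype κ]
  (b : Basis κ ℂ W) (σ : Representation ℂ H W)

theorem sum_repMatrix_smul (h : H) (k : κ) : ∑ l, repMatrix b σ h k l • b l = σ h (b k) :=
  b.sum_repr (σ h (b k))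

theorem apply_sum_smul (h : H) (r : κ → ℂ) :
    σ h (∑ k, r k • b k) = ∑ l, (Matrix.vecMul r (repMatrix b σ h)) l • b l := by
  simp only [map_sum, map_smul, ← sum_repMatrix_smul b σ h, Finset.smul_sum, Matrix.vecMul,
    dotProduct, Finset.sum_smul, smul_smul]
  exact Finset.sum_comm

theorem repMatrix_mul (g h : H) : repMatrix b σ (g * h) = repMatrix b σ h * repMatrix b σ g := by
  ext k l
  have h1 : σ (g * h) (b k) = σ g (σ h (b k)) := by rw [map_mul]; rfl
  have h2 : b.repr (σ g (σ h (b k))) l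
      = Matrix.vecMul (repMatrix b σ h k) (repMatrix b σ g) l := by
    rw [← sum_repMatrix_smul b σ h, apply_sum_smul, b.repr_sum_self]
  rw [repMatrix, Matrix.of_apply, h1, h2]
  rfl

omit [Fintype κ] in
theorem repMatrix_one [DecidableEq κ] : repMatrix b σ 1 = 1 := by
  ext k l
  rw [repMatrix, Matrix.of_apply, map_one, Module.End.one_apply, b.repr_self,
    Finsupp.single_apply, Matrix.one_apply]

end RepMatrix

section ChartMatrix

variable {I J : Type*} [DecidableEq I]

/-- The matrix `[1 | a]`, whose rows span the point with coordinates `a` in the standard chart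
of the Grassmannian. -/
def chartMat {B : Type*} [CommRing B] (a : I × J → B) : Matrix I (I ⊕ J) B :=
  Matrix.fromCols 1 (Matrix.of fun i j => a (i, j))

theorem map_chartMat {B B' : Type*} [CommRing B] [CommRing B'] (f : B →+* B') (a : I × J → B) :
    (chartMat a).map f = chartMat fun p => f (a p) := by
  ext i (j | j)
  · simp [chartMat, Matrix.one_apply, apply_ite f]
  · simp [chartMat]

variable [Fintype I]

theorem mul_chartMat {B : Type*} [CommRing B] (C : Matrix I I B) (a : I × J → B) :
    C * chartMat a = Matrix.fromCols C (C * Matrix.of fun i j => a (i, j)) := by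
  rw [chartMat, Matrix.mul_fromCols, mul_one]

/-- The coordinates of the span of the rows of `x` in the standard chart of the Grassmannian. -/
noncomputable def chartCoord {F : Type*} [Field F] (x : Matrix I (I ⊕ J) F) : I × J → F :=
  fun p => (x.toCols₁⁻¹ * x.toCols₂) p.1 p.2

theorem toCols₁_mul_chartCoord {F : Type*} [Field F] {x : Matrix I (I ⊕ J) F}
    (hx : x.toCols₁.det ≠ 0) : x.toCols₁ * chartMat (chartCoord x) = x := by
  have h1 : (Matrix.of fun i j => chartCoord x (i, j)) = x.toCols₁⁻¹ * x.toCols₂ := rfl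
  rw [mul_chartMat, h1, Matrix.mul_nonsing_inv_cancel_left _ _ (Ne.isUnit hx),
    Matrix.fromCols_toCols]

variable [Fintype J]

/-- The matrix `[1 | a] M`. -/
def moved {B : Type*} [CommRing B] [Algebra ℂ B] (M : Matrix (I ⊕ J) (I ⊕ J) ℂ) (a : I × J → B) :
    Matrix I (I ⊕ J) B :=
  chartMat a * M.map (algebraMap ℂ B)

theorem map_moved {B B' : Type*} [CommRing B] [Algebra ℂ B] [CommRing B'] [Algebra ℂ B']
    (f : B →ₐ[ℂ] B') (M : Matrix (I ⊕ J) (I ⊕ J) ℂ) (a : I × J → B) :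
    (moved M a).map f = moved M fun p => f (a p) := by
  have h1 : (M.map (algebraMap ℂ B)).map f = M.map (algebraMap ℂ B') := by
    ext i j
    simp
  have h2 := map_chartMat (f : B →+* B') a
  have h3 := Matrix.map_mul (L := chartMat a) (M := M.map (algebraMap ℂ B)) (f := (f : B →+* B'))
  exact h3.trans (congrArg₂ (· * ·) h2 h1)

/-- The action of a matrix on the standard chart: `[1 | a] M = C [1 | a']` for an invertible
matrix `C`, the left block of `[1 | a] M`. -/
noncomputable def chartMove (M : Matrix (I ⊕ J) (I ⊕ J) ℂ) (a : I × J → ℂ) : I × J → ℂ :=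
  chartCoord (moved M a)

theorem toCols₁_mul_chartMat_chartMove {M : Matrix (I ⊕ J) (I ⊕ J) ℂ} {a : I × J → ℂ}
    (h : (moved M a).toCols₁.det ≠ 0) :
    (moved M a).toCols₁ * chartMat (chartMove M a) = moved M a :=
  toCols₁_mul_chartCoord h

/-- The determinant of the left block of `[1 | X] M`, a polynomial on the chart. -/
noncomputable def chartDet (M : Matrix (I ⊕ J) (I ⊕ J) ℂ) : MvPolynomial (I × J) ℂ :=
  (moved M fun p => (MvPolynomial.X p : MvPolynomial (I × J) ℂ)).toCols₁.det

theorem aeval_chartDet {B : Type*} [CommRing B] [Algebra ℂ B] (M : Matrix (I ⊕ J) (I ⊕ J) ℂ)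
    (a : I × J → B) : MvPolynomial.aeval a (chartDet M) = (moved M a).toCols₁.det := by
  have h1 := map_moved (MvPolynomial.aeval a) M
    fun p => (MvPolynomial.X p : MvPolynomial (I × J) ℂ)
  simp only [MvPolynomial.aeval_X] at h1
  rw [chartDet, AlgHom.map_det, ← h1]
  rfl

theorem eval_chartDet (M : Matrix (I ⊕ J) (I ⊕ J) ℂ) (x : I × J → ℂ) :
    MvPolynomial.eval x (chartDet M) = (moved M x).toCols₁.det := aeval_chartDet M x

end ChartMatrix

section MatrixFamilies

variable {H ι m : Type*} [Group H] [AlgGroup H] [Fintype m] [DecidableEq m]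

theorem det_mem_familyRing {N : H → Matrix m m (MvPolynomial ι ℂ)}
    (hN : ∀ i j, (fun h => N h i j) ∈ familyRing H ι) :
    (fun h => (N h).det) ∈ familyRing H ι := by
  have : (fun h => (N h).det)
      = ∑ s : Equiv.Perm m, Equiv.Perm.sign s • ∏ i, fun h => N h (s i) i := by
    ext1 h
    rw [Matrix.det_apply, Finset.sum_apply]
    refine Finset.sum_congr rfl fun s _ => ?_
    rw [Pi.smul_apply, Finset.prod_apply]
  rw [this]
  refine sum_mem fun s _ => ?_
  rw [Units.smul_def]
  exact zsmul_mem (prod_mem fun i _ => hN _ _) _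

theorem adjugate_mem_familyRing {N : H → Matrix m m (MvPolynomial ι ℂ)}
    (hN : ∀ i j, (fun h => N h i j) ∈ familyRing H ι) (i j : m) :
    (fun h => (N h).adjugate i j) ∈ familyRing H ι := by
  simp only [Matrix.adjugate_apply]
  refine det_mem_familyRing fun k l => ?_
  by_cases hk : k = j
  · subst hk
    simp only [Matrix.updateRow_self]
    exact const_mem_familyRing _
  · simp only [Matrix.updateRow_ne hk]
    exact hN k l

end MatrixFamilies

section ChartAction

variable {H W I J : Type*} [Group H] [AlgGroup H] [AddCommGroup W] [Module ℂ W]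
  [Fintype I] [DecidableEq I] [Fintype J]
  {b : Basis (I ⊕ J) ℂ W} {σ : Representation ℂ H W} (hσ : IsAlgebraicRep σ)

omit [Fintype I] [DecidableEq I] [Fintype J] in
include hσ in
theorem repMatrix_regular (k l : I ⊕ J) :
    (fun h => repMatrix b σ h k l) ∈ AlgGroup.regular (G := H) :=
  hσ (b k) (b.coord l)

include hσ in
theorem moved_mem_familyRing (i : I) (l : I ⊕ J) :
    (fun h => moved (repMatrix b σ h)
      (fun p => (MvPolynomial.X p : MvPolynomial (I × J) ℂ)) i l) ∈ familyRing H (I × J) := by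
  have : (fun h => moved (repMatrix b σ h)
      (fun p => (MvPolynomial.X p : MvPolynomial (I × J) ℂ)) i l)
      = ∑ k, (fun _ => chartMat (fun p => (MvPolynomial.X p : MvPolynomial (I × J) ℂ)) i k) *
        fun h => MvPolynomial.C (repMatrix b σ h k l) := by
    ext1 h
    rw [Finset.sum_apply, moved, Matrix.mul_apply]
    rfl
  rw [this]
  exact sum_mem fun k _ => mul_mem (const_mem_familyRing _)
    (C_mem_familyRing (repMatrix_regular hσ k l))

include hσ in
theorem chartDet_mem_familyRing :
    (fun h => chartDet (repMatrix b σ h)) ∈ familyRing H (I × J) :=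
  det_mem_familyRing fun i j => moved_mem_familyRing hσ i (Sum.inl j)

variable {K : Type*} [Field K] [Algebra ℂ K] {A : I × J → K}

include hσ in
theorem isFamily_moved {D : H → MvPolynomial (I × J) ℂ} (i : I) (l : I ⊕ J) :
    IsFamily A D (fun h => moved (repMatrix b σ h) A i l)
      fun h x => moved (repMatrix b σ h) x i l := by
  have h1 := isFamily_aeval (A := A) (D := D) (moved_mem_familyRing (b := b) hσ i l)
  have h2 : ∀ h : H, MvPolynomial.aeval A (moved (repMatrix b σ h)
      (fun p => (MvPolynomial.X p : MvPolynomial (I × J) ℂ)) i l)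
      = moved (repMatrix b σ h) A i l := fun h => by
    have := map_moved (MvPolynomial.aeval A) (repMatrix b σ h)
      fun p => (MvPolynomial.X p : MvPolynomial (I × J) ℂ)
    simp only [MvPolynomial.aeval_X] at this
    rw [← this]
    rfl
  have h3 : ∀ (h : H) (x : I × J → ℂ), MvPolynomial.eval x (moved (repMatrix b σ h)
      (fun p => (MvPolynomial.X p : MvPolynomial (I × J) ℂ)) i l)
      = moved (repMatrix b σ h) x i l := fun h x => by
    have := map_moved (MvPolynomial.aeval x) (repMatrix b σ h)
      fun p => (MvPolynomial.X p : MvPolynomial (I × J) ℂ)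
    simp only [MvPolynomial.aeval_X] at this
    rw [← this]
    rfl
  simpa only [h2, h3] using h1

/-- The hypotheses describing the action of `H` on the function field `K` of (the chart of) the
Grassmannian, in terms of the coordinates `A` of the chart. The action is from the right:
`τ h f` is the function `x ↦ f (h x)`. -/
structure ChartAction (b : Basis (I ⊕ J) ℂ W) (σ : Representation ℂ H W) (A : I × J → K)
    (τ : H → K →ₐ[ℂ] K) : Prop where
  indep : AlgebraicIndependent ℂ A
  one : ∀ x, τ 1 x = x
  mul : ∀ g h x, τ (g * h) x = τ h (τ g x)
  det_ne_zero : ∀ h, (moved (repMatrix b σ h) A).toCols₁.det ≠ 0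
  apply_coord : ∀ h, (moved (repMatrix b σ h) A).toCols₁ * chartMat (fun p => τ h (A p))
    = moved (repMatrix b σ h) A

variable {τ : H → K →ₐ[ℂ] K} (hK : ChartAction b σ A τ)

/-- Cramer's rule for the coordinates of a transformed point. -/
theorem mul_det_toCols₁ {B : Type*} [CommRing B] [Algebra ℂ B] {M : Matrix (I ⊕ J) (I ⊕ J) ℂ}
    {a a' : I × J → B} (h : (moved M a).toCols₁ * chartMat a' = moved M a) (p : I × J) :
    a' p * (moved M a).toCols₁.det
      = ((moved M a).toCols₁.adjugate * (moved M a).toCols₂) p.1 p.2 := by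
  have h1 := congrArg Matrix.toCols₂ h
  rw [mul_chartMat, Matrix.toCols₂_fromCols] at h1
  rw [← h1, ← Matrix.mul_assoc, Matrix.adjugate_mul, Matrix.smul_mul, Matrix.one_mul,
    Matrix.smul_apply, smul_eq_mul, mul_comm]
  rfl

include hK hσ

theorem ChartAction.isFamily_coord (p : I × J) :
    IsFamily A (fun h => chartDet (repMatrix b σ h)) (fun h => τ h (A p))
      fun h x => chartMove (repMatrix b σ h) x p := by
  let X : I × J → MvPolynomial (I × J) ℂ := MvPolynomial.X
  let P : H → MvPolynomial (I × J) ℂ := fun h =>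
    ((moved (repMatrix b σ h) X).toCols₁.adjugate * (moved (repMatrix b σ h) X).toCols₂) p.1 p.2
  have hP : P ∈ familyRing H (I × J) := by
    have : P = ∑ k, (fun h => (moved (repMatrix b σ h) X).toCols₁.adjugate p.1 k) *
        fun h => moved (repMatrix b σ h) X k (Sum.inr p.2) := by
      ext1 h
      rw [Finset.sum_apply]
      rfl
    rw [this]
    exact sum_mem fun k _ => mul_mem
      (adjugate_mem_familyRing (fun i j => moved_mem_familyRing hσ i (Sum.inl j)) _ _)
      (moved_mem_familyRing hσ _ _)
  have hPa : ∀ {B : Type _} [CommRing B] [Algebra ℂ B] (a : I × J → B) (h : H),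
      MvPolynomial.aeval a (P h) = ((moved (repMatrix b σ h) a).toCols₁.adjugate *
        (moved (repMatrix b σ h) a).toCols₂) p.1 p.2 := by
    intro B _ _ a h
    have h1 := map_moved (MvPolynomial.aeval a) (repMatrix b σ h) X
    simp only [X, MvPolynomial.aeval_X] at h1
    have h2 : (moved (repMatrix b σ h) a).toCols₁
        = (MvPolynomial.aeval a).mapMatrix (moved (repMatrix b σ h) X).toCols₁ := by
      rw [← h1]; rfl
    rw [h2, ← AlgHom.map_adjugate, ← h1]
    simp only [P, Matrix.mul_apply, map_sum, map_mul]
    rfl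
  have hPe : ∀ (x : I × J → ℂ) (h : H),
      MvPolynomial.eval x (P h) = ((moved (repMatrix b σ h) x).toCols₁.adjugate *
        (moved (repMatrix b σ h) x).toCols₂) p.1 p.2 := by
    intro a h
    have h1 := map_moved (MvPolynomial.aeval a) (repMatrix b σ h) X
    simp only [X, MvPolynomial.aeval_X] at h1
    have h2 : (moved (repMatrix b σ h) a).toCols₁
        = (MvPolynomial.aeval a).mapMatrix (moved (repMatrix b σ h) X).toCols₁ := by
      rw [← h1]; rfl
    rw [h2, ← AlgHom.map_adjugate, ← h1, ← MvPolynomial.coe_aeval_eq_eval]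
    simp only [P, Matrix.mul_apply, map_sum, map_mul]
    rfl
  refine ⟨1, P, hP, fun h => ?_, fun h x hx => ?_⟩
  · rw [pow_one, aeval_chartDet, hPa]
    exact mul_det_toCols₁ (hK.apply_coord h) p
  · rw [pow_one, eval_chartDet, hPe]
    rw [eval_chartDet] at hx
    exact mul_det_toCols₁ (toCols₁_mul_chartMat_chartMove hx) p

theorem ChartAction.isFamily_apply_aeval (u : MvPolynomial (I × J) ℂ) :
    IsFamily A (fun h => chartDet (repMatrix b σ h)) (fun h => τ h (MvPolynomial.aeval A u))
      fun h x => MvPolynomial.eval (chartMove (repMatrix b σ h) x) u := by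
  induction u using MvPolynomial.induction_on with
  | C c =>
    have := isFamily_aeval (A := A) (D := fun h => chartDet (repMatrix b σ h))
      (const_mem_familyRing (H := H) (MvPolynomial.C c : MvPolynomial (I × J) ℂ))
    simpa using this
  | add p q hp hq =>
    simp only [map_add]
    exact hp.add (chartDet_mem_familyRing hσ) hq
  | mul_X p i hp =>
    simp only [map_mul, MvPolynomial.aeval_X, MvPolynomial.eval_X]
    exact hp.mul (hK.isFamily_coord hσ i)

/-- The value of `τ h k` at `x` is the value of `k` at the point `h x`. -/
theorem ChartAction.hasValue_apply {h : H} {x : I × J → ℂ}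
    (hx : MvPolynomial.eval x (chartDet (repMatrix b σ h)) ≠ 0) {k : K} {v : ℂ}
    (hk : HasValue A (chartMove (repMatrix b σ h) x) k v) : HasValue A x (τ h k) v := by
  obtain ⟨p, q, hq, h1, h2⟩ := hk
  have hp' := (hK.isFamily_apply_aeval hσ p).hasValue hx
  have hq' := ((hK.isFamily_apply_aeval hσ q).hasValue hx).inv hK.indep hq
  have hq0 : MvPolynomial.aeval A q ≠ 0 :=
    aeval_ne_zero hK.indep fun h => hq (by rw [h, map_zero])
  have hq0' : τ h (MvPolynomial.aeval A q) ≠ 0 := by simpa using hq0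
  have := hp'.mul hq'
  have e1 : k = MvPolynomial.aeval A p * (MvPolynomial.aeval A q)⁻¹ := by
    rw [← h1]; field_simp
  have e2 : v = MvPolynomial.eval (chartMove (repMatrix b σ h) x) p *
      (MvPolynomial.eval (chartMove (repMatrix b σ h) x) q)⁻¹ := by
    rw [← h2]; field_simp
  rw [e1, e2, map_mul, map_inv₀]
  exact this

/-- The open set of the `(h, x)` for which `x` and `h x` are defined and belong to
a given principal open set. -/
theorem ChartAction.exists_domain {u : MvPolynomial (I × J) ℂ} (hu : u ≠ 0) :
    ∃ D ∈ familyRing H (I × J), (∀ h, D h ≠ 0) ∧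
      (∃ G ∈ familyRing H (I × J), ∀ h, D h = chartDet (repMatrix b σ h) * G h) ∧
      ∀ h x, MvPolynomial.eval x (D h) ≠ 0 → MvPolynomial.eval x u ≠ 0 ∧
        MvPolynomial.eval x (chartDet (repMatrix b σ h)) ≠ 0 ∧
        MvPolynomial.eval (chartMove (repMatrix b σ h) x) u ≠ 0 := by
  obtain ⟨k, P, hP, h1, h2⟩ := hK.isFamily_apply_aeval hσ u
  have hdet : ∀ h, MvPolynomial.aeval A (chartDet (repMatrix b σ h)) ≠ 0 := fun h => by
    rw [aeval_chartDet]
    exact hK.det_ne_zero h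
  have hG : (fun _ => u) * P ∈ familyRing H (I × J) := mul_mem (const_mem_familyRing u) hP
  refine ⟨_, mul_mem (chartDet_mem_familyRing (b := b) hσ) hG, fun h => ?_, ⟨_, hG, fun _ => rfl⟩,
    fun h x hx => ?_⟩
  · refine mul_ne_zero (fun h0 => hdet h ((congrArg _ h0).trans (map_zero _)))
      (mul_ne_zero hu fun h0 => ?_)
    have := h1 h
    rw [h0, map_zero] at this
    refine mul_ne_zero ?_ (pow_ne_zero k (hdet h)) this
    simpa using aeval_ne_zero hK.indep hu
  · simp only [Pi.mul_apply, map_mul] at hx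
    have hd := left_ne_zero_of_mul hx
    have hr := right_ne_zero_of_mul hx
    refine ⟨left_ne_zero_of_mul hr, hd, ?_⟩
    have := right_ne_zero_of_mul hr
    rw [← h2 h x hd] at this
    exact left_ne_zero_of_mul this

omit [AlgGroup H] hσ in
/-- The left block of `[1 | A] M(h)` is a cocycle. -/
theorem ChartAction.toCols₁_mul (g h : H) :
    (moved (repMatrix b σ (g * h)) A).toCols₁ = (moved (repMatrix b σ h) A).toCols₁ *
      ((moved (repMatrix b σ g) A).toCols₁).map (τ h) := by
  have h1 : moved (repMatrix b σ (g * h)) A = (moved (repMatrix b σ h) A).toCols₁ *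
      (moved (repMatrix b σ g) A).map (τ h) := by
    have h2 : moved (repMatrix b σ g) (fun p => τ h (A p))
        = chartMat (fun p => τ h (A p)) * (repMatrix b σ g).map (algebraMap ℂ K) := rfl
    rw [map_moved, h2, ← Matrix.mul_assoc, hK.apply_coord, moved, moved, Matrix.mul_assoc,
      repMatrix_mul]
    exact congrArg _ Matrix.map_mul
  rw [h1]
  rfl

end ChartAction

end RatQuot

/-! ### The points of the chart -/

namespace RatQuot

theorem span_range_sum_smul {I W : Type*} [Fintype I] [DecidableEq I] [AddCommGroup W] [Module ℂ W]
    {C : Matrix I I ℂ} (hC : C.det ≠ 0) (f : I → W) :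
    Submodule.span ℂ (Set.range fun i => ∑ j, C i j • f j) = Submodule.span ℂ (Set.range f) := by
  have key : ∀ (C : Matrix I I ℂ) (f : I → W),
      Submodule.span ℂ (Set.range fun i => ∑ j, C i j • f j) ≤ Submodule.span ℂ (Set.range f) := by
    intro C f
    rw [Submodule.span_le]
    rintro _ ⟨i, rfl⟩
    exact Submodule.sum_mem _ fun j _ =>
      Submodule.smul_mem _ _ (Submodule.subset_span (Set.mem_range_self j))
  refine le_antisymm (key C f) ?_
  have h1 : (fun i => ∑ j, C⁻¹ i j • ∑ l, C j l • f l) = f := by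
    ext1 i
    have : ∀ l, ∑ j, C⁻¹ i j * C j l = (1 : Matrix I I ℂ) i l := fun l => by
      rw [← Matrix.mul_apply, Matrix.nonsing_inv_mul _ (Ne.isUnit hC)]
    simp only [Finset.smul_sum, smul_smul]
    rw [Finset.sum_comm]
    simp only [← Finset.sum_smul, this, Matrix.one_apply, ite_smul, one_smul, zero_smul]
    simp
  have := key C⁻¹ fun i => ∑ j, C i j • f j
  rwa [h1] at this

section ChartPoint

variable {H W I J : Type*} [Group H] [AddCommGroup W] [Module ℂ W]
  [Fintype I] [DecidableEq I] [Fintype J] (b : Basis (I ⊕ J) ℂ W)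

/-- The vectors of the basis which the rows of `[1 | x]` describe. -/
noncomputable def chartVec (x : I × J → ℂ) (i : I) : W := ∑ l, chartMat x i l • b l

theorem repr_chartVec (x : I × J → ℂ) (i : I) (l : I ⊕ J) :
    b.repr (chartVec b x i) l = chartMat x i l := by
  rw [chartVec, b.repr_sum_self]

theorem linearIndependent_chartVec (x : I × J → ℂ) : LinearIndependent ℂ (chartVec b x) := by
  let f : W →ₗ[ℂ] (I → ℂ) := LinearMap.pi fun i => b.coord (Sum.inl i)
  refine LinearIndependent.of_comp f ?_
  have : f ∘ chartVec b x = Pi.basisFun ℂ I := by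
    ext i j
    simp only [f, Function.comp_apply, LinearMap.pi_apply, Basis.coord_apply, repr_chartVec,
      Pi.basisFun_apply]
    simp [chartMat, Matrix.one_apply, Pi.single_apply, eq_comm]
  rw [this]
  exact (Pi.basisFun ℂ I).linearIndependent

theorem sum_mul_chartMat_smul (C : Matrix I I ℂ) (x : I × J → ℂ) (i : I) :
    ∑ l, (C * chartMat x) i l • b l = ∑ j, C i j • chartVec b x j := by
  simp only [chartVec, Matrix.mul_apply, Finset.sum_smul, Finset.smul_sum, smul_smul]
  exact Finset.sum_comm

theorem apply_chartVec (σ : Representation ℂ H W) (h : H) (x : I × J → ℂ) (i : I) :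
    σ h (chartVec b x i) = ∑ l, moved (repMatrix b σ h) x i l • b l := by
  rw [chartVec, apply_sum_smul]
  rfl

theorem apply_chartVec_eq (σ : Representation ℂ H W) {h : H} {x : I × J → ℂ}
    (hx : MvPolynomial.eval x (chartDet (repMatrix b σ h)) ≠ 0) (i : I) :
    σ h (chartVec b x i) = ∑ j, (moved (repMatrix b σ h) x).toCols₁ i j •
      chartVec b (chartMove (repMatrix b σ h) x) j := by
  rw [eval_chartDet] at hx
  rw [apply_chartVec, ← sum_mul_chartMat_smul, toCols₁_mul_chartMat_chartMove hx]

variable {k : ℕ} (e : Fin k ≃ I)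

/-- The rows of `[1 | x]`, as a frame. -/
noncomputable def chartFrame (x : I × J → ℂ) : Frame W k :=
  ⟨fun n => chartVec b x (e n), (linearIndependent_chartVec b x).comp e e.injective⟩

/-- The point with coordinates `x` of the Grassmannian: the span of the rows of `[1 | x]`. -/
noncomputable def chartPt (x : I × J → ℂ) : Grass W k := (chartFrame b e x).span

theorem coe_chartPt (x : I × J → ℂ) :
    (chartPt b e x).1 = Submodule.span ℂ (Set.range (chartVec b x)) := by
  have : Set.range (chartFrame b e x).1 = Set.range (chartVec b x) :=
    e.surjective.range_comp (chartVec b x)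
  rw [← this]
  rfl

theorem chartVec_mem (x : I × J → ℂ) (i : I) : chartVec b x i ∈ (chartPt b e x).1 := by
  rw [coe_chartPt]
  exact Submodule.subset_span (Set.mem_range_self i)

/-- On its domain of definition, `chartMove` is the action of `H` in coordinates. -/
theorem chartPt_act (σ : Representation ℂ H W) {h : H} {x : I × J → ℂ}
    (hx : MvPolynomial.eval x (chartDet (repMatrix b σ h)) ≠ 0) :
    (chartPt b e x).act σ h = chartPt b e (chartMove (repMatrix b σ h) x) := by
  refine Subtype.ext ?_
  change Submodule.map (repEquiv σ h).toLinearMap (chartPt b e x).1 = _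
  rw [coe_chartPt, coe_chartPt, Submodule.map_span, ← Set.range_comp]
  have : ((repEquiv σ h).toLinearMap ∘ chartVec b x) = fun i =>
      ∑ j, (moved (repMatrix b σ h) x).toCols₁ i j •
        chartVec b (chartMove (repMatrix b σ h) x) j :=
    funext fun i => apply_chartVec_eq b σ hx i
  rw [this, span_range_sum_smul]
  rwa [eval_chartDet] at hx

/-- The polynomial functions on frames are polynomials in the coordinates of the chart. -/
theorem exists_eval_chartFrame {p : (Fin k → W) → ℂ} (hp : p ∈ polyFun (Fin k → W)) :
    ∃ q : MvPolynomial (I × J) ℂ, ∀ x, p (chartFrame b e x).1 = MvPolynomial.eval x q := by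
  induction hp using Algebra.adjoin_induction with
  | mem p hp =>
    obtain ⟨l, rfl⟩ := hp
    refine ⟨∑ n, ∑ m, chartMat (fun p => (MvPolynomial.X p : MvPolynomial (I × J) ℂ)) (e n) m *
      MvPolynomial.C (l (Pi.single n (b m))), fun x => ?_⟩
    have h1 : ∀ n m, MvPolynomial.eval x
        (chartMat (fun p => (MvPolynomial.X p : MvPolynomial (I × J) ℂ)) (e n) m)
        = chartMat x (e n) m := fun n m => by
      have := congrFun (congrFun (map_chartMat (MvPolynomial.eval x)
        fun p => (MvPolynomial.X p : MvPolynomial (I × J) ℂ)) (e n)) m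
      simpa using this
    simp only [map_sum, map_mul, h1, MvPolynomial.eval_C]
    have h2 := Finset.univ_sum_single (chartFrame b e x).1
    conv_lhs => rw [← h2]
    rw [map_sum]
    refine Finset.sum_congr rfl fun n _ => ?_
    change l (LinearMap.single ℂ (fun _ => W) n (∑ m, chartMat x (e n) m • b m)) = _
    simp only [map_sum, map_smul, smul_eq_mul]
    rfl
  | algebraMap c => exact ⟨.C c, fun x => by simp⟩
  | add p q _ _ hp hq =>
    obtain ⟨p', hp⟩ := hp
    obtain ⟨q', hq⟩ := hq
    exact ⟨p' + q', fun x => by simp [hp, hq]⟩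
  | mul p q _ _ hp hq =>
    obtain ⟨p', hp⟩ := hp
    obtain ⟨q', hq⟩ := hq
    exact ⟨p' * q', fun x => by simp [hp, hq]⟩

/-- The regular functions on the product of `H` and the space of frames become elements
of `O(H)[X]` on the chart. -/
theorem exists_eval_prodFun [AlgGroup H] {p : H × Frame W k → ℂ}
    (hp : p ∈ prodFun (AlgGroup.regular (G := H)) (frameFun W k)) :
    ∃ Q ∈ familyRing H (I × J), ∀ h x,
      p (h, chartFrame b e x) = MvPolynomial.eval x (Q h) := by
  rw [prodFun, Algebra.sup_def] at hp
  induction hp using Algebra.adjoin_induction with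
  | mem p hp =>
    rcases hp with ⟨f, hf, rfl⟩ | ⟨f, ⟨g, hg, rfl⟩, rfl⟩
    · exact ⟨_, C_mem_familyRing hf, fun h x => (MvPolynomial.eval_C _).symm⟩
    · obtain ⟨q, hq⟩ := exists_eval_chartFrame b e hg
      exact ⟨_, const_mem_familyRing q, fun h x => hq x⟩
  | algebraMap c => exact ⟨_, const_mem_familyRing (.C c), fun h x => by simp⟩
  | add p q _ _ hp hq =>
    obtain ⟨p', hp', hp⟩ := hp
    obtain ⟨q', hq', hq⟩ := hq
    exact ⟨p' + q', add_mem hp' hq', fun h x => by simp [hp, hq]⟩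
  | mul p q _ _ hp hq =>
    obtain ⟨p', hp', hp⟩ := hp
    obtain ⟨q', hq', hq⟩ := hq
    exact ⟨p' * q', mul_mem hp' hq', fun h x => by simp [hp, hq]⟩

theorem comp_sum_smul_mem_polyFun (C : Matrix (Fin k) (Fin k) ℂ) {p : (Fin k → W) → ℂ}
    (hp : p ∈ polyFun (Fin k → W)) :
    (fun f : Fin k → W => p fun n => ∑ m, C n m • f m) ∈ polyFun (Fin k → W) := by
  have := comp_mem_polyFun (LinearMap.pi fun n => ∑ m, C n m • LinearMap.proj (R := ℂ)
    (φ := fun _ : Fin k => W) m) hp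
  convert this using 3 with f
  ext n
  simp

/-- The chart meets every nonempty open subset of the Grassmannian. -/
theorem exists_chartPt_mem {U : Set (Grass W k)} (hU : Grass.IsOpen U) (hne : U.Nonempty) :
    ∃ u : MvPolynomial (I × J) ℂ, u ≠ 0 ∧ ∀ x, MvPolynomial.eval x u ≠ 0 → chartPt b e x ∈ U := by
  obtain ⟨P, hP⟩ := hne
  have : FiniteDimensional ℂ W := b.finiteDimensional_of_finite
  let B := finBasisOfFinrankEq ℂ P.1 P.2
  let f₀ : Frame W k := ⟨fun n => B n, B.linearIndependent.map' P.1.subtype P.1.ker_subtype⟩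
  have hf₀ : f₀.span = P := by
    refine Subtype.ext ?_
    have h1 := congrArg (Submodule.map P.1.subtype) B.span_eq
    rw [Submodule.map_span, ← Set.range_comp, Submodule.map_top, Submodule.range_subtype] at h1
    exact h1
  obtain ⟨_, ⟨p, hp, rfl⟩, hp0, hpU⟩ := hU f₀ (by rw [Set.mem_preimage, hf₀]; exact hP)
  -- the frames in the domain of the chart are those for which `N` is invertible
  let N : (Fin k → W) → Matrix (Fin k) (Fin k) ℂ := fun f =>
    Matrix.of fun n m => b.repr (f n) (Sum.inl (e m))
  have hδ : (fun f => (N f).det) ∈ polyFun (Fin k → W) := by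
    have : (fun f => (N f).det)
        = ∑ s : Equiv.Perm (Fin k), Equiv.Perm.sign s • ∏ i, fun f => N f (s i) i := by
      ext1 h
      rw [Matrix.det_apply, Finset.sum_apply]
      refine Finset.sum_congr rfl fun s _ => ?_
      rw [Pi.smul_apply, Finset.prod_apply]
    rw [this]
    refine sum_mem fun s _ => ?_
    rw [Units.smul_def]
    refine zsmul_mem (prod_mem fun i _ => ?_) _
    exact Algebra.subset_adjoin
      ⟨b.coord (Sum.inl (e i)) ∘ₗ LinearMap.proj (R := ℂ) (φ := fun _ : Fin k => W) (s i), rfl⟩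
  let p' : PolyRing (Fin k → W) := ⟨p, hp⟩
  let δ : PolyRing (Fin k → W) := ⟨_, hδ⟩
  have hp' : p' ≠ 0 := fun h => hp0 (congrFun (congrArg Subtype.val h) f₀.1)
  have hδ0 : δ ≠ 0 := fun h => by
    have h1 := congrFun (congrArg Subtype.val h) (chartFrame b e (0 : I × J → ℂ)).1
    have h2 : N (chartFrame b e (0 : I × J → ℂ)).1 = 1 := by
      ext n m
      change b.repr (chartVec b 0 (e n)) (Sum.inl (e m)) = _
      rw [repr_chartVec]
      simp [chartMat, Matrix.one_apply]
    have h3 : (N (chartFrame b e (0 : I × J → ℂ)).1).det = 0 := h1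
    rw [h2, Matrix.det_one] at h3
    exact one_ne_zero h3
  obtain ⟨f₁, hf₁⟩ : ∃ f, p f * (N f).det ≠ 0 := by
    by_contra! h0
    exact mul_ne_zero hp' hδ0 (Subtype.ext (funext h0))
  obtain ⟨hpf, hNf⟩ := mul_ne_zero_iff.1 hf₁
  -- `f₁` is a frame of a point of the chart, transformed by the matrix `N f₁`
  obtain ⟨u, hu⟩ := exists_eval_chartFrame b e (comp_sum_smul_mem_polyFun (N f₁) hp)
  refine ⟨u, ?_, fun x hx => ?_⟩
  · let x₁ : I × J → ℂ := fun q => ((N f₁)⁻¹ *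
      Matrix.of fun n j => b.repr (f₁ n) (Sum.inr j)) (e.symm q.1) q.2
    have hx₁ : (fun n => ∑ m, N f₁ n m • (chartFrame b e x₁).1 m) = f₁ := by
      ext1 n
      apply b.repr.injective
      ext l
      simp only [map_sum, map_smul, Finsupp.coe_finsetSum, Finset.sum_apply,
        Finsupp.smul_apply, smul_eq_mul]
      change ∑ m, N f₁ n m * b.repr (chartVec b x₁ (e m)) l = _
      simp only [repr_chartVec]
      rcases l with i | j
      · simp only [chartMat, Matrix.fromCols_apply_inl, Matrix.one_apply, mul_ite, mul_one,
          mul_zero]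
        have h4 : ∀ m, e m = i ↔ m = e.symm i := fun m => by
          rw [Equiv.eq_symm_apply]
        simp only [h4, Finset.sum_ite_eq', Finset.mem_univ, if_true]
        simp [N]
      · simp only [chartMat, Matrix.fromCols_apply_inr, Matrix.of_apply, x₁,
          Equiv.symm_apply_apply]
        rw [← Matrix.mul_apply, Matrix.mul_nonsing_inv_cancel_left _ _ (Ne.isUnit hNf)]
        rfl
    rintro rfl
    have := hu x₁
    rw [map_zero, hx₁] at this
    exact hpf this
  · rw [← hu] at hx
    have hspan := span_range_sum_smul hNf (chartFrame b e x).1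
    have hli : LinearIndependent ℂ fun n => ∑ m, N f₁ n m • (chartFrame b e x).1 m := by
      rw [linearIndependent_iff_card_eq_finrank_span, Set.finrank, hspan]
      exact (linearIndependent_iff_card_eq_finrank_span.1 (chartFrame b e x).2)
    have hmem := hpU ⟨_, hli⟩ hx
    have : Frame.span ⟨_, hli⟩ = chartPt b e x := Subtype.ext hspan
    rw [← this]
    exact hmem

end ChartPoint

end RatQuot

/-! ### Invariant frames -/

namespace RatQuot

section Act

variable {H W : Type*} [Group H] [AddCommGroup W] [Module ℂ W] {σ : Representation ℂ H W}

theorem Grass.act_mul {k : ℕ} (g h : H) (P : Grass W k) :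
    P.act σ (g * h) = (P.act σ h).act σ g := by
  refine Subtype.ext ?_
  have : (repEquiv σ (g * h)).toLinearMap
      = (repEquiv σ g).toLinearMap ∘ₗ (repEquiv σ h).toLinearMap := by
    ext x; simp [repEquiv]
  simp only [Grass.act, this, Submodule.map_comp]

theorem Grass.act_one {k : ℕ} (P : Grass W k) : P.act σ 1 = P := by
  refine Subtype.ext ?_
  have : (repEquiv σ 1).toLinearMap = LinearMap.id := by
    ext x; simp [repEquiv]
  simp only [Grass.act, this, Submodule.map_id]

/-- Elements acting trivially on `ℙW` act on `W` by scalars. -/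
theorem exists_eq_smul_of_mem_projKernel {h : H} (hh : h ∈ projKernel σ) :
    ∃ s : ℂ, ∀ w, σ h w = s • w := by
  have h1 : ∀ w, σ h w ∈ Submodule.span ℂ {w} := by
    intro w
    by_cases hw : w = 0
    · simp [hw]
    have h2 := congrArg Subtype.val (hh ⟨Submodule.span ℂ {w}, finrank_span_singleton hw⟩)
    change Submodule.map (repEquiv σ h).toLinearMap (Submodule.span ℂ {w})
      = Submodule.span ℂ {w} at h2
    rw [← h2]
    exact Submodule.mem_map_of_mem (Submodule.mem_span_singleton_self w)
  obtain ⟨s, hs⟩ := LinearMap.exists_eq_smul_id_of_forall_notLinearIndependent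
    (f := σ h) fun w => by
      obtain ⟨a, ha⟩ := Submodule.mem_span_singleton.1 (h1 w)
      rw [LinearIndependent.pair_iff]
      intro hli
      have := hli a (-1) (by rw [ha]; simp)
      simp at this
  exact ⟨s, fun w => by rw [hs]; rfl⟩

end Act

section TwistTrivial

variable {H W : Type*} [Group H] [AlgGroup H] [AddCommGroup W] [Module ℂ W]
  {σ : Representation ℂ H W} {k : ℕ} {L : LinearizedLineBundle σ k}

/-- If `h ∈ H₀` acts by `m` on the fibre of `ℒ` at `P`, then it acts by `m⁻¹` on `P`. -/
theorem LinearizedLineBundle.TwistTrivial.exists_smul (hL : L.TwistTrivial) {h : H}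
    (hh : h ∈ projKernel σ) {P : Grass W k} (e : P.act σ h = P) {y : L.fiber P} (hy : y ≠ 0) :
    ∃ m : ℂ, L.act h e y = m • y ∧ ∀ w ∈ P.1, m • σ h w = w := by
  obtain ⟨m, hm⟩ := (finrank_eq_one_iff_of_nonzero' y hy).1 (L.finrank_fiber P) (L.act h e y)
  refine ⟨m, hm.symm, fun w hw => ?_⟩
  obtain ⟨φ, hφ⟩ := Module.Projective.exists_dual_eq_one ℂ hy
  have h1 := congrArg (fun f => TensorProduct.rid ℂ P.1 (TensorProduct.map LinearMap.id φ
    (f (⟨w, hw⟩ ⊗ₜ y)))) (hL h hh P e)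
  simp only [TensorProduct.map_tmul, LinearMap.id_apply, TensorProduct.rid_tmul,
    LinearEquiv.coe_coe, ← hm, map_smul, hφ, smul_eq_mul, mul_one, one_smul] at h1
  exact congrArg Subtype.val h1

end TwistTrivial

section Frames

variable {H W I J : Type*} [Group H] [AlgGroup H] [AddCommGroup W] [Module ℂ W]
  [Fintype I] [DecidableEq I] [Fintype J] {b : Basis (I ⊕ J) ℂ W} {σ : Representation ℂ H W}
  {K : Type*} [Field K] [Algebra ℂ K] {A : I × J → K} {τ : H → K →ₐ[ℂ] K}

/-- The linearization in terms of a trivialization `y` of `ℒ` near a point of the chart: a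
rational cocycle `c` of `H`, with values `v`. At the points of `{D ≠ 0}`, where all of this is
defined, stabilizers are contained in `H₀`. -/
theorem exists_linearization_cocycle (hσ : IsAlgebraicRep σ) (hK : ChartAction b σ A τ) {k : ℕ}
    (e : Fin k ≃ I) (L : LinearizedLineBundle σ k) (hGr : ActsAlmostFreely σ k) :
    ∃ (D : H → MvPolynomial (I × J) ℂ) (c : H → K) (v : H → (I × J → ℂ) → ℂ)
      (y : ∀ P, L.fiber P),
      D ∈ familyRing H (I × J) ∧ (∀ h, D h ≠ 0) ∧
      (∃ G ∈ familyRing H (I × J), ∀ h, D h = chartDet (repMatrix b σ h) * G h) ∧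
      IsFamily A D c v ∧ (∀ h, c h ≠ 0) ∧ (∀ g h, c (g * h) = c h * τ h (c g)) ∧
      ∀ h x, MvPolynomial.eval x (D h) ≠ 0 →
        y (chartPt b e x) ≠ 0 ∧ y (chartPt b e (chartMove (repMatrix b σ h) x)) ≠ 0 ∧
        (∀ E : (chartPt b e x).act σ h = chartPt b e (chartMove (repMatrix b σ h) x),
          L.act h E (y _) = v h x • y _) ∧
        ∀ g, (chartPt b e x).act σ g = chartPt b e x → g ∈ projKernel σ := by
  obtain ⟨i₀, hi₀⟩ := L.chart_cover (chartPt b e 0)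
  obtain ⟨u₁, hu₁, hu₁'⟩ := exists_chartPt_mem b e (L.chart_open i₀) ⟨_, hi₀⟩
  obtain ⟨U, hU, hUne, hfree⟩ := hGr
  obtain ⟨u₂, hu₂, hu₂'⟩ := exists_chartPt_mem b e hU hUne
  obtain ⟨D, hD, hD0, hDG, hDx⟩ := hK.exists_domain hσ (mul_ne_zero hu₁ hu₂)
  obtain ⟨c, hc, hc'⟩ := L.act_regular i₀ i₀
  have hchart : ∀ h x, MvPolynomial.eval x (D h) ≠ 0 →
      chartPt b e x ∈ L.chart i₀ ∧ chartPt b e (chartMove (repMatrix b σ h) x) ∈ L.chart i₀ ∧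
      (chartPt b e x).act σ h = chartPt b e (chartMove (repMatrix b σ h) x) ∧
      chartPt b e x ∈ U ∧ MvPolynomial.eval x (chartDet (repMatrix b σ h)) ≠ 0 := by
    intro h x hx
    obtain ⟨h1, h2, h3⟩ := hDx h x hx
    rw [map_mul] at h1 h3
    exact ⟨hu₁' _ (left_ne_zero_of_mul h1), hu₁' _ (left_ne_zero_of_mul h3),
      chartPt_act b e σ h2, hu₂' _ (right_ne_zero_of_mul h1), h2⟩
  let v : H → (I × J → ℂ) → ℂ := fun h x => c (h, chartPt b e x)
  obtain ⟨n, P, hP, hPv⟩ := exists_mul_pow_eq_of_locally hD v fun h x hx => by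
    obtain ⟨h1, h2, h3, -, -⟩ := hchart h x hx
    obtain ⟨p, hp, q, hq, hq0, hpq⟩ := hc (h, chartFrame b e x) ⟨h1, by rwa [← h3] at h2⟩
    obtain ⟨p', hp', hpp'⟩ := exists_eval_prodFun b e hp
    obtain ⟨q', hq', hqq'⟩ := exists_eval_prodFun b e hq
    refine ⟨p', hp', q', hq', ?_, fun g z hz hqz => ?_⟩
    · rwa [← hqq']
    · obtain ⟨h1, h2, h3, -, -⟩ := hchart g z hz
      rw [← hpp', ← hqq']
      rw [← hqq'] at hqz
      exact hpq (g, chartFrame b e z) ⟨h1, by rwa [← h3] at h2⟩ hqz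
  have hact : ∀ h x, MvPolynomial.eval x (D h) ≠ 0 →
      ∀ E : (chartPt b e x).act σ h = chartPt b e (chartMove (repMatrix b σ h) x),
        L.act h E (L.gen i₀ _) = v h x • L.gen i₀ _ := fun h x hx E =>
    hc' h E (hchart h x hx).1 (hchart h x hx).2.1
  have hv0 : ∀ h x, MvPolynomial.eval x (D h) ≠ 0 → v h x ≠ 0 := by
    intro h x hx h0
    obtain ⟨h1, -, h3, -⟩ := hchart h x hx
    have := hact h x hx h3
    rw [h0, zero_smul, LinearEquiv.map_eq_zero_iff] at this
    exact L.gen_ne_zero i₀ _ h1 this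
  have hDa : ∀ h, MvPolynomial.aeval A (D h) ≠ 0 := fun h => aeval_ne_zero hK.indep (hD0 h)
  let f : H → K := fun h => MvPolynomial.aeval A (P h) / MvPolynomial.aeval A (D h) ^ n
  have hf : IsFamily A D f v :=
    ⟨n, P, hP, fun h => div_mul_cancel₀ _ (pow_ne_zero n (hDa h)), hPv⟩
  have hf0 : ∀ h, f h ≠ 0 := by
    intro h
    refine div_ne_zero (aeval_ne_zero hK.indep fun h0 => ?_) (pow_ne_zero n (hDa h))
    obtain ⟨x, hx⟩ : ∃ x, MvPolynomial.eval x (D h) ≠ 0 := by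
      by_contra! h1
      exact hD0 h (MvPolynomial.funext fun x => by rw [h1, map_zero])
    have := hPv h x hx
    rw [h0, map_zero] at this
    exact mul_ne_zero (hv0 h x hx) (pow_ne_zero n hx) this
  refine ⟨D, f, v, L.gen i₀, hD, hD0, hDG, hf, hf0, fun g h => ?_, fun h x hx => ?_⟩
  · -- it suffices to compare the values at the points where all terms are defined
    obtain ⟨l, Q, hQ, hQ1, hQ2⟩ := hK.isFamily_apply_aeval hσ (D g)
    have hQ0 : Q h ≠ 0 := by
      intro h0
      have := hQ1 h
      rw [h0, map_zero, aeval_chartDet] at this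
      refine mul_ne_zero ?_ (pow_ne_zero l (hK.det_ne_zero h)) this
      simpa using hDa g
    refine eq_of_hasValue hK.indep (mul_ne_zero (mul_ne_zero (hD0 h) (hD0 (g * h))) hQ0)
      fun x hx => ⟨v (g * h) x, ?_⟩
    simp only [map_mul] at hx
    have hx1 := left_ne_zero_of_mul (left_ne_zero_of_mul hx)
    have hx2 := right_ne_zero_of_mul (left_ne_zero_of_mul hx)
    obtain ⟨a1, a2, a3, a4, a5⟩ := hchart h x hx1
    have hx3 : MvPolynomial.eval (chartMove (repMatrix b σ h) x) (D g) ≠ 0 := by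
      have := right_ne_zero_of_mul hx
      rw [← hQ2 h x a5] at this
      exact left_ne_zero_of_mul this
    obtain ⟨b1, b2, b3, -⟩ := hchart g _ hx3
    refine ⟨hf.hasValue hx2, ?_⟩
    have hval : v (g * h) x = v h x * v g (chartMove (repMatrix b σ h) x) := by
      have E : (chartPt b e x).act σ (g * h)
          = chartPt b e (chartMove (repMatrix b σ g) (chartMove (repMatrix b σ h) x)) := by
        rw [Grass.act_mul, a3, b3]
      have h1 := L.act_mul g h a3 b3 E (L.gen i₀ _)
      rw [hact h x hx1 a3, map_smul, hact g _ hx3 b3, hc' (g * h) E a1 b2, smul_smul] at h1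
      exact smul_left_injective ℂ (L.gen_ne_zero i₀ _ b2) h1
    rw [hval]
    exact (hf.hasValue hx1).mul (hK.hasValue_apply hσ a5 (hf.hasValue hx3))
  · obtain ⟨h1, h2, h3, h4, h5⟩ := hchart h x hx
    exact ⟨L.gen_ne_zero i₀ _ h1, L.gen_ne_zero i₀ _ h2, hact h x hx, hfree _ h4⟩

omit [AlgGroup H] in
theorem toCols₁_moved_one : (moved (repMatrix b σ 1) A).toCols₁ = 1 := by
  classical
  rw [moved, repMatrix_one, Matrix.map_one _ (map_zero _) (map_one _), Matrix.mul_one, chartMat,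
    Matrix.toCols₁_fromCols]

/-- The bundle `ℰ ⊗ ℒ` descends to the quotient of the Grassmannian by `H`: the
columns of `S` are a rational frame of invariant sections of the dual bundle. As `τ h` acts on
coordinates, the cocycle of the dual bundle is `c h` times the left block of `[1 | A] M(h)`. -/
theorem ChartAction.exists_invariant_frame [Nonempty I] (hσ : IsAlgebraicRep σ)
    (hK : ChartAction b σ A τ) {k : ℕ} (e : Fin k ≃ I) {L : LinearizedLineBundle σ k}
    (hL : L.TwistTrivial) (hGr : ActsAlmostFreely σ k) :
    ∃ (c : H → K) (S : Matrix I I K), (∀ h, c h ≠ 0) ∧ IsUnit S.det ∧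
      ∀ h, c h • ((moved (repMatrix b σ h) A).toCols₁ * S.map (τ h)) = S := by
  obtain ⟨D, c, v, y, hD, hD0, ⟨G, hG, hDG⟩, hcv, hc0, hc, hy⟩ :=
    exists_linearization_cocycle hσ hK e L hGr
  have hdet : ∀ h x, MvPolynomial.eval x (D h) ≠ 0 →
      MvPolynomial.eval x (chartDet (repMatrix b σ h)) ≠ 0 := fun h x hx => by
    rw [hDG, map_mul] at hx
    exact left_ne_zero_of_mul hx
  have hc1 : c 1 = 1 := by
    have := hc 1 1
    rw [hK.one, mul_one] at this
    exact mul_left_cancel₀ (hc0 1) (by rw [← this, mul_one])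
  have hspan := span_invariants_eq_top_of_separated hK.indep hD hD0 τ hK.one hK.mul
    (fun h x => chartMove (repMatrix b σ h) x) (fun i => (hK.isFamily_coord hσ i).mono hG hDG)
    (fun h => c h • (moved (repMatrix b σ h) A).toCols₁)
    (fun h x => v h x • (moved (repMatrix b σ h) x).toCols₁)
    (fun i j => hcv.mul (isFamily_moved hσ i (Sum.inl j)))
    (fun h h' x hx hx' hE => ?_)
    (by rw [hc1, one_smul, toCols₁_moved_one])
    (fun g h => by
      have h1 : (c g • (moved (repMatrix b σ g) A).toCols₁).map (τ h)
          = τ h (c g) • ((moved (repMatrix b σ g) A).toCols₁).map (τ h) := by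
        ext i j
        simp
      rw [hK.toCols₁_mul, hc, h1, Matrix.smul_mul, Matrix.mul_smul, smul_smul])
  · obtain ⟨w, hw, hw0⟩ : ∃ w ∈ {w : I → K | ∀ h, (c h • (moved (repMatrix b σ h) A).toCols₁).mulVec
        (fun i => τ h (w i)) = w}, w ≠ 0 := by
      by_contra! h0
      have : Submodule.span K {w : I → K | ∀ h,
          (c h • (moved (repMatrix b σ h) A).toCols₁).mulVec (fun i => τ h (w i)) = w} = ⊥ :=
        Submodule.span_eq_bot.2 h0
      rw [hspan] at this
      exact top_ne_bot this
    obtain ⟨S, hS, hSs, -⟩ := exists_isUnit_det_of_span_eq_top hspan (Classical.arbitrary I) hw hw0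
    refine ⟨c, S, hc0, hS, fun h => ?_⟩
    rw [← Matrix.smul_mul]
    ext i j
    exact congrFun (hSs j h) i
  · -- two elements with the same effect on a general point `P` differ by an element of `H₀`
    obtain ⟨h₀, rfl⟩ : ∃ h₀, h' = h * h₀ := ⟨h⁻¹ * h', by group⟩
    obtain ⟨hy1, hy2, hya, hyf⟩ := hy h x hx
    obtain ⟨-, -, hya', -⟩ := hy (h * h₀) x hx'
    have E := chartPt_act b e σ (hdet h x hx)
    have E' := chartPt_act b e σ (hdet (h * h₀) x hx')
    rw [← hE] at E' hya'
    have E₀ : (chartPt b e x).act σ h₀ = chartPt b e x := by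
      have h1 : (chartPt b e x).act σ h₀ = ((chartPt b e x).act σ (h * h₀)).act σ h⁻¹ := by
        rw [← Grass.act_mul, inv_mul_cancel_left]
      rw [h1, E', ← E, ← Grass.act_mul, inv_mul_cancel, Grass.act_one]
    obtain ⟨m, hm1, hm2⟩ := hL.exists_smul (hyf h₀ E₀) E₀ hy1
    have hvv : v (h * h₀) x = m * v h x := by
      have h1 := L.act_mul h h₀ E₀ E E' (y _)
      rw [hya' E', hm1, map_smul, hya E, smul_smul] at h1
      exact smul_left_injective ℂ hy2 h1
    ext i j
    have h2 : v h x • σ h (chartVec b x i) = v (h * h₀) x • σ (h * h₀) (chartVec b x i) := by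
      have h3 : σ (h * h₀) (chartVec b x i) = σ h (σ h₀ (chartVec b x i)) := by
        rw [map_mul]; rfl
      conv_lhs => rw [← hm2 _ (chartVec_mem b e x i)]
      rw [h3, hvv, map_smul, smul_smul, mul_comm]
    rw [apply_chartVec_eq b σ (hdet h x hx), apply_chartVec_eq b σ (hdet (h * h₀) x hx'), ← hE,
      Finset.smul_sum, Finset.smul_sum] at h2
    simp only [smul_smul] at h2
    have h4 := (Fintype.linearIndependent_iff.1 (linearIndependent_chartVec b
      (chartMove (repMatrix b σ h) x)))
      (fun j => v h x * (moved (repMatrix b σ h) x).toCols₁ i j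
        - v (h * h₀) x * (moved (repMatrix b σ (h * h₀)) x).toCols₁ i j) (by
        simp only [sub_smul, Finset.sum_sub_distrib]
        rw [h2, sub_self]) j
    exact sub_eq_zero.1 h4

end Frames

section ProjectiveSpace

variable {H W J : Type*} [Group H] [AlgGroup H] [AddCommGroup W] [Module ℂ W]
  [Fintype J] [DecidableEq J] {b : Basis (Unit ⊕ J) ℂ W} {σ : Representation ℂ H W}
  {K : Type*} [Field K] [Algebra ℂ K] {A : Unit × J → K} {τ : H → K →ₐ[ℂ] K}

/-- The bundle `Hom(𝒪(-1), W)` descends to the quotient of `ℙW` by `H`: the rows of `S` are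
a rational frame of invariant sections. The first one is the tautological inclusion. -/
theorem ChartAction.exists_invariant_rows (hσ : IsAlgebraicRep σ) (hK : ChartAction b σ A τ)
    (hPW : ActsAlmostFreely σ 1) :
    ∃ S : Matrix (Unit ⊕ J) (Unit ⊕ J) K, IsUnit S.det ∧
      (∀ l, S (Sum.inl ()) l = chartMat A () l) ∧
      ∀ h, (moved (repMatrix b σ h) A).toCols₁ () () • S.map (τ h)
        = S * (repMatrix b σ h).map (algebraMap ℂ K) := by
  have e : Fin 1 ≃ Unit := Equiv.ofUnique _ _
  obtain ⟨U, hU, hUne, hfree⟩ := hPW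
  obtain ⟨u, hu, hu'⟩ := exists_chartPt_mem b e hU hUne
  obtain ⟨D, hD, hD0, ⟨G, hG, hDG⟩, hDx⟩ := hK.exists_domain hσ hu
  let M : H → Matrix (Unit ⊕ J) (Unit ⊕ J) ℂ := repMatrix b σ
  have hMinv : ∀ h, M h * M h⁻¹ = 1 := fun h => by
    rw [← repMatrix_mul, inv_mul_cancel, repMatrix_one]
  let N : H → K := fun h => (moved (M h) A).toCols₁ () ()
  have hNmul : ∀ g h, N (g * h) = N h * τ h (N g) := fun g h => by
    have := congrFun (congrFun (hK.toCols₁_mul g h) ()) ()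
    rw [Matrix.mul_apply, Fintype.sum_unique] at this
    exact this
  have hN1 : N 1 = 1 := by
    exact congrFun (congrFun (toCols₁_moved_one (b := b) (σ := σ) (A := A)) ()) ()
  have hmapτ : ∀ h (Q : Matrix (Unit ⊕ J) (Unit ⊕ J) ℂ),
      (Q.map (algebraMap ℂ K)).map (τ h) = Q.map (algebraMap ℂ K) := fun h Q => by
    ext i j
    simp
  have hspan := span_invariants_eq_top_of_separated hK.indep hD hD0 τ hK.one hK.mul
    (fun h x => chartMove (M h) x) (fun i => (hK.isFamily_coord hσ i).mono hG hDG)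
    (fun h => N h • ((M h⁻¹).transpose.map (algebraMap ℂ K)))
    (fun h x => (moved (M h) x).toCols₁ () () • (M h⁻¹).transpose)
    (fun i j => by
      have h1 := isFamily_aeval (A := A) (D := D) (C_mem_familyRing (ι := Unit × J)
        (AlgGroup.inv_regular _ (repMatrix_regular (b := b) hσ j i)))
      simp only [MvPolynomial.aeval_C, MvPolynomial.eval_C] at h1
      exact (isFamily_moved hσ () (Sum.inl ())).mul h1)
    (fun h h' x hx hx' hE => ?_)
    (by
      change N 1 • ((M 1⁻¹).transpose.map (algebraMap ℂ K)) = 1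
      have h1 : M 1 = 1 := repMatrix_one b σ
      rw [hN1, one_smul, inv_one, h1, Matrix.transpose_one,
        Matrix.map_one _ (map_zero _) (map_one _)])
    (fun g h => by
      have h1 : (N g • ((M g⁻¹).transpose.map (algebraMap ℂ K))).map (τ h)
          = τ h (N g) • ((M g⁻¹).transpose.map (algebraMap ℂ K)) := by
        conv_rhs => rw [← hmapτ h]
        ext i j
        exact map_mul (τ h) _ _
      have h2 : (M (g * h)⁻¹) = M g⁻¹ * M h⁻¹ := by rw [mul_inv_rev]; exact repMatrix_mul b σ _ _
      change N (g * h) • ((M (g * h)⁻¹).transpose.map (algebraMap ℂ K)) = _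
      rw [h1, hNmul, h2, Matrix.transpose_mul, Matrix.smul_mul, Matrix.mul_smul, smul_smul,
        Matrix.map_mul])
  · -- the tautological section is invariant
    have hw : (fun l => chartMat A () l) ∈ {w : Unit ⊕ J → K | ∀ h,
        (N h • ((M h⁻¹).transpose.map (algebraMap ℂ K))).mulVec (fun i => τ h (w i)) = w} := by
      intro h
      have h1 : N h • chartMat (fun p => τ h (A p)) () = moved (M h) A () := by
        have := congrFun (hK.apply_coord h) ()
        rw [← this]
        ext l
        rw [Matrix.mul_apply, Fintype.sum_unique]
        rfl
      have h2 : (fun i => τ h (chartMat A () i)) = chartMat (fun p => τ h (A p)) () := by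
        have := congrFun (map_chartMat (τ h : K →+* K) A) ()
        exact this
      rw [h2, Matrix.smul_mulVec, ← Matrix.mulVec_smul, h1, Matrix.transpose_map,
        Matrix.mulVec_transpose]
      have h3 : moved (M h) A () = Matrix.vecMul (chartMat A ()) ((M h).map (algebraMap ℂ K)) :=
        rfl
      rw [h3, Matrix.vecMul_vecMul, ← Matrix.map_mul, hMinv,
        Matrix.map_one _ (map_zero _) (map_one _), Matrix.vecMul_one]
    obtain ⟨S, hS, hSs, hS0⟩ := exists_isUnit_det_of_span_eq_top hspan (Sum.inl ()) hw (by
      intro h0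
      have := congrFun h0 (Sum.inl ())
      simp [chartMat] at this)
    refine ⟨S.transpose, by rwa [Matrix.det_transpose], fun l => congrFun hS0 l, fun h => ?_⟩
    have h1 : N h • ((M h⁻¹).transpose.map (algebraMap ℂ K) * S.map (τ h)) = S := by
      rw [← Matrix.smul_mul]
      ext i j
      exact congrFun (hSs j h) i
    have h2 := congrArg Matrix.transpose h1
    rw [Matrix.transpose_smul, Matrix.transpose_mul, Matrix.transpose_map,
      Matrix.transpose_transpose] at h2
    have h3 := congrArg (fun Q => Q * (M h).map (algebraMap ℂ K)) h2
    beta_reduce at h3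
    rw [Matrix.smul_mul, Matrix.mul_assoc, ← Matrix.map_mul] at h3
    have h4 : M h⁻¹ * M h = 1 := by
      have := hMinv h⁻¹
      rwa [inv_inv] at this
    rwa [h4, Matrix.map_one _ (map_zero _) (map_one _), Matrix.mul_one] at h3
  · -- two elements with the same effect on a general point differ by a scalar
    obtain ⟨h₀, rfl⟩ : ∃ h₀, h' = h * h₀ := ⟨h⁻¹ * h', by group⟩
    obtain ⟨hxu, hxd, -⟩ := hDx h x hx
    obtain ⟨-, hxd', -⟩ := hDx (h * h₀) x hx'
    have E := chartPt_act b e σ hxd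
    have E' := chartPt_act b e σ hxd'
    have hE' : chartMove (repMatrix b σ h) x = chartMove (repMatrix b σ (h * h₀)) x := hE
    rw [← hE'] at E'
    have E₀ : (chartPt b e x).act σ h₀ = chartPt b e x := by
      have h1 : (chartPt b e x).act σ h₀ = ((chartPt b e x).act σ (h * h₀)).act σ h⁻¹ := by
        rw [← Grass.act_mul, inv_mul_cancel_left]
      rw [h1, E', ← E, ← Grass.act_mul, inv_mul_cancel, Grass.act_one]
    obtain ⟨s, hs⟩ := exists_eq_smul_of_mem_projKernel (hfree _ (hu' x hxu) h₀ E₀)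
    have hs1 : M h₀ = s • 1 := by
      ext i j
      change b.repr (σ h₀ (b i)) j = _
      rw [hs]
      simp [Matrix.one_apply, Finsupp.single_apply]
    have h1 : M (h * h₀) = s • M h := by
      have : M (h * h₀) = M h₀ * M h := repMatrix_mul b σ _ _
      rw [this, hs1, Matrix.smul_mul, Matrix.one_mul]
    have h2 : M h⁻¹ = s • M (h * h₀)⁻¹ := by
      have : M h⁻¹ = M (h * h₀)⁻¹ * M h₀ := by
        rw [← repMatrix_mul, mul_inv_rev, mul_inv_cancel_left]
      rw [this, hs1, Matrix.mul_smul, Matrix.mul_one]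
    have h3 : (moved (M (h * h₀)) x).toCols₁ () () = s * (moved (M h) x).toCols₁ () () := by
      change (chartMat x * (M (h * h₀)).map (algebraMap ℂ ℂ)) () (Sum.inl ())
        = s * (chartMat x * (M h).map (algebraMap ℂ ℂ)) () (Sum.inl ())
      simp only [h1, Matrix.mul_apply, Matrix.map_apply, Matrix.smul_apply, smul_eq_mul,
        Algebra.algebraMap_self, RingHom.id_apply, Finset.mul_sum]
      exact Finset.sum_congr rfl fun _ _ => by ring
    change (moved (M h) x).toCols₁ () () • (M h⁻¹).transpose
      = (moved (M (h * h₀)) x).toCols₁ () () • (M (h * h₀)⁻¹).transpose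
    rw [h2, h3, Matrix.transpose_smul, smul_smul, mul_comm]

end ProjectiveSpace

end RatQuot

/-! ### Generic matrices and their chart coordinates -/

namespace RatQuot

open IntermediateField IntermediateField.algebraAdjoinAdjoin

section Adjoin

variable {F : Type*} [Field F] [Algebra ℂ F]

theorem adjoin_range_le {ι : Type*} {s : ι → F} {E : IntermediateField ℂ F} (h : ∀ i, s i ∈ E) :
    adjoin ℂ (Set.range s) ≤ E :=
  adjoin_le_iff.2 (Set.range_subset_iff.2 h)

theorem algebraicIndependent_adjoin_of_sumElim {ι κ : Type*} {s : ι → F} {t : κ → F}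
    (h : AlgebraicIndependent ℂ (Sum.elim s t)) :
    AlgebraicIndependent (adjoin ℂ (Set.range t)) s := by
  have h1 := (AlgebraicIndependent.sumElim_iff.1 h).2
  have : Algebra.IsAlgebraic (Algebra.adjoin ℂ (Set.range t)) (adjoin ℂ (Set.range t)) :=
    IsLocalization.isAlgebraic _ (nonZeroDivisors (Algebra.adjoin ℂ (Set.range t)))
  exact h1.extendScalars _

end Adjoin

theorem det_ne_zero_of_algebraicIndependent {k F n : Type*} [Field k] [Field F]
    [Algebra k F] [Fintype n] [DecidableEq n] {X : Matrix n n F}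
    (hX : AlgebraicIndependent k fun p : n × n => X p.1 p.2) : X.det ≠ 0 := by
  intro h
  apply Matrix.det_mvPolynomialX_ne_zero n k
  apply hX
  rw [AlgHom.map_det, map_zero, ← h]
  congr 1
  ext i j
  simp [Matrix.mvPolynomialX]

section ChartCoord

variable {I J F : Type*} [Fintype I] [DecidableEq I] [Field F]

theorem chartCoord_mul {B : Matrix I I F} (hB : B.det ≠ 0) (x : Matrix I (I ⊕ J) F) :
    chartCoord (B * x) = chartCoord x := by
  have h1 : (B * x).toCols₁ = B * x.toCols₁ := rfl
  have h2 : (B * x).toCols₂ = B * x.toCols₂ := rfl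
  ext p
  rw [chartCoord, h1, h2, Matrix.mul_inv_rev, Matrix.mul_assoc,
    Matrix.nonsing_inv_mul_cancel_left _ _ (Ne.isUnit hB)]
  rfl

theorem map_chartCoord {F' : Type*} [Field F'] (f : F →+* F') (x : Matrix I (I ⊕ J) F)
    (p : I × J) : f (chartCoord x p) = chartCoord (x.map f) p := by
  have h1 : (x.map f).toCols₁ = f.mapMatrix x.toCols₁ := rfl
  rw [chartCoord, chartCoord, Matrix.inv_def, Matrix.inv_def, h1, ← RingHom.map_adjugate,
    ← RingHom.map_det]
  simp only [Matrix.mul_apply, map_sum, map_mul, Matrix.smul_apply, smul_eq_mul,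
    Ring.inverse_eq_inv', map_inv₀]
  rfl

theorem chartCoord_mem [Algebra ℂ F] {E : IntermediateField ℂ F} {x : Matrix I (I ⊕ J) F}
    (hx : ∀ i j, x i j ∈ E) (p : I × J) : chartCoord x p ∈ E := by
  have := map_chartCoord (E.val : E →+* F) (Matrix.of fun i j => (⟨x i j, hx i j⟩ : E)) p
  have h2 : (Matrix.of fun i j => (⟨x i j, hx i j⟩ : E)).map (E.val : E →+* F) = x := rfl
  rw [h2] at this
  rw [← this]
  exact SetLike.coe_mem _

theorem mul_mem_of_mem {k : Type*} [Field k] [Algebra k F] {E : IntermediateField k F}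
    {m n o : Type*} [Fintype n] {x : Matrix m n F} {y : Matrix n o F}
    (hx : ∀ i j, x i j ∈ E) (hy : ∀ i j, y i j ∈ E) (i : m) (j : o) : (x * y) i j ∈ E :=
  sum_mem fun k _ => mul_mem (hx i k) (hy k j)

theorem inv_mem_of_mem {k : Type*} [Field k] [Algebra k F] {E : IntermediateField k F}
    {n : Type*} [Fintype n] [DecidableEq n] {x : Matrix n n F} (hx : ∀ i j, x i j ∈ E) (i j : n) :
    x⁻¹ i j ∈ E := by
  have h1 : x = (E.val : E →+* F).mapMatrix (Matrix.of fun i j => (⟨x i j, hx i j⟩ : E)) := rfl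
  have h2 : x⁻¹ i j = x.det⁻¹ * x.adjugate i j := by
    rw [Matrix.inv_def, Ring.inverse_eq_inv']
    rfl
  rw [h2, h1, ← RingHom.map_adjugate, ← RingHom.map_det]
  exact mul_mem (inv_mem (Subtype.mem _)) (Subtype.mem _)

omit [Fintype I] in
theorem chartMat_mem {k : Type*} [Field k] [Algebra k F] {E : IntermediateField k F}
    {a : I × J → F} (ha : ∀ p, a p ∈ E) (i : I) (l : I ⊕ J) : chartMat a i l ∈ E := by
  rcases l with k | j
  · simp only [chartMat, Matrix.fromCols_apply_inl, Matrix.one_apply]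
    split_ifs
    · exact one_mem E
    · exact zero_mem E
  · exact ha (i, j)

/-- Right multiplication by a matrix over `E` maps points of the Grassmannian with coordinates
in `E` to such points. -/
theorem chartCoord_mul_mem [Algebra ℂ F] [Fintype J] {E : IntermediateField ℂ F}
    {x : Matrix I (I ⊕ J) F} (hx : x.toCols₁.det ≠ 0) (ha : ∀ p, chartCoord x p ∈ E)
    {N : Matrix (I ⊕ J) (I ⊕ J) F} (hN : ∀ i j, N i j ∈ E) (p : I × J) :
    chartCoord (x * N) p ∈ E := by
  rw [← toCols₁_mul_chartCoord hx, Matrix.mul_assoc, chartCoord_mul hx]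
  exact chartCoord_mem (mul_mem_of_mem (chartMat_mem ha) hN) p

end ChartCoord

section GenericMatrix

variable {I J F : Type*} [Fintype I] [DecidableEq I] [Fintype J] [Field F] [Algebra ℂ F]
  {x : Matrix I (I ⊕ J) F} (hx : AlgebraicIndependent ℂ fun p : I × (I ⊕ J) => x p.1 p.2)

include hx

omit [Fintype J] in
theorem toCols₁_det_ne_zero : x.toCols₁.det ≠ 0 :=
  det_ne_zero_of_algebraicIndependent (k := ℂ)
    (hx.comp (fun p : I × I => (p.1, Sum.inl p.2)) fun p q h => by
      simpa [Prod.ext_iff] using h)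

theorem algebraicIndependent_toCols₁_chartCoord : AlgebraicIndependent ℂ
    (Sum.elim (fun p : I × I => x p.1 (Sum.inl p.2)) (chartCoord x)) := by
  refine algebraicIndependent_of_mem_adjoin hx (by simp [mul_add]) fun p => ?_
  have h1 := congrFun (congrFun (toCols₁_mul_chartCoord (toCols₁_det_ne_zero hx)) p.1) p.2
  rw [← h1]
  exact mul_mem_of_mem
    (fun i j => subset_adjoin ℂ (Set.range (Sum.elim (fun p : I × I => x p.1 (Sum.inl p.2))
      (chartCoord x))) ⟨Sum.inl (i, j), rfl⟩)
    (chartMat_mem fun q => subset_adjoin ℂ _ ⟨Sum.inr q, rfl⟩) _ _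

theorem algebraicIndependent_chartCoord : AlgebraicIndependent ℂ (chartCoord x) :=
  (algebraicIndependent_toCols₁_chartCoord hx).comp Sum.inr Sum.inr_injective

/-- The left block of a generic matrix is generic over the field generated by the chart
coordinates, and remains so after an invertible change of columns over this field. -/
theorem algebraicIndependent_toCols₁_mul {S : Matrix I I F} (hS : S.det ≠ 0)
    (hSm : ∀ i j, S i j ∈ adjoin ℂ (Set.range (chartCoord x))) :
    AlgebraicIndependent (adjoin ℂ (Set.range (chartCoord x)))
      fun p : I × I => (x.toCols₁ * S) p.1 p.2 := by
  refine algebraicIndependent_of_mem_adjoin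
    (algebraicIndependent_adjoin_of_sumElim (algebraicIndependent_toCols₁_chartCoord hx)) rfl
    fun p => ?_
  have h1 : x p.1 (Sum.inl p.2) = (x.toCols₁ * S * S⁻¹) p.1 p.2 := by
    rw [Matrix.mul_nonsing_inv_cancel_right _ _ (Ne.isUnit hS)]
    rfl
  rw [h1]
  refine mul_mem_of_mem
    (fun i j => subset_adjoin _ (Set.range fun p : I × I => (x.toCols₁ * S) p.1 p.2)
      ⟨(i, j), rfl⟩)
    (inv_mem_of_mem fun i j => ?_) _ _
  exact IntermediateField.algebraMap_mem _
    (⟨S i j, hSm i j⟩ : adjoin ℂ (Set.range (chartCoord x)))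

variable {H W : Type*} [Group H] [AlgGroup H] [AddCommGroup W] [Module ℂ W]
  {b : Basis (I ⊕ J) ℂ W} {σ : Representation ℂ H W} {τ : H → F ≃ₐ[ℂ] F}

omit [AlgGroup H] in
/-- The left block `X` of `x = X [1 | A]` is transformed by the cocycle of the tautological
bundle. -/
theorem toCols₁_map (hτ : ∀ h, x.map (τ h) = x * (repMatrix b σ h).map (algebraMap ℂ F)) (h : H) :
    x.toCols₁.map (τ h)
      = x.toCols₁ * (moved (repMatrix b σ h) (chartCoord x)).toCols₁ := by
  have h1 := hτ h
  rw [← toCols₁_mul_chartCoord (toCols₁_det_ne_zero hx), Matrix.mul_assoc,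
    toCols₁_mul_chartCoord (toCols₁_det_ne_zero hx)] at h1
  have h2 := congrArg Matrix.toCols₁ h1
  exact h2

omit [AlgGroup H] in
theorem apply_chartCoord_mem
    (hτ : ∀ h, x.map (τ h) = x * (repMatrix b σ h).map (algebraMap ℂ F)) (h : H) {u : F}
    (hu : u ∈ adjoin ℂ (Set.range (chartCoord x))) :
    τ h u ∈ adjoin ℂ (Set.range (chartCoord x)) := by
  have : adjoin ℂ (Set.range (chartCoord x))
      ≤ (adjoin ℂ (Set.range (chartCoord x))).comap (τ h).toAlgHom := by
    refine adjoin_range_le fun p => ?_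
    change (τ h : F →+* F) (chartCoord x p) ∈ adjoin ℂ (Set.range (chartCoord x))
    have h1 : x.map (τ h : F →+* F) = x * (repMatrix b σ h).map (algebraMap ℂ F) := hτ h
    rw [map_chartCoord, h1]
    exact chartCoord_mul_mem (toCols₁_det_ne_zero hx)
      (fun q => subset_adjoin _ (Set.range (chartCoord x)) ⟨q, rfl⟩)
      (fun i j => (adjoin ℂ (Set.range (chartCoord x))).algebraMap_mem _) p
  exact this hu

omit [AlgGroup H] in
/-- The chart coordinates of a generic matrix, on which `H` acts from the right, are transformed
like the coordinates of the chart of the Grassmannian. -/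
theorem exists_chartAction (hτ1 : ∀ u, τ 1 u = u) (hτm : ∀ g h u, τ (g * h) u = τ h (τ g u))
    (hτ : ∀ h, x.map (τ h) = x * (repMatrix b σ h).map (algebraMap ℂ F)) :
    ∃ τK : H → adjoin ℂ (Set.range (chartCoord x)) →ₐ[ℂ] adjoin ℂ (Set.range (chartCoord x)),
      (∀ h u, (τK h u : F) = τ h u) ∧
      ChartAction b σ (fun p => (⟨chartCoord x p, subset_adjoin _ _ ⟨p, rfl⟩⟩ :
        adjoin ℂ (Set.range (chartCoord x)))) τK := by
  let K := adjoin ℂ (Set.range (chartCoord x))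
  let A : I × J → K := fun p => ⟨chartCoord x p, subset_adjoin _ _ ⟨p, rfl⟩⟩
  let τK : H → K →ₐ[ℂ] K := fun h =>
    ((τ h).toAlgHom.comp K.val).codRestrict K.toSubalgebra
      fun u => apply_chartCoord_mem hx hτ h u.2
  have hinj : Function.Injective K.val := Subtype.val_injective
  have hdet := toCols₁_det_ne_zero hx
  have hmov : ∀ h, (moved (repMatrix b σ h) A).map K.val
      = moved (repMatrix b σ h) (chartCoord x) := fun h => map_moved K.val _ _
  refine ⟨τK, fun h u => rfl, ?_, fun u => Subtype.ext (hτ1 u),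
    fun g h u => Subtype.ext (hτm g h u), fun h h0 => ?_, fun h => ?_⟩
  · exact (AlgHom.algebraicIndependent_iff K.val hinj).1 (algebraicIndependent_chartCoord hx)
  · have h1 := congrArg Matrix.det (toCols₁_map hx hτ h)
    have h2 : (x.toCols₁.map (τ h)).det = τ h x.toCols₁.det :=
      ((τ h : F →+* F).map_det x.toCols₁).symm
    have h3 : (moved (repMatrix b σ h) (chartCoord x)).toCols₁.det
        = K.val (moved (repMatrix b σ h) A).toCols₁.det := by
      rw [AlgHom.map_det, ← hmov]
      rfl
    rw [h2, Matrix.det_mul, h3, h0, map_zero, mul_zero] at h1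
    exact hdet ((τ h).injective (h1.trans (map_zero _).symm))
  · refine Matrix.map_injective hinj ?_
    have h1 := hτ h
    rw [← toCols₁_mul_chartCoord hdet] at h1
    have h2 : (x.toCols₁ * chartMat (chartCoord x)).map (τ h)
        = x.toCols₁.map (τ h) * chartMat fun p => τ h (chartCoord x p) :=
      (Matrix.map_mul (f := (τ h : F →+* F))).trans
        (congrArg _ (map_chartMat (τ h : F →+* F) (chartCoord x)))
    rw [h2, toCols₁_map hx hτ, Matrix.mul_assoc, Matrix.mul_assoc] at h1
    have h3 := congrArg (fun Q => x.toCols₁⁻¹ * Q) h1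
    beta_reduce at h3
    rw [Matrix.nonsing_inv_mul_cancel_left _ _ (Ne.isUnit hdet),
      Matrix.nonsing_inv_mul_cancel_left _ _ (Ne.isUnit hdet)] at h3
    have h4 : ((moved (repMatrix b σ h) A).toCols₁ * chartMat fun p => τK h (A p)).map K.val
        = (moved (repMatrix b σ h) A).toCols₁.map K.val *
          chartMat fun p => τ h (chartCoord x p) :=
      (Matrix.map_mul (f := (K.val : K →+* F))).trans
        (congrArg _ (map_chartMat (K.val : K →+* F) fun p => τK h (A p)))
    have h5 : (moved (repMatrix b σ h) A).toCols₁.map K.val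
        = (moved (repMatrix b σ h) (chartCoord x)).toCols₁ := by
      rw [← hmov]
      rfl
    exact h4.trans ((congrArg₂ (· * ·) h5 rfl).trans (h3.trans (hmov h).symm))

/-- After multiplication with a suitable matrix over the function field of the
Grassmannian, the left block of a generic matrix is transformed by scalars only. -/
theorem exists_toCols₁_mul_map [Nonempty I] (hσ : IsAlgebraicRep σ) (hτ1 : ∀ u, τ 1 u = u)
    (hτm : ∀ g h u, τ (g * h) u = τ h (τ g u))
    (hτ : ∀ h, x.map (τ h) = x * (repMatrix b σ h).map (algebraMap ℂ F)) {k : ℕ}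
    (e : Fin k ≃ I) {L : LinearizedLineBundle σ k} (hL : L.TwistTrivial)
    (hGr : ActsAlmostFreely σ k) :
    ∃ S : Matrix I I F, S.det ≠ 0 ∧ (∀ i j, S i j ∈ adjoin ℂ (Set.range (chartCoord x))) ∧
      ∀ h, ∃ c : F, c ≠ 0 ∧ (x.toCols₁ * S).map (τ h) = c • (x.toCols₁ * S) := by
  obtain ⟨τK, hτK, hK⟩ := exists_chartAction hx hτ1 hτm hτ
  obtain ⟨c, S, hc, hS, hSh⟩ := hK.exists_invariant_frame hσ e hL hGr
  let K := adjoin ℂ (Set.range (chartCoord x))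
  refine ⟨S.map K.val, ?_, fun i j => (S i j).2, fun h => ⟨(c h : F)⁻¹, ?_, ?_⟩⟩
  · intro h0
    refine hS.ne_zero (K.val.injective ?_)
    exact (K.val.map_det S).trans (h0.trans (map_zero K.val).symm)
  · simpa using hc h
  · have h1 := congrArg (fun Q => Q.map K.val) (hSh h)
    beta_reduce at h1
    have h2 : (c h • ((moved (repMatrix b σ h) fun p => (⟨chartCoord x p,
        subset_adjoin _ _ ⟨p, rfl⟩⟩ : K)).toCols₁ * S.map (τK h))).map K.val
        = (c h : F) • ((moved (repMatrix b σ h) (chartCoord x)).toCols₁ *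
          (S.map K.val).map (τ h)) := by
      have h3 := map_moved K.val (repMatrix b σ h) fun p => (⟨chartCoord x p,
        subset_adjoin _ _ ⟨p, rfl⟩⟩ : K)
      have h4 : (S.map (τK h)).map K.val = (S.map K.val).map (τ h) := by
        ext i j
        exact hτK h (S i j)
      have h5 := congrArg Matrix.toCols₁ h3
      ext i j
      refine (map_mul K.val _ _).trans (congrArg₂ (· * ·) rfl ?_)
      have h6 := congrFun (congrFun (Matrix.map_mul (f := (K.val : K →+* F))
        (L := (moved (repMatrix b σ h) fun p => (⟨chartCoord x p,
        subset_adjoin _ _ ⟨p, rfl⟩⟩ : K)).toCols₁) (M := S.map (τK h))) i) j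
      refine h6.trans ?_
      exact congrFun (congrFun (congrArg₂ (· * ·) h5 h4) i) j
    rw [h2] at h1
    have h3 : (x.toCols₁ * S.map K.val).map (τ h)
        = x.toCols₁.map (τ h) * (S.map K.val).map (τ h) := Matrix.map_mul (f := (τ h : F →+* F))
    rw [h3, toCols₁_map hx hτ, ← h1, Matrix.mul_smul, smul_smul, inv_mul_cancel₀, one_smul, h1,
      Matrix.mul_assoc]
    simpa using hc h

end GenericMatrix

section GenericVector

variable {J F : Type*} [Fintype J] [DecidableEq J] [Field F] [Algebra ℂ F]
  {x : Matrix Unit (Unit ⊕ J) F}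
  (hx : AlgebraicIndependent ℂ fun p : Unit × (Unit ⊕ J) => x p.1 p.2)
  {H W : Type*} [Group H] [AlgGroup H] [AddCommGroup W] [Module ℂ W]
  {b : Basis (Unit ⊕ J) ℂ W} {σ : Representation ℂ H W} {τ : H → F ≃ₐ[ℂ] F}

include hx

/-- There is a matrix `S` over the function field of `ℙW`, whose first row represents the generic
point of `ℙW`, and which is transformed up to scalars like this row. -/
theorem exists_map_smul_eq_mul (hσ : IsAlgebraicRep σ) (hτ1 : ∀ u, τ 1 u = u)
    (hτm : ∀ g h u, τ (g * h) u = τ h (τ g u))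
    (hτ : ∀ h, x.map (τ h) = x * (repMatrix b σ h).map (algebraMap ℂ F))
    (hPW : ActsAlmostFreely σ 1) :
    ∃ S : Matrix (Unit ⊕ J) (Unit ⊕ J) F, S.det ≠ 0 ∧
      (∀ i j, S i j ∈ adjoin ℂ (Set.range (chartCoord x))) ∧
      (∀ l, x () (Sum.inl ()) * S (Sum.inl ()) l = x () l) ∧
      ∀ h, ∃ c : F, c ≠ 0 ∧ c • S.map (τ h) = S * (repMatrix b σ h).map (algebraMap ℂ F) := by
  obtain ⟨τK, hτK, hK⟩ := exists_chartAction hx hτ1 hτm hτ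
  obtain ⟨S, hS, hS0, hSh⟩ := hK.exists_invariant_rows hσ hPW
  let K := adjoin ℂ (Set.range (chartCoord x))
  let A : Unit × J → K := fun p => ⟨chartCoord x p, subset_adjoin _ _ ⟨p, rfl⟩⟩
  refine ⟨S.map K.val, ?_, fun i j => (S i j).2, fun l => ?_,
    fun h => ⟨(moved (repMatrix b σ h) A).toCols₁ () (), ?_, ?_⟩⟩
  · intro h0
    refine hS.ne_zero (K.val.injective ?_)
    exact (K.val.map_det S).trans (h0.trans (map_zero K.val).symm)
  · have h1 := congrFun (congrFun (toCols₁_mul_chartCoord (toCols₁_det_ne_zero hx)) ()) l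
    rw [Matrix.mul_apply, Fintype.sum_unique] at h1
    have h2 : (S.map K.val) (Sum.inl ()) l = chartMat (chartCoord x) () l := by
      refine (congrArg K.val (hS0 l)).trans ?_
      exact congrFun (congrFun (map_chartMat (K.val : K →+* F) A) ()) l
    rw [h2]
    exact h1
  · intro h0
    apply hK.det_ne_zero h
    rw [Matrix.det_unique]
    exact Subtype.ext h0
  · have h1 := congrArg (fun Q => Q.map K.val) (hSh h)
    have h2 : (S.map (τK h)).map K.val = (S.map K.val).map (τ h) := by
      ext i j
      exact hτK h (S i j)
    have h3 : (((moved (repMatrix b σ h) A).toCols₁ () ()) • S.map (τK h)).map K.val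
        = ((moved (repMatrix b σ h) A).toCols₁ () () : F) • (S.map K.val).map (τ h) := by
      rw [← h2]
      ext i j
      exact map_mul K.val _ _
    have h4 : (S * (repMatrix b σ h).map (algebraMap ℂ K)).map K.val
        = S.map K.val * (repMatrix b σ h).map (algebraMap ℂ F) :=
      Matrix.map_mul (f := (K.val : K →+* F))
    exact h3.symm.trans (h1.trans h4)

end GenericVector

end RatQuot

/-! ### Fields generated by ratios, and their invariants -/

namespace RatQuot

open IntermediateField

section RatioField

variable {F : Type*} [Field F] [Algebra ℂ F]

theorem ratioField_le {ι : Type*} {y : ι → F} {E : IntermediateField ℂ F} {c : F} (hc : c ≠ 0)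
    (h : ∀ i, y i / c ∈ E) : ratioField y ≤ E :=
  adjoin_range_le fun p => by
    rw [← div_div_div_cancel_right₀ hc]
    exact div_mem (h p.1) (h p.2)

theorem ratioField_comp_le {ι κ : Type*} (y : ι → F) (f : κ → ι) :
    ratioField (y ∘ f) ≤ ratioField y :=
  adjoin_range_le fun p => div_mem_ratioField y (f p.1) (f p.2)

theorem ratioField_comp_equiv {ι κ : Type*} (y : ι → F) (e : κ ≃ ι) :
    ratioField (y ∘ e) = ratioField y := by
  refine le_antisymm (ratioField_comp_le y e) ?_
  have := ratioField_comp_le (y ∘ e) e.symm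
  rwa [Function.comp_assoc, Equiv.self_comp_symm, Function.comp_id] at this

theorem ratioField_comp_snd {ι : Type*} (y : ι → F) :
    ratioField (fun p : Unit × ι => y p.2) = ratioField y :=
  ratioField_comp_equiv y (Equiv.punitProd ι)

theorem ratioField_le_adjoin {ι : Type*} (y : ι → F) :
    ratioField y ≤ adjoin ℂ (Set.range y) :=
  adjoin_range_le fun p => div_mem (subset_adjoin _ _ ⟨p.1, rfl⟩) (subset_adjoin _ _ ⟨p.2, rfl⟩)

theorem ratioField_mul_le {m n o : Type*} [Fintype n] {x : Matrix m n F} {N : Matrix n o F}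
    {E : IntermediateField ℂ F} {i₀ : m} {j₀ : n} (h0 : x i₀ j₀ ≠ 0)
    (hx : ratioField (fun p : m × n => x p.1 p.2) ≤ E) (hN : ∀ i j, N i j ∈ E) :
    ratioField (fun p : m × o => (x * N) p.1 p.2) ≤ E := by
  refine ratioField_le h0 fun p => ?_
  rw [Matrix.mul_apply, Finset.sum_div]
  refine sum_mem fun k _ => ?_
  rw [mul_div_right_comm]
  exact mul_mem (hx (div_mem_ratioField (fun p : m × n => x p.1 p.2) (p.1, k) (i₀, j₀)))
    (hN _ _)

theorem chartCoord_mem_ratioField {I J : Type*} [Fintype I] [DecidableEq I]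
    {x : Matrix I (I ⊕ J) F} {i₀ : I} {l₀ : I ⊕ J} (h0 : x i₀ l₀ ≠ 0) (p : I × J) :
    chartCoord x p ∈ ratioField fun p : I × (I ⊕ J) => x p.1 p.2 := by
  have hB : ((x i₀ l₀)⁻¹ • (1 : Matrix I I F)).det ≠ 0 := by
    rw [Matrix.det_smul, Matrix.det_one, mul_one]
    exact pow_ne_zero _ (inv_ne_zero h0)
  rw [← chartCoord_mul hB]
  refine chartCoord_mem (fun i j => ?_) p
  rw [Matrix.smul_mul, Matrix.one_mul, Matrix.smul_apply, smul_eq_mul, mul_comm, ← div_eq_mul_inv]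
  exact div_mem_ratioField (fun p : I × (I ⊕ J) => x p.1 p.2) (i, j) (i₀, l₀)

theorem ratioField_row {J : Type*} {x : Matrix Unit (Unit ⊕ J) F}
    (h0 : x () (Sum.inl ()) ≠ 0) :
    ratioField (x ()) = adjoin ℂ (Set.range (chartCoord x)) := by
  have h1 : ratioField (fun p : Unit × (Unit ⊕ J) => x p.1 p.2) = ratioField (x ()) :=
    ratioField_comp_snd (x ())
  refine le_antisymm (ratioField_le h0 fun l => ?_)
    (h1 ▸ adjoin_range_le (chartCoord_mem_ratioField h0))
  have hdet : x.toCols₁.det ≠ 0 := by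
    rw [Matrix.det_unique]
    exact h0
  have h2 := congrFun (congrFun (toCols₁_mul_chartCoord hdet) ()) l
  rw [Matrix.mul_apply, Fintype.sum_unique] at h2
  have h3 : x () (Sum.inl ()) * chartMat (chartCoord x) () l = x () l := h2
  rw [← h3, mul_div_cancel_left₀ _ h0]
  exact chartMat_mem (fun q => subset_adjoin ℂ (Set.range (chartCoord x)) ⟨q, rfl⟩) _ _

theorem apply_eq_of_mem_adjoin {S : Set F} (τ : F ≃ₐ[ℂ] F) (h : ∀ s ∈ S, τ s = s) {u : F}
    (hu : u ∈ adjoin ℂ S) : τ u = u := by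
  have : adjoin ℂ S ≤ fixedIn (fun _ : Unit => τ) ⊤ :=
    adjoin_le_iff.2 fun s hs => ⟨mem_top, fun _ => h s hs⟩
  exact (this hu).2 ()

theorem apply_eq_of_mem_ratioField {ι : Type*} {y : ι → F} (τ : F ≃ₐ[ℂ] F) {c : F} (hc : c ≠ 0)
    (h : ∀ i, τ (y i) = c * y i) {u : F} (hu : u ∈ ratioField y) : τ u = u := by
  refine apply_eq_of_mem_adjoin τ ?_ hu
  rintro _ ⟨p, rfl⟩
  rw [map_div₀, h, h, mul_div_mul_left _ _ hc]

theorem apply_mem_ratioField {ι : Type*} {y : ι → F} (τ : F ≃ₐ[ℂ] F) {i₀ : ι} (h0 : y i₀ ≠ 0)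
    (h : ∀ i, τ (y i) / y i₀ ∈ ratioField y) {u : F} (hu : u ∈ ratioField y) :
    τ u ∈ ratioField y := by
  have : ratioField y ≤ (ratioField y).comap τ.toAlgHom := by
    refine adjoin_range_le fun p => ?_
    change τ (y p.1 / y p.2) ∈ ratioField y
    rw [map_div₀, ← div_div_div_cancel_right₀ h0]
    exact div_mem (h p.1) (h p.2)
  exact this hu

end RatioField

section Invariants

variable {F : Type*} [Field F] [Algebra ℂ F] {Γ : Type*} {τ : Γ → F ≃ₐ[ℂ] F}
  {E : IntermediateField ℂ F}

/-- Invariants of a purely transcendental extension with invariant generators. -/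
theorem fixedIn_sup_areBirational {κ : Type*} [Fintype κ] {n : ℕ} (hn : Fintype.card κ = n)
    {s : κ → F} (hs : AlgebraicIndependent E s) (hE : ∀ γ, ∀ u ∈ E, τ γ u ∈ E)
    (hfix : ∀ γ i, τ γ (s i) = s i) :
    AreBirational (fixedIn τ (E ⊔ adjoin ℂ (Set.range s))) (affineTimes n (fixedIn τ E)) := by
  refine areBirational_affineTimes_of_eq hn
    (algebraicIndependent_mono (fixedIn_le τ E) hs)
    (fixedIn_sup τ (linearDisjoint_adjoin hs) hE fun γ u hu =>
      apply_eq_of_mem_adjoin (τ γ) ?_ hu)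
  rintro _ ⟨i, rfl⟩
  exact hfix γ i

/-- Invariants of the function field of a projective bundle, where the homogeneous coordinates
on the fibres are invariant up to a common factor. -/
theorem fixedIn_sup_ratioField_areBirational {κ : Type*} [Fintype κ] {n : ℕ}
    (hn : Fintype.card κ = n) {y : Unit ⊕ κ → F} (hy : AlgebraicIndependent E y)
    (hE : ∀ γ, ∀ u ∈ E, τ γ u ∈ E)
    (hfix : ∀ γ, ∃ c : F, c ≠ 0 ∧ ∀ i, τ γ (y i) = c * y i) :
    AreBirational (fixedIn τ (E ⊔ ratioField y)) (affineTimes n (fixedIn τ E)) := by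
  have h0 : y (Sum.inl ()) ≠ 0 := hy.ne_zero _
  let s : κ → F := fun j => y (Sum.inr j) / y (Sum.inl ())
  have hs : AlgebraicIndependent E s := by
    have : AlgebraicIndependent E (Sum.elim (fun _ : Unit => y (Sum.inl ())) s) := by
      refine algebraicIndependent_of_mem_adjoin hy rfl fun i => ?_
      rcases i with _ | j
      · exact subset_adjoin _ _ ⟨Sum.inl (), rfl⟩
      · have h1 : y (Sum.inr j) = s j * y (Sum.inl ()) := (div_mul_cancel₀ _ h0).symm
        rw [h1]
        exact mul_mem (subset_adjoin _ _ ⟨Sum.inr j, rfl⟩) (subset_adjoin _ _ ⟨Sum.inl (), rfl⟩)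
    exact this.comp Sum.inr Sum.inr_injective
  have hr : ratioField y = adjoin ℂ (Set.range s) := by
    refine le_antisymm (ratioField_le h0 fun i => ?_)
      (adjoin_range_le fun j => div_mem_ratioField y _ _)
    rcases i with _ | j
    · rw [div_self h0]
      exact one_mem _
    · exact subset_adjoin _ _ ⟨j, rfl⟩
  rw [hr]
  refine fixedIn_sup_areBirational hn hs hE fun γ j => ?_
  obtain ⟨c, hc, h⟩ := hfix γ
  exact apply_eq_of_mem_ratioField (τ γ) hc h (div_mem_ratioField y _ _)

theorem exists_adjoin_eq_of_isRationalOfDim {n : ℕ} (h : IsRationalOfDim E n) :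
    ∃ t : Fin n → F, AlgebraicIndependent ℂ t ∧ adjoin ℂ (Set.range t) = E := by
  obtain ⟨e⟩ := h
  let X : Fin n → affineTimes n ℂ := fun i =>
    algebraMap (MvPolynomial (Fin n) ℂ) (affineTimes n ℂ) (MvPolynomial.X i)
  have hX : AlgebraicIndependent ℂ X := (MvPolynomial.algebraicIndependent_X (Fin n) ℂ).map'
    (f := IsScalarTower.toAlgHom ℂ (MvPolynomial (Fin n) ℂ) (affineTimes n ℂ))
    (IsFractionRing.injective (MvPolynomial (Fin n) ℂ) (affineTimes n ℂ))
  let f : affineTimes n ℂ →ₐ[ℂ] F := E.val.comp e.symm.toAlgHom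
  have hf : Function.Injective f := f.injective
  refine ⟨f ∘ X, (AlgHom.algebraicIndependent_iff f hf).2 hX, ?_⟩
  have h1 : adjoin ℂ (Set.range X) = ⊤ := adjoin_range_X_eq_top ℂ (Fin n)
  rw [Set.range_comp, ← adjoin_map, h1, ← AlgHom.fieldRange_eq_map]
  ext u
  constructor
  · rintro ⟨v, rfl⟩
    exact Subtype.mem _
  · intro hu
    exact ⟨e ⟨u, hu⟩, congrArg Subtype.val (e.symm_apply_apply ⟨u, hu⟩)⟩

end Invariants

section GenericMatrix

variable {F : Type*} [Field F] [Algebra ℂ F]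

/-- The function field of `ℙ(V ⊗ W)` as that of a projective bundle over the Grassmannian, with
the entries of `X S` as homogeneous coordinates on the fibres. -/
theorem ratioField_eq_sup {I J : Type*} [Fintype I] [DecidableEq I] [Fintype J] [Nonempty I]
    {x : Matrix I (I ⊕ J) F} (hx : AlgebraicIndependent ℂ fun p : I × (I ⊕ J) => x p.1 p.2)
    {S : Matrix I I F} (hS : S.det ≠ 0)
    (hSm : ∀ i j, S i j ∈ adjoin ℂ (Set.range (chartCoord x))) :
    ratioField (fun p : I × (I ⊕ J) => x p.1 p.2) = adjoin ℂ (Set.range (chartCoord x)) ⊔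
      ratioField fun p : I × I => (x.toCols₁ * S) p.1 p.2 := by
  let i₀ : I := Classical.arbitrary I
  have h0 : x i₀ (Sum.inl i₀) ≠ 0 := hx.ne_zero (i₀, Sum.inl i₀)
  have h0' : (x.toCols₁ * S) i₀ i₀ ≠ 0 :=
    (algebraicIndependent_toCols₁_mul hx hS hSm).ne_zero (i₀, i₀)
  have hK : adjoin ℂ (Set.range (chartCoord x)) ≤ ratioField fun p : I × (I ⊕ J) => x p.1 p.2 :=
    adjoin_range_le (chartCoord_mem_ratioField h0)
  refine le_antisymm ?_ (sup_le hK (ratioField_mul_le (x := x.toCols₁) h0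
    (ratioField_comp_le (fun p : I × (I ⊕ J) => x p.1 p.2) fun p : I × I => (p.1, Sum.inl p.2))
    fun i j => hK (hSm i j)))
  have h1 : x = x.toCols₁ * S * (S⁻¹ * chartMat (chartCoord x)) := by
    rw [Matrix.mul_assoc, Matrix.mul_nonsing_inv_cancel_left _ _ (Ne.isUnit hS),
      toCols₁_mul_chartCoord (toCols₁_det_ne_zero hx)]
  have h2 := ratioField_mul_le (N := S⁻¹ * chartMat (chartCoord x)) h0'
    (le_sup_right (a := adjoin ℂ (Set.range (chartCoord x)))) fun i j =>
    le_sup_left (a := adjoin ℂ (Set.range (chartCoord x))) (mul_mem_of_mem (inv_mem_of_mem hSm)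
      (chartMat_mem fun q => subset_adjoin ℂ (Set.range (chartCoord x)) ⟨q, rfl⟩) i j)
  rwa [← h1] at h2

theorem linearDisjoint_ratioField {I J : Type*} [Fintype I] [DecidableEq I] [Fintype J]
    {x : Matrix I (I ⊕ J) F} (hx : AlgebraicIndependent ℂ fun p : I × (I ⊕ J) => x p.1 p.2)
    {S : Matrix I I F} (hS : S.det ≠ 0)
    (hSm : ∀ i j, S i j ∈ adjoin ℂ (Set.range (chartCoord x))) :
    (adjoin ℂ (Set.range (chartCoord x))).LinearDisjoint
      (ratioField fun p : I × I => (x.toCols₁ * S) p.1 p.2) :=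
  (linearDisjoint_adjoin (algebraicIndependent_toCols₁_mul hx hS hSm)).of_le_right
    (ratioField_le_adjoin _)

end GenericMatrix

section FirstRow

variable {F I' J : Type*} [Field F] [Algebra ℂ F] [Fintype I'] [DecidableEq I'] [Fintype J]
  {x : Matrix (Unit ⊕ I') ((Unit ⊕ I') ⊕ J) F}
  (hx : AlgebraicIndependent ℂ fun p : (Unit ⊕ I') × ((Unit ⊕ I') ⊕ J) => x p.1 p.2)

include hx

/-- The function field of the space of the pairs of a point of the Grassmannian and a point in the
corresponding linear subspace: the point can be given by the first row of `x`, as a point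
of `ℙW`, or by the first row of `X S`, in coordinates on the subspace. -/
theorem sup_ratioField_firstRow {S : Matrix (Unit ⊕ I') (Unit ⊕ I') F} (hS : S.det ≠ 0)
    (hSm : ∀ i j, S i j ∈ adjoin ℂ (Set.range (chartCoord x))) :
    adjoin ℂ (Set.range (chartCoord x)) ⊔ ratioField ((x.toCols₁ * S) (Sum.inl ()))
      = adjoin ℂ (Set.range (chartCoord x)) ⊔ ratioField (x (Sum.inl ())) := by
  have h0 : x (Sum.inl ()) (Sum.inl (Sum.inl ())) ≠ 0 :=
    hx.ne_zero (Sum.inl (), Sum.inl (Sum.inl ()))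
  have h0' : (x.toCols₁ * S) (Sum.inl ()) (Sum.inl ()) ≠ 0 :=
    (algebraicIndependent_toCols₁_mul hx hS hSm).ne_zero (Sum.inl (), Sum.inl ())
  refine le_antisymm (sup_le le_sup_left ?_) (sup_le le_sup_left ?_)
  · have h1 := ratioField_mul_le (x := Matrix.of fun (_ : Unit) j => x (Sum.inl ()) (Sum.inl j))
      (N := S) (i₀ := ()) (j₀ := Sum.inl ()) (E := adjoin ℂ (Set.range (chartCoord x)) ⊔
        ratioField (x (Sum.inl ()))) h0
      ((ratioField_comp_le (x (Sum.inl ())) fun p : Unit × (Unit ⊕ I') => Sum.inl p.2).trans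
        le_sup_right) fun i j => le_sup_left (a := adjoin ℂ (Set.range (chartCoord x))) (hSm i j)
    rw [← ratioField_comp_snd ((x.toCols₁ * S) (Sum.inl ()))]
    exact h1
  · have h2 : x = x.toCols₁ * S * (S⁻¹ * chartMat (chartCoord x)) := by
      rw [Matrix.mul_assoc, Matrix.mul_nonsing_inv_cancel_left _ _ (Ne.isUnit hS),
        toCols₁_mul_chartCoord (toCols₁_det_ne_zero hx)]
    have h1 := ratioField_mul_le (x := Matrix.of fun (_ : Unit) j => (x.toCols₁ * S) (Sum.inl ()) j)
      (N := S⁻¹ * chartMat (chartCoord x)) (i₀ := ()) (j₀ := Sum.inl ())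
      (E := adjoin ℂ (Set.range (chartCoord x)) ⊔
        ratioField ((x.toCols₁ * S) (Sum.inl ()))) h0'
      ((ratioField_comp_le ((x.toCols₁ * S) (Sum.inl ())) fun p : Unit × (Unit ⊕ I') => p.2).trans
        le_sup_right) fun i j =>
      le_sup_left (a := adjoin ℂ (Set.range (chartCoord x))) (mul_mem_of_mem (inv_mem_of_mem hSm)
        (chartMat_mem fun q => subset_adjoin ℂ (Set.range (chartCoord x)) ⟨q, rfl⟩) i j)
    have h3 : (fun p : Unit × ((Unit ⊕ I') ⊕ J) => x (Sum.inl ()) p.2)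
        = fun p => (Matrix.of (fun (_ : Unit) j => (x.toCols₁ * S) (Sum.inl ()) j) *
          (S⁻¹ * chartMat (chartCoord x))) p.1 p.2 :=
      funext fun p => congrFun (congrFun h2 (Sum.inl ())) p.2
    rw [← ratioField_comp_snd (x (Sum.inl ())), h3]
    exact h1

variable {S : Matrix ((Unit ⊕ I') ⊕ J) ((Unit ⊕ I') ⊕ J) F} [DecidableEq J] (hS : S.det ≠ 0)
  (hSm : ∀ i j, S i j ∈ ratioField (x (Sum.inl ())))
  (hS0 : ∀ l, x (Sum.inl ()) (Sum.inl (Sum.inl ())) * S (Sum.inl (Sum.inl ())) l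
    = x (Sum.inl ()) l)

include hS hSm

theorem algebraicIndependent_rows_mul_inv :
    AlgebraicIndependent (adjoin ℂ (Set.range (x (Sum.inl ()))))
      fun p : I' × ((Unit ⊕ I') ⊕ J) => (x * S⁻¹) (Sum.inr p.1) p.2 := by
  have h1 : AlgebraicIndependent ℂ (Sum.elim
      (fun p : I' × ((Unit ⊕ I') ⊕ J) => x (Sum.inr p.1) p.2) (x (Sum.inl ()))) := by
    have := hx.comp (Sum.elim (fun p : I' × ((Unit ⊕ I') ⊕ J) => (Sum.inr p.1, p.2))
      fun l => (Sum.inl (), l)) (by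
        rintro (⟨i, l⟩ | l) (⟨i', l'⟩ | l') h <;> simp_all)
    convert this using 1
    ext (p | l) <;> rfl
  refine algebraicIndependent_of_mem_adjoin (algebraicIndependent_adjoin_of_sumElim h1) rfl
    fun p => ?_
  have h2 : x (Sum.inr p.1) p.2
      = ((Matrix.of fun (i : I') l => (x * S⁻¹) (Sum.inr i) l) * S) p.1 p.2 := by
    have : x * S⁻¹ * S = x := Matrix.nonsing_inv_mul_cancel_right _ _ (Ne.isUnit hS)
    exact (congrFun (congrFun this (Sum.inr p.1)) p.2).symm
  rw [h2]
  refine mul_mem_of_mem (fun i j => subset_adjoin _ (Set.range fun p : I' × ((Unit ⊕ I') ⊕ J) =>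
    (x * S⁻¹) (Sum.inr p.1) p.2) ⟨(i, j), rfl⟩) (fun i j => ?_) _ _
  exact IntermediateField.algebraMap_mem _ (⟨S i j, ratioField_le_adjoin _ (hSm i j)⟩ :
    adjoin ℂ (Set.range (x (Sum.inl ()))))

include hS0

omit [Algebra ℂ F] hx hSm in
/-- In the coordinates given by the rows of `S`, the first row of `x` is a multiple of a basis
vector. -/
theorem firstRow_mul_inv (l : (Unit ⊕ I') ⊕ J) : (x * S⁻¹) (Sum.inl ()) l
    = if l = Sum.inl (Sum.inl ()) then x (Sum.inl ()) (Sum.inl (Sum.inl ())) else 0 := by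
  have h1 : (S * S⁻¹) (Sum.inl (Sum.inl ())) l
      = (1 : Matrix ((Unit ⊕ I') ⊕ J) ((Unit ⊕ I') ⊕ J) F) (Sum.inl (Sum.inl ())) l := by
    rw [Matrix.mul_nonsing_inv _ (Ne.isUnit hS)]
  rw [Matrix.mul_apply] at h1 ⊢
  have h2 : ∀ j, x (Sum.inl ()) j * S⁻¹ j l = x (Sum.inl ()) (Sum.inl (Sum.inl ())) *
      (S (Sum.inl (Sum.inl ())) j * S⁻¹ j l) := fun j => by rw [← mul_assoc, hS0]
  rw [Finset.sum_congr rfl fun j _ => h2 j, ← Finset.mul_sum, h1, Matrix.one_apply]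
  simp [eq_comm]

theorem toCols₁_mul_inv_det_ne_zero : (x * S⁻¹).toCols₁.det ≠ 0 := by
  have h1 := algebraicIndependent_rows_mul_inv hx hS hSm
  have h2 : (x * S⁻¹).toCols₁ = Matrix.fromBlocks
      (Matrix.of fun _ _ => x (Sum.inl ()) (Sum.inl (Sum.inl ()))) 0
      (Matrix.of fun i j => (x * S⁻¹) (Sum.inr i) (Sum.inl (Sum.inl j)))
      (Matrix.of fun i j => (x * S⁻¹) (Sum.inr i) (Sum.inl (Sum.inr j))) := by
    ext (i | i) (j | j)
    · exact (firstRow_mul_inv hS hS0 _).trans (if_pos rfl)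
    · exact (firstRow_mul_inv hS hS0 _).trans (if_neg (by simp))
    · rfl
    · rfl
  rw [h2, Matrix.det_fromBlocks_zero₁₂, Matrix.det_unique]
  refine mul_ne_zero (hx.ne_zero (Sum.inl (), Sum.inl (Sum.inl ()))) ?_
  exact det_ne_zero_of_algebraicIndependent (k := adjoin ℂ (Set.range (x (Sum.inl ()))))
    (h1.comp (fun p : I' × I' => (p.1, Sum.inl (Sum.inr p.2))) fun p q h => by
      simpa [Prod.ext_iff] using h)

theorem chartCoord_mul_inv_firstRow (j : J) : chartCoord (x * S⁻¹) (Sum.inl (), j) = 0 := by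
  have h1 := congrFun (congrFun (toCols₁_mul_chartCoord
    (toCols₁_mul_inv_det_ne_zero hx hS hSm hS0)) (Sum.inl ())) (Sum.inr j)
  rw [firstRow_mul_inv hS hS0, if_neg (by simp), Matrix.mul_apply,
    Finset.sum_eq_single (Sum.inl ())] at h1
  · have h2 : (x * S⁻¹).toCols₁ (Sum.inl ()) (Sum.inl ())
        = x (Sum.inl ()) (Sum.inl (Sum.inl ())) :=
      (firstRow_mul_inv hS hS0 _).trans (if_pos rfl)
    rw [h2] at h1
    exact (mul_eq_zero.1 h1).resolve_left (hx.ne_zero (Sum.inl (), Sum.inl (Sum.inl ())))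
  · rintro (i | i) - hi
    · exact absurd rfl hi
    · have h2 : (x * S⁻¹).toCols₁ (Sum.inl ()) (Sum.inr i) = 0 :=
        (firstRow_mul_inv hS hS0 _).trans (if_neg (by simp))
      rw [h2, zero_mul]
  · simp

/-- The lower rows of the chart coordinates of `x S⁻¹`, which are the coordinates of the subspace
with respect to the rows of `S`, are independent over the function field of `ℙW`. -/
theorem algebraicIndependent_chartCoord_mul_inv :
    AlgebraicIndependent (ratioField (x (Sum.inl ())))
      fun p : I' × J => chartCoord (x * S⁻¹) (Sum.inr p.1, p.2) := by
  refine algebraicIndependent_mono (ratioField_le_adjoin (x (Sum.inl ()))) ?_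
  let B : I' × (Unit ⊕ I') → F := fun p => (x * S⁻¹) (Sum.inr p.1) (Sum.inl p.2)
  let A : I' × J → F := fun p => chartCoord (x * S⁻¹) (Sum.inr p.1, p.2)
  have h1 : AlgebraicIndependent (adjoin ℂ (Set.range (x (Sum.inl ())))) (Sum.elim B A) := by
    refine algebraicIndependent_of_mem_adjoin (algebraicIndependent_rows_mul_inv hx hS hSm)
      (by simp [mul_add]) fun p => ?_
    have h2 := congrFun (congrFun (toCols₁_mul_chartCoord
      (toCols₁_mul_inv_det_ne_zero hx hS hSm hS0)) (Sum.inr p.1)) p.2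
    rw [← h2, Matrix.mul_apply]
    refine sum_mem fun k _ => mul_mem
      (subset_adjoin _ (Set.range (Sum.elim B A)) ⟨Sum.inl (p.1, k), rfl⟩)
      (chartMat_mem (fun q => ?_) _ _)
    rcases q with ⟨i | i, j⟩
    · rw [chartCoord_mul_inv_firstRow hx hS hSm hS0]
      exact zero_mem _
    · exact subset_adjoin _ (Set.range (Sum.elim B A)) ⟨Sum.inr (i, j), rfl⟩
  exact h1.comp Sum.inr Sum.inr_injective

/-- Over `ℙW`, the subspaces containing a given point are described by the lower rows of the chart
coordinates of `x S⁻¹`. -/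
theorem sup_adjoin_chartCoord_mul_inv :
    adjoin ℂ (Set.range (chartCoord x)) ⊔ ratioField (x (Sum.inl ()))
      = ratioField (x (Sum.inl ())) ⊔
        adjoin ℂ (Set.range fun p : I' × J => chartCoord (x * S⁻¹) (Sum.inr p.1, p.2)) := by
  refine le_antisymm (sup_le (adjoin_range_le fun p => ?_) le_sup_left)
    (sup_le le_sup_right (adjoin_range_le fun p => ?_))
  · have h1 : x = x * S⁻¹ * S := (Matrix.nonsing_inv_mul_cancel_right _ _ (Ne.isUnit hS)).symm
    have h2 : chartCoord x = chartCoord (x * S⁻¹ * S) := by rw [← h1]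
    rw [h2]
    refine chartCoord_mul_mem (toCols₁_mul_inv_det_ne_zero hx hS hSm hS0) (fun q => ?_)
      (fun i j => le_sup_left (a := ratioField (x (Sum.inl ()))) (hSm i j)) p
    rcases q with ⟨i | i, j⟩
    · rw [chartCoord_mul_inv_firstRow hx hS hSm hS0]
      exact zero_mem _
    · exact le_sup_right (a := ratioField (x (Sum.inl ()))) (subset_adjoin _ _ ⟨(i, j), rfl⟩)
  · exact chartCoord_mul_mem (toCols₁_det_ne_zero hx)
      (fun q => le_sup_left (b := ratioField (x (Sum.inl ())))
        (subset_adjoin ℂ (Set.range (chartCoord x)) ⟨q, rfl⟩))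
      (fun i j => le_sup_right (a := adjoin ℂ (Set.range (chartCoord x)))
        (inv_mem_of_mem hSm i j)) _

end FirstRow

end RatQuot

/-! ### The invariants of the generic matrix -/

namespace RatQuot

open IntermediateField

section GenericMatrix

variable {F : Type*} [Field F] [Algebra ℂ F]

omit [Algebra ℂ F] in
theorem chartCoord_smul {I J : Type*} [Fintype I] [DecidableEq I] {c : F} (hc : c ≠ 0)
    (x : Matrix I (I ⊕ J) F) : chartCoord (c • x) = chartCoord x := by
  have hB : (c • (1 : Matrix I I F)).det ≠ 0 := by
    rw [Matrix.det_smul, Matrix.det_one, mul_one]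
    exact pow_ne_zero _ hc
  rw [← chartCoord_mul hB x, Matrix.smul_mul, Matrix.one_mul]

/-- The columns of a matrix, on which `G` acts from the left, are a copy of the coordinates of the
direct sum of copies of `V`. -/
theorem projQuotField_powRep_areBirational {G V I : Type*} [Group G] [AddCommGroup V] [Module ℂ V]
    [Fintype I] [Nonempty I] (bV : Basis I ℂ V) (ρ : Representation ℂ G V) {n : ℕ} (e : Fin n ≃ I)
    {X : Matrix I I F} (hX : AlgebraicIndependent ℂ fun p : I × I => X p.1 p.2)
    (τ : G → F ≃ₐ[ℂ] F)
    (hτ : ∀ g, X.map (τ g) = (repMatrix bV ρ g).transpose.map (algebraMap ℂ F) * X) :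
    AreBirational (projQuotField (powRep ρ n))
      (fixedIn τ (ratioField fun p : I × I => X p.1 p.2)) := by
  let ε : (Σ _ : Fin n, I) ≃ I × I := (Equiv.sigmaEquivProd (Fin n) I).trans
    ((Equiv.prodComm _ _).trans ((Equiv.refl I).prodCongr e))
  rw [← ratioField_comp_equiv (fun p : I × I => X p.1 p.2) ε]
  have : Nonempty (Σ _ : Fin n, I) := ε.nonempty
  refine projQuotField_areBirational_fixedIn (Pi.basis fun _ : Fin n => bV) (powRep ρ n)
    (hX.comp ε ε.injective) τ (fun _ => 1) ?_
  rintro g ⟨j, i⟩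
  rw [one_mul, Fintype.sum_sigma, Finset.sum_eq_single j]
  · have h1 : τ g (X i (e j)) = ∑ k, algebraMap ℂ F (repMatrix bV ρ g k i) * X k (e j) :=
      congrFun (congrFun (hτ g) i) (e j)
    refine h1.trans (Finset.sum_congr rfl fun k _ => ?_)
    rw [Pi.basis_repr, Pi.basis_apply, Algebra.smul_def]
    change _ = algebraMap ℂ F (bV.repr (ρ g (Pi.single (M := fun _ => V) j (bV k) j)) i) *
      X k (e j)
    rw [Pi.single_eq_same]
    rfl
  · intro j' _ hj
    refine Finset.sum_eq_zero fun k _ => ?_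
    rw [Pi.basis_repr, Pi.basis_apply]
    change bV.repr (ρ g (Pi.single (M := fun _ => V) j' (bV k) j)) i • _ = _
    rw [Pi.single_eq_of_ne hj.symm, map_zero, map_zero, Finsupp.zero_apply, zero_smul]
  · simp

variable {G H V W I' J : Type*} [Group G] [Group H] [AlgGroup H] [AddCommGroup V] [Module ℂ V]
  [AddCommGroup W] [Module ℂ W] [Fintype I'] [DecidableEq I'] [Fintype J] [DecidableEq J]
  {ρ : Representation ℂ G V} {σ : Representation ℂ H W} (bV : Basis (Unit ⊕ I') ℂ V)
  (bW : Basis ((Unit ⊕ I') ⊕ J) ℂ W) {x : Matrix (Unit ⊕ I') ((Unit ⊕ I') ⊕ J) F}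
  (hx : AlgebraicIndependent ℂ fun p : (Unit ⊕ I') × ((Unit ⊕ I') ⊕ J) => x p.1 p.2)
  {τG : G → F ≃ₐ[ℂ] F} {τH : H → F ≃ₐ[ℂ] F}

include hx

omit [AlgGroup H] [DecidableEq I'] [DecidableEq J] in
theorem projQuotField_areBirational_firstRow
    (hτH : ∀ h, x.map (τH h) = x * (repMatrix bW σ h).map (algebraMap ℂ F)) :
    AreBirational (projQuotField σ) (fixedIn τH (ratioField (x (Sum.inl ())))) := by
  refine projQuotField_areBirational_fixedIn bW σ (hx.comp (fun l => (Sum.inl (), l))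
    fun l l' h => (Prod.ext_iff.1 h).2) τH (fun _ => 1) fun h l => ?_
  have h1 : τH h (x (Sum.inl ()) l)
      = ∑ k, x (Sum.inl ()) k * algebraMap ℂ F (repMatrix bW σ h k l) :=
    congrFun (congrFun (hτH h) (Sum.inl ())) l
  refine h1.trans ?_
  rw [one_mul]
  refine Finset.sum_congr rfl fun k _ => ?_
  rw [Algebra.smul_def, mul_comm]
  rfl

/-- The function field of the quotient by `H` of the space of the pairs of a point in the chart of
the Grassmannian and a point in the corresponding linear subspace, computed by means of the
projection to `ℙW`. -/
theorem fixedIn_sup_firstRow_areBirational (hσ : IsAlgebraicRep σ) (hτ1 : ∀ u, τH 1 u = u)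
    (hτm : ∀ g h u, τH (g * h) u = τH h (τH g u))
    (hτH : ∀ h, x.map (τH h) = x * (repMatrix bW σ h).map (algebraMap ℂ F))
    (hPW : ActsAlmostFreely σ 1) :
    AreBirational
      (fixedIn τH (adjoin ℂ (Set.range (chartCoord x)) ⊔ ratioField (x (Sum.inl ()))))
      (affineTimes (Fintype.card I' * Fintype.card J) (projQuotField σ)) := by
  let ε : (Unit ⊕ I') ⊕ J ≃ Unit ⊕ (I' ⊕ J) := Equiv.sumAssoc Unit I' J
  let w : Matrix Unit (Unit ⊕ (I' ⊕ J)) F := Matrix.of fun _ l => x (Sum.inl ()) (ε.symm l)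
  have hw : AlgebraicIndependent ℂ fun p : Unit × (Unit ⊕ (I' ⊕ J)) => w p.1 p.2 :=
    hx.comp (fun p : Unit × (Unit ⊕ (I' ⊕ J)) => (Sum.inl (), ε.symm p.2))
      fun p q h => Prod.ext rfl (ε.symm.injective (Prod.ext_iff.1 h).2)
  have hM : ∀ h, repMatrix (bW.reindex ε) σ h
      = (repMatrix bW σ h).submatrix ε.symm ε.symm := fun h => by
    ext k l
    change (bW.reindex ε).repr (σ h (bW.reindex ε k)) l
      = bW.repr (σ h (bW (ε.symm k))) (ε.symm l)
    rw [Basis.reindex_apply, Basis.repr_reindex_apply]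
  have hwτ : ∀ h, w.map (τH h)
      = w * (repMatrix (bW.reindex ε) σ h).map (algebraMap ℂ F) := fun h => by
    ext i l
    have h1 : τH h (x (Sum.inl ()) (ε.symm l))
        = ∑ k, x (Sum.inl ()) k * algebraMap ℂ F (repMatrix bW σ h k (ε.symm l)) :=
      congrFun (congrFun (hτH h) (Sum.inl ())) (ε.symm l)
    refine h1.trans ?_
    rw [hM, Matrix.mul_apply, ← ε.symm.sum_comp]
    rfl
  have hw0 : w () (Sum.inl ()) ≠ 0 := hw.ne_zero ((), Sum.inl ())
  have hK' : adjoin ℂ (Set.range (chartCoord w)) = ratioField (x (Sum.inl ())) := by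
    rw [← ratioField_row hw0]
    exact ratioField_comp_equiv (x (Sum.inl ())) ε.symm
  obtain ⟨S', hS', hSm', hS0', hSh'⟩ := exists_map_smul_eq_mul hw hσ hτ1 hτm hwτ hPW
  rw [hK'] at hSm'
  let S : Matrix ((Unit ⊕ I') ⊕ J) ((Unit ⊕ I') ⊕ J) F := S'.submatrix ε ε
  have hS : S.det ≠ 0 := by
    rw [Matrix.det_submatrix_equiv_self]
    exact hS'
  have hSm : ∀ i j, S i j ∈ ratioField (x (Sum.inl ())) := fun i j => hSm' _ _
  have hS0 : ∀ l, x (Sum.inl ()) (Sum.inl (Sum.inl ())) * S (Sum.inl (Sum.inl ())) l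
      = x (Sum.inl ()) l := fun l => by
    refine (hS0' (ε l)).trans ?_
    change x (Sum.inl ()) (ε.symm (ε l)) = _
    rw [ε.symm_apply_apply]
  have hSh : ∀ h, ∃ c : F, c ≠ 0 ∧
      c • S.map (τH h) = S * (repMatrix bW σ h).map (algebraMap ℂ F) := fun h => by
    obtain ⟨c, hc, h1⟩ := hSh' h
    refine ⟨c, hc, ?_⟩
    ext i j
    refine (congrFun (congrFun h1 (ε i)) (ε j)).trans ?_
    rw [hM, Matrix.mul_apply, ← ε.sum_comp, Matrix.mul_apply]
    refine Finset.sum_congr rfl fun k _ => ?_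
    rw [Matrix.map_apply, Matrix.submatrix_apply, ε.symm_apply_apply, ε.symm_apply_apply]
    rfl
  -- the coordinates `x S⁻¹` are transformed by scalars
  have hZ : ∀ h, ∃ c : F, c ≠ 0 ∧ (x * S⁻¹).map (τH h) = c • (x * S⁻¹) := fun h => by
    obtain ⟨c, hc, h1⟩ := hSh h
    refine ⟨c, hc, ?_⟩
    have h2 : (S.map (τH h)).det ≠ 0 := by
      have : (S.map (τH h)).det = τH h S.det := ((τH h : F →+* F).map_det S).symm
      rw [this]
      simpa using hS
    have h3 : (x * S⁻¹).map (τH h) * S.map (τH h) = x.map (τH h) := by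
      have : (x * S⁻¹ * S).map (τH h) = (x * S⁻¹).map (τH h) * S.map (τH h) :=
        Matrix.map_mul (f := (τH h : F →+* F))
      rw [← this, Matrix.nonsing_inv_mul_cancel_right _ _ (Ne.isUnit hS)]
    have h4 : c • (x * S⁻¹) * S.map (τH h) = x.map (τH h) := by
      rw [Matrix.smul_mul, ← Matrix.mul_smul, h1, ← Matrix.mul_assoc,
        Matrix.nonsing_inv_mul_cancel_right _ _ (Ne.isUnit hS), hτH]
    have h5 := congrArg (fun Q => Q * (S.map (τH h))⁻¹) (h3.trans h4.symm)
    beta_reduce at h5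
    rwa [Matrix.mul_nonsing_inv_cancel_right _ _ (Ne.isUnit h2),
      Matrix.mul_nonsing_inv_cancel_right _ _ (Ne.isUnit h2)] at h5
  rw [sup_adjoin_chartCoord_mul_inv hx hS hSm hS0]
  refine (fixedIn_sup_areBirational (Fintype.card_prod I' J)
    (algebraicIndependent_chartCoord_mul_inv hx hS hSm hS0) (fun h u hu => ?_)
    fun h p => ?_).trans ((projQuotField_areBirational_firstRow bW hx hτH).symm.affineTimes _)
  · rw [← hK'] at hu ⊢
    exact apply_chartCoord_mem hw hwτ h hu
  · obtain ⟨c, hc, h1⟩ := hZ h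
    have h2 := map_chartCoord (τH h : F →+* F) (x * S⁻¹) (Sum.inr p.1, p.2)
    have h3 : (x * S⁻¹).map (τH h : F →+* F) = c • (x * S⁻¹) := h1
    rw [h3, chartCoord_smul hc] at h2
    exact h2

/-- The field of the invariants in the field of the ratios of the entries of a generic matrix `x`.
The left block `X` is replaced by `X S`, which is transformed by `G` like `X`, and by `H` through
scalars. This gives generators `t` of the `G`-invariants over `K`, which are fixed by `H`. -/
theorem fixedIn_fixedIn_areBirational (hσ : IsAlgebraicRep σ)
    (hτG : ∀ g, x.map (τG g) = (repMatrix bV ρ g).transpose.map (algebraMap ℂ F) * x)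
    (hτ1 : ∀ u, τH 1 u = u) (hτm : ∀ g h u, τH (g * h) u = τH h (τH g u))
    (hτH : ∀ h, x.map (τH h) = x * (repMatrix bW σ h).map (algebraMap ℂ F)) {n : ℕ}
    (e : Fin n ≃ Unit ⊕ I') {L : LinearizedLineBundle σ n} (hL : L.TwistTrivial)
    (hGr : ActsAlmostFreely σ n) (hPW : ActsAlmostFreely σ 1) {d : ℕ}
    (hrat : IsRationalOfDim (projQuotField (powRep ρ n)) d) (had : Fintype.card I' ≤ d) :
    AreBirational (fixedIn τH (fixedIn τG
        (ratioField fun p : (Unit ⊕ I') × ((Unit ⊕ I') ⊕ J) => x p.1 p.2)))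
      (affineTimes (d - Fintype.card I' + Fintype.card I' * Fintype.card J)
        (projQuotField σ)) := by
  obtain ⟨S, hS, hSm, hSh⟩ := exists_toCols₁_mul_map hx hσ hτ1 hτm hτH e hL hGr
  let K := adjoin ℂ (Set.range (chartCoord x))
  let E := ratioField fun p : (Unit ⊕ I') × (Unit ⊕ I') => (x.toCols₁ * S) p.1 p.2
  have hdet := toCols₁_det_ne_zero hx
  have hX := algebraicIndependent_toCols₁_mul hx hS hSm
  have hXC : AlgebraicIndependent ℂ
      fun p : (Unit ⊕ I') × (Unit ⊕ I') => (x.toCols₁ * S) p.1 p.2 :=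
    hX.restrictScalars (algebraMap ℂ K).injective
  have h0 : (x.toCols₁ * S) (Sum.inl ()) (Sum.inl ()) ≠ 0 := hX.ne_zero (Sum.inl (), Sum.inl ())
  have hKE : K.LinearDisjoint E := linearDisjoint_ratioField hx hS hSm
  have hKH : ∀ h, ∀ u ∈ K, τH h u ∈ K := fun h u hu => apply_chartCoord_mem hx hτH h hu
  have hτX : ∀ g, x.toCols₁.map (τG g)
      = (repMatrix bV ρ g).transpose.map (algebraMap ℂ F) * x.toCols₁ := fun g =>
    congrArg Matrix.toCols₁ (hτG g)
  have hr : ∀ g, ((repMatrix bV ρ g).transpose.map (algebraMap ℂ F)).det ≠ 0 := fun g hg => by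
    have h1 := congrArg Matrix.det (hτX g)
    have h2 : (x.toCols₁.map (τG g)).det = τG g x.toCols₁.det :=
      ((τG g : F →+* F).map_det x.toCols₁).symm
    rw [Matrix.det_mul, hg, zero_mul, h2] at h1
    exact hdet ((τG g).injective (h1.trans (map_zero _).symm))
  have hKG : ∀ g, ∀ u ∈ K, τG g u = u := fun g u hu => by
    refine apply_eq_of_mem_adjoin (τG g) ?_ hu
    rintro _ ⟨p, rfl⟩
    have h1 := map_chartCoord (τG g : F →+* F) x p
    have h2 : x.map (τG g : F →+* F) = (repMatrix bV ρ g).transpose.map (algebraMap ℂ F) * x :=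
      hτG g
    rw [h2, chartCoord_mul (hr g)] at h1
    exact h1
  have hXG : ∀ g, (x.toCols₁ * S).map (τG g)
      = (repMatrix bV ρ g).transpose.map (algebraMap ℂ F) * (x.toCols₁ * S) := fun g => by
    have h1 : (x.toCols₁ * S).map (τG g) = x.toCols₁.map (τG g) * S.map (τG g) :=
      Matrix.map_mul (f := (τG g : F →+* F))
    have h2 : S.map (τG g) = S := by
      ext i j
      exact hKG g _ (hSm i j)
    rw [h1, h2, hτX, Matrix.mul_assoc]
  have hEG : ∀ g, ∀ u ∈ E, τG g u ∈ E := fun g u hu => by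
    refine apply_mem_ratioField (τG g) (i₀ := (Sum.inl (), Sum.inl ())) h0 (fun p => ?_) hu
    have h1 : τG g ((x.toCols₁ * S) p.1 p.2) = ((repMatrix bV ρ g).transpose.map
        (algebraMap ℂ F) * (x.toCols₁ * S)) p.1 p.2 := congrFun (congrFun (hXG g) p.1) p.2
    rw [h1, Matrix.mul_apply, Finset.sum_div]
    refine sum_mem fun k _ => ?_
    rw [mul_div_assoc]
    exact mul_mem (E.algebraMap_mem _) (div_mem_ratioField
      (fun p : (Unit ⊕ I') × (Unit ⊕ I') => (x.toCols₁ * S) p.1 p.2) (k, p.2) _)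
  have hEH : ∀ h, ∀ u ∈ E, τH h u = u := fun h u hu => by
    obtain ⟨c, hc, h1⟩ := hSh h
    exact apply_eq_of_mem_ratioField (τH h) hc
      (fun p => congrFun (congrFun h1 p.1) p.2) hu
  obtain ⟨t, ht, htE⟩ := exists_adjoin_eq_of_isRationalOfDim
    ((projQuotField_powRep_areBirational bV ρ e hXC τG hXG).symm.trans hrat)
  have htE' : ∀ i, t i ∈ E := fun i => fixedIn_le τG E (htE ▸ subset_adjoin _ _ ⟨i, rfl⟩)
  have h1 : fixedIn τG (ratioField fun p : (Unit ⊕ I') × ((Unit ⊕ I') ⊕ J) => x p.1 p.2)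
      = K ⊔ adjoin ℂ (Set.range t) := by
    rw [ratioField_eq_sup hx hS hSm, sup_comm, fixedIn_sup τG hKE.symm hEG hKG, htE, sup_comm]
  have h2 : AreBirational (fixedIn τH (K ⊔ adjoin ℂ (Set.range t)))
      (affineTimes d (fixedIn τH K)) :=
    fixedIn_sup_areBirational (Fintype.card_fin d)
      (algebraicIndependent_of_linearDisjoint hKE ht htE') hKH fun h i => hEH h _ (htE' i)
  have h3 : AreBirational (fixedIn τH (K ⊔ ratioField ((x.toCols₁ * S) (Sum.inl ()))))
      (affineTimes (Fintype.card I') (fixedIn τH K)) :=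
    fixedIn_sup_ratioField_areBirational rfl
      (hX.comp (fun j => (Sum.inl (), j)) fun j j' h => (Prod.ext_iff.1 h).2) hKH fun h => by
      obtain ⟨c, hc, h1⟩ := hSh h
      exact ⟨c, hc, fun i => congrFun (congrFun h1 (Sum.inl ())) i⟩
  rw [sup_ratioField_firstRow hx hS hSm] at h3
  have h4 := fixedIn_sup_firstRow_areBirational bW hx hσ hτ1 hτm hτH hPW
  have h5 := areBirational_affineTimes_affineTimes (fixedIn τH K) (d - Fintype.card I')
    (Fintype.card I')
  rw [Nat.sub_add_cancel had] at h5
  rw [h1]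
  exact (h2.trans h5.symm).trans (((h3.symm.trans h4).affineTimes _).trans
    (areBirational_affineTimes_affineTimes _ _ _))

end GenericMatrix

end RatQuot

/-! ### The coordinates of the tensor product -/

namespace RatQuot

section RatSubst

variable {G V : Type*} [Group G] [AddCommGroup V] [Module ℂ V] (ρ : Representation ℂ G V)

theorem ratSubst_algebraMap (L : V ≃ₗ[ℂ] V) (p : PolyRing V) :
    ratSubst L (algebraMap (PolyRing V) (RatFun V) p)
      = algebraMap (PolyRing V) (RatFun V) (polySubst L p) :=
  IsFractionRing.algEquivOfAlgEquiv_algebraMap (polySubst L) p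

theorem ratSubst_repEquiv_one (u : RatFun V) : ratSubst (repEquiv ρ 1) u = u := by
  have h1 : ∀ p : PolyRing V, polySubst (repEquiv ρ 1) p = p := fun p => by
    refine Subtype.ext (funext fun v => ?_)
    change p.1 (ρ 1 v) = p.1 v
    rw [map_one]
    rfl
  obtain ⟨p, q, -, rfl⟩ := IsFractionRing.div_surjective (A := PolyRing V) u
  rw [map_div₀, ratSubst_algebraMap, ratSubst_algebraMap, h1, h1]

theorem ratSubst_repEquiv_mul (g h : G) (u : RatFun V) :
    ratSubst (repEquiv ρ (g * h)) u = ratSubst (repEquiv ρ h) (ratSubst (repEquiv ρ g) u) := by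
  have h1 : ∀ p : PolyRing V, polySubst (repEquiv ρ (g * h)) p
      = polySubst (repEquiv ρ h) (polySubst (repEquiv ρ g) p) := fun p => by
    refine Subtype.ext (funext fun v => ?_)
    change p.1 (ρ (g * h) v) = p.1 (ρ g (ρ h v))
    rw [map_mul]
    rfl
  obtain ⟨p, q, -, rfl⟩ := IsFractionRing.div_surjective (A := PolyRing V) u
  rw [map_div₀, ratSubst_algebraMap, ratSubst_algebraMap, h1, h1, map_div₀, map_div₀,
    ratSubst_algebraMap, ratSubst_algebraMap, ratSubst_algebraMap, ratSubst_algebraMap]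

end RatSubst

section TensorCoord

variable {G H V W κ ι : Type*} [Group G] [Group H] [AddCommGroup V] [Module ℂ V]
  [AddCommGroup W] [Module ℂ W] [Fintype κ] [Fintype ι] (bV : Basis κ ℂ V) (bW : Basis ι ℂ W)
  (ρ : Representation ℂ G V) (σ : Representation ℂ H W)

/-- The coordinates of `V ⊗ W`, as the entries of a matrix. -/
noncomputable def tensorCoord : Matrix κ ι (RatFun (V ⊗[ℂ] W)) :=
  Matrix.of fun i l => ratCoord (bV.tensorProduct bW) (i, l)

/-- Representation matrices act on row vectors of basis elements; hence the transpose for the rows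
of the coordinate matrix, which are indexed by the basis of `V`. -/
theorem tensorCoord_map (g : G) (h : H) :
    (tensorCoord bV bW).map (ratSubst (repEquiv (extTensor ρ σ) (g, h)))
      = (repMatrix bV ρ g).transpose.map (algebraMap ℂ (RatFun (V ⊗[ℂ] W))) *
        (tensorCoord bV bW * (repMatrix bW σ h).map (algebraMap ℂ (RatFun (V ⊗[ℂ] W)))) := by
  ext i l
  refine (ratSubst_ratCoord (bV.tensorProduct bW) _ (i, l)).trans ?_
  rw [Matrix.mul_apply, Fintype.sum_prod_type]
  refine Finset.sum_congr rfl fun k _ => ?_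
  rw [Matrix.mul_apply, Finset.mul_sum]
  refine Finset.sum_congr rfl fun m _ => ?_
  have h1 : repEquiv (extTensor ρ σ) (g, h) (bV.tensorProduct bW (k, m))
      = ρ g (bV k) ⊗ₜ[ℂ] σ h (bW m) := by
    rw [Basis.tensorProduct_apply]
    rfl
  rw [h1, Basis.tensorProduct_repr_tmul_apply, Algebra.smul_def, smul_eq_mul, map_mul]
  change algebraMap ℂ _ (repMatrix bW σ h m l) * algebraMap ℂ _ (repMatrix bV ρ g k i) *
    tensorCoord bV bW k m = algebraMap ℂ _ (repMatrix bV ρ g k i) *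
      (tensorCoord bV bW k m * algebraMap ℂ _ (repMatrix bW σ h m l))
  ring

/-- The invariants of `G × H` are the `H`-invariants among the `G`-invariants. -/
theorem projQuotField_extTensor [Nonempty κ] [Nonempty ι] :
    projQuotField (extTensor ρ σ)
      = fixedIn (fun h => ratSubst (repEquiv (extTensor ρ σ) (1, h)))
        (fixedIn (fun g => ratSubst (repEquiv (extTensor ρ σ) (g, 1)))
          (ratioField fun p : κ × ι => tensorCoord bV bW p.1 p.2)) := by
  have h1 : projField (V ⊗[ℂ] W) = ratioField fun p : κ × ι => tensorCoord bV bW p.1 p.2 :=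
    projField_eq_ratioField (bV.tensorProduct bW)
  rw [← h1]
  ext u
  refine ⟨fun hu => ⟨⟨hu.1, fun g => hu.2 _⟩, fun h => hu.2 _⟩, fun hu => ⟨hu.1.1, ?_⟩⟩
  rintro ⟨g, h⟩
  have h2 : ((g, h) : G × H) = (g, 1) * (1, h) := by simp
  rw [h2, ratSubst_repEquiv_mul, hu.1.2 g, hu.2 h]

end TensorCoord

end RatQuot

theorem mainTheorem3 {G H V W : Type*} [Group G] [RatQuot.AlgGroup G] [Group H]
    [RatQuot.AlgGroup H] [AddCommGroup V] [Module ℂ V] [FiniteDimensional ℂ V]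
    [AddCommGroup W] [Module ℂ W] [FiniteDimensional ℂ W]
    (ρ : Representation ℂ G V) (hρ : RatQuot.IsAlgebraicRep ρ)
    (σ : Representation ℂ H W) (hσ : RatQuot.IsAlgebraicRep σ)
    (a b d : ℕ) (ha : Module.finrank ℂ V = a + 1) (hb : Module.finrank ℂ W = b + 1)
    (hab : a < b)
    (hL : ∃ L : RatQuot.LinearizedLineBundle σ (a + 1), L.TwistTrivial)
    (hPW : RatQuot.ActsAlmostFreely σ 1)
    (hGr : RatQuot.ActsAlmostFreely σ (a + 1))
    (hrat : RatQuot.IsRationalOfDim ↥(RatQuot.projQuotField (RatQuot.powRep ρ (a + 1))) d)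
    (had : a ≤ d) :
    RatQuot.AreBirational ↥(RatQuot.projQuotField (RatQuot.extTensor ρ σ))
      (RatQuot.affineTimes (d - a + a * (b - a)) ↥(RatQuot.projQuotField σ)) := by
  obtain ⟨L, hL⟩ := hL
  let e : Fin (a + 1) ≃ Unit ⊕ Fin a := Fintype.equivOfCardEq (by simp [add_comm])
  let e' : Fin (b + 1) ≃ (Unit ⊕ Fin a) ⊕ Fin (b - a) := Fintype.equivOfCardEq (by simp; omega)
  let bV := (finBasisOfFinrankEq ℂ V ha).reindex e
  let bW := (finBasisOfFinrankEq ℂ W hb).reindex e'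
  rw [RatQuot.projQuotField_extTensor bV bW ρ σ]
  have h1 := RatQuot.fixedIn_fixedIn_areBirational (ρ := ρ) (σ := σ) bV bW
    (x := RatQuot.tensorCoord bV bW)
    (RatQuot.algebraicIndependent_ratCoord (bV.tensorProduct bW))
    (τG := fun g => RatQuot.ratSubst (RatQuot.repEquiv (RatQuot.extTensor ρ σ) (g, 1)))
    (τH := fun h => RatQuot.ratSubst (RatQuot.repEquiv (RatQuot.extTensor ρ σ) (1, h))) hσ
    (fun g => by
      rw [RatQuot.tensorCoord_map, RatQuot.repMatrix_one,
        Matrix.map_one _ (map_zero _) (map_one _), Matrix.mul_one])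
    (fun u => RatQuot.ratSubst_repEquiv_one _ u)
    (fun g h u => by
      rw [← RatQuot.ratSubst_repEquiv_mul, Prod.mk_mul_mk, one_mul])
    (fun h => by
      rw [RatQuot.tensorCoord_map, RatQuot.repMatrix_one, Matrix.transpose_one,
        Matrix.map_one _ (map_zero _) (map_one _), Matrix.one_mul])
    e hL hGr hPW hrat (by rwa [Fintype.card_fin])
  rwa [Fintype.card_fin, Fintype.card_fin] at h1
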